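/- **Setting.** Let $(M,\omega,J,B=\omega(\cdot,J\cdot))$ be a compact connected Kähler manifold of complex dimension $n$, with Liouville volume form $\varepsilon_\omega=\omega^{\wedge n}/n!$. Let a compact connected Lie group $G$ with Lie algebra $\mathfrak g$ act smoothly on $M$, preserving $\omega$ and $J$, and let $X^\xi(x)=\frac{d}{dt}\big|_{t=0}e^{t\xi}\cdot x$ for $\xi\in\mathfrak g$. Assume that the action has an equivariant moment map $\Phi:M\to\mathfrak g^*$, $\phi_\xi(x)=\Phi(x)(\xi)$, $\mathfrak i(X^\xi)\omega=d\phi_\xi$, that $0$ is a regular value of $\Phi$, and that $G$ acts freely on $\Phi^{-1}(0)$. For $\xi\in\mathfrak g$ and $x\in M$ let $t\mapsto e^{it\xi}\cdot x$ be the integral curve through $x$ of the vector field $X^{i\xi}:=JX^\xi$ (it exists for all $t\in\mathbb R$; this is the action of $e^{it\xi}\in G_{\mathbb C}$ on $M$). Let $\ell\to M$ be a Hermitian line bundle with compatible connection $\nabla$ of curvature $-i\omega$, and let $k\ge 0$ be an integer. A smooth section of $\ell^{\otimes k}$ is holomorphic if it is covariantly constant in the $(0,1)$-directions, and $G$-invariant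 if $Q_\xi s:=(\nabla_{X^\xi}-ik\phi_\xi)s=0$ for all $\xi\in\mathfrak g$. Let $\sqrt K$ be a square root of the canonical bundle $K$ of $M$; its holomorphic structure and the Lie derivative of its sections are determined by squaring, $2(\nabla_Z\nu)\nu=\nabla_Z(\nu^2)=\mathfrak i(Z)\,d(\nu^2)$ for $Z$ of type $(0,1)$ and $2(\mathcal L_{X^\xi}\nu)\nu=\mathcal L_{X^\xi}(\nu^2)$, and its Hermitian structure $|\nu|^2=(\nu,\nu)\ge 0$ is given by $\nu^2\wedge\overline{\nu}^{\,2}=c_n(\nu,\nu)^2\varepsilon_\omega$, with the constant $c_n$ of modulus $1$, depending only on $n$, that makes this possible. A smooth section $r$ of $\ell^{\otimes k}\otimes\sqrt K$ is holomorphic if it is covariantly constant in the $(0,1)$-directions, and $G$-invariant if $(Q_\xi\otimes 1+1\otimes\mathcal L_{X^\xi})r=0$ for all $\xi\in\mathfrak g$. **Theorem.** Let $x_0\in\Phi^{-1}(0)$ and $\xi\in\mathfrak g$. (a) For every $G$-invariant holomorphic section $s$ of $\ell^{\otimes k}$, $$|s|^2(e^{i\xi}\cdot x_0)=|s|^2(x_0)\exp\Big\{-\int_0^1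 2k\,\phi_\xi(e^{it\xi}\cdot x_0)\,dt\Big\}.$$ (b) For every $G$-invariant holomorphic section $r$ of $\ell^{\otimes k}\otimes\sqrt K$, $$|r|^2(e^{i\xi}\cdot x_0)=|r|^2(x_0)\exp\Big\{-\int_0^1\Big(2k\,\phi_\xi(e^{it\xi}\cdot x_0)+\frac{\mathcal L_{JX^\xi}\varepsilon_\omega}{2\varepsilon_\omega}(e^{it\xi}\cdot x_0)\Big)dt\Big\}.$$ Furthermore, let $\rho(\xi,x_0):=2\int_0^1\phi_\xi(e^{it\xi}\cdot x_0)\,dt$. Then for each fixed $x_0\in\Phi^{-1}(0)$ the function $\rho(\cdot,x_0)$ on $\mathfrak g$ achieves its unique minimum at $\xi=0$; it is differentiable near $\xi=0$ and twice differentiable at $\xi=0$, and its Hessian there is $$D_{\xi_1}D_{\xi_2}\rho(\xi,x_0)\big|_{\xi=0}=2B_{x_0}(JX^{\xi_1},JX^{\xi_2}),\qquad \xi_1,\xi_2\in\mathfrak g.$$ -/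

import Mathlib

open scoped Manifold ContDiff

noncomputable section

/-! ## Differential forms on complex manifolds

A complex manifold `M` of complex dimension `n` is charted on `ℂⁿ`.  As everywhere in Mathlib, the
real tangent space `T_x M` *is* the model space `ℂⁿ` (through the preferred chart at `x`), and the
complex structure `J` of `M` is multiplication by `√-1` on it. -/

/-- The model space `ℂⁿ`. -/
abbrev Cn (n : ℕ) : Type := EuclideanSpace ℂ (Fin n)

/-- The complex structure `J` on the tangent space `T_x M = ℂⁿ`. -/
def cJ {n : ℕ} (v : Cn n) : Cn n := Complex.I • v

/-- (Not necessarily smooth) real differential `k`-forms on `M` with values in `F`. -/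
abbrev DiffForm (n k : ℕ) (M F : Type*) [NormedAddCommGroup F] [NormedSpace ℝ F] : Type _ :=
  M → (Cn n) [⋀^Fin k]→L[ℝ] F

section Forms

variable {n k : ℕ} {M F : Type*} [TopologicalSpace M] [ChartedSpace (Cn n) M]
  [NormedAddCommGroup F] [NormedSpace ℝ F]

/-- The differential `df_x : T_x M → F` of a function `f : M → F`. -/
def dFun (f : M → F) (x : M) : Cn n →L[ℝ] F :=
  mfderiv 𝓘(ℝ, Cn n) 𝓘(ℝ, F) f x

/-- The differential at `e ∈ ℂⁿ` of the inverse of the preferred chart at `x`, that is, the linear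
map sending a coordinate vector to the tangent vector of `M` it represents. -/
def chartDeriv (x : M) (e : Cn n) : Cn n →L[ℝ] Cn n :=
  mfderiv 𝓘(ℝ, Cn n) 𝓘(ℝ, Cn n) (extChartAt 𝓘(ℝ, Cn n) x).symm e

/-- The coordinate expression, in the preferred chart at `x`, of a vector field on `M`. -/
def fieldInChart (V : M → Cn n) (x : M) (e : Cn n) : Cn n :=
  ContinuousLinearMap.inverse (chartDeriv x e) (V ((extChartAt 𝓘(ℝ, Cn n) x).symm e))

/-- The coordinate expression of a differential form in the preferred chart at `x`. -/
def DiffForm.inChart (α : DiffForm n k M F) (x : M) (e : Cn n) : (Cn n) [⋀^Fin k]→L[ℝ] F :=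
  (α ((extChartAt 𝓘(ℝ, Cn n) x).symm e)).compContinuousLinearMap (chartDeriv x e)

/-- Smoothness of a differential form on a set: its coordinate expressions are smooth. -/
def DiffForm.SmoothOn (α : DiffForm n k M F) (U : Set M) : Prop :=
  ∀ x : M, ContDiffOn ℝ ∞ (DiffForm.inChart α x)
    ((extChartAt 𝓘(ℝ, Cn n) x).target ∩ (extChartAt 𝓘(ℝ, Cn n) x).symm ⁻¹' U)

/-- The exterior derivative, computed at `x` in the preferred chart at `x`. -/
def DiffForm.d (α : DiffForm n k M F) : DiffForm n (k + 1) M F :=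
  fun x => extDeriv (DiffForm.inChart α x) (extChartAt 𝓘(ℝ, Cn n) x x)

/-- The Lie derivative of a covariant `k`-tensor field `α` along the vector field `V`, by the
coordinate formula
`(L_V α)(v₁,…,v_k) = V(α(v₁,…,v_k)) + ∑ⱼ α(v₁,…,DV(vⱼ),…,v_k)`
(with `v₁,…,v_k` constant in the chart), evaluated at `x` in the preferred chart at `x`. -/
def lieDeriv (V : M → Cn n) (α : M → (Fin k → Cn n) → F) (x : M) (v : Fin k → Cn n) : F :=
  fderiv ℝ (fun e : Cn n => α ((extChartAt 𝓘(ℝ, Cn n) x).symm e) (fun j => chartDeriv x e (v j)))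
      (extChartAt 𝓘(ℝ, Cn n) x x) (V x) +
    ∑ j : Fin k, α x (Function.update v j
      (fderiv ℝ (fieldInChart V x) (extChartAt 𝓘(ℝ, Cn n) x x) (v j)))

/-- A form of degree `n` is an `(n,0)`-form if `i(Jv) α = √-1 i(v) α`, i.e. if it is
complex multilinear. -/
def DiffForm.IsTypeN0 (α : DiffForm n n M ℂ) : Prop :=
  ∀ (x : M) (v : Fin n → Cn n) (j : Fin n),
    α x (Function.update v j (cJ (v j))) = Complex.I * α x v

/-- The standard complex frame `∂/∂z₁, …, ∂/∂zₙ` of `ℂⁿ`. -/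
def complexFrame (n : ℕ) : Fin n → Cn n := fun j => EuclideanSpace.single j (1 : ℂ)

/-- An `(n,0)`-form is holomorphic on `U` if in each chart the coefficient of `dz₁ ∧ ⋯ ∧ dzₙ` is a
holomorphic function. -/
def DiffForm.IsHolomorphicOn (α : DiffForm n n M ℂ) (U : Set M) : Prop :=
  DiffForm.IsTypeN0 α ∧
  ∀ x : M, DifferentiableOn ℂ (fun e => DiffForm.inChart α x e (complexFrame n))
    ((extChartAt 𝓘(ℝ, Cn n) x).target ∩ (extChartAt 𝓘(ℝ, Cn n) x).symm ⁻¹' U)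

/-- The standard real frame `e₁, √-1 e₁, e₂, √-1 e₂, …` of `ℂⁿ = ℝ²ⁿ`.  It serves to form quotients
of top-degree forms. -/
def realFrame (n : ℕ) : Fin (2 * n) → Cn n := fun m =>
  EuclideanSpace.single (⟨m.1 / 2, by omega⟩ : Fin n) (if m.1 % 2 = 0 then (1 : ℂ) else Complex.I)

/-- The `2n`-form `α ∧ ᾱ` for a complex-valued `n`-form `α`. -/
def wedgeConj (α : DiffForm n n M ℂ) (x : M) (v : Fin (2 * n) → Cn n) : ℂ :=
  ((n.factorial : ℂ) * (n.factorial : ℂ))⁻¹ * ∑ σ : Equiv.Perm (Fin (2 * n)),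
    ((Equiv.Perm.sign σ : ℤ) : ℂ) *
      (α x (fun i : Fin n => v (σ ⟨i.1, by omega⟩)) *
        (starRingEnd ℂ) (α x (fun i : Fin n => v (σ ⟨n + i.1, by omega⟩))))

end Forms

/-! ## Kähler manifolds -/

/-- A Kähler structure on the complex manifold `M`: a smooth closed real two-form `ω` such that
`ω(J·,J·) = ω` and such that `B = ω(·,J·)` is positive definite. -/
structure KahlerStructure (n : ℕ) (M : Type*) [TopologicalSpace M] [ChartedSpace (Cn n) M] where
  form : DiffForm n 2 M ℝ
  smooth : DiffForm.SmoothOn form Set.univ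
  closed : ∀ x, DiffForm.d form x = 0
  compat : ∀ x v w, form x ![cJ v, cJ w] = form x ![v, w]
  pos : ∀ x v, v ≠ 0 → 0 < form x ![v, cJ v]

namespace KahlerStructure

variable {n : ℕ} {M : Type*} [TopologicalSpace M] [ChartedSpace (Cn n) M]

/-- The Riemannian metric `B = ω(·,J·)`. -/
def metric (W : KahlerStructure n M) (x : M) (v w : Cn n) : ℝ := W.form x ![v, cJ w]

/-- The Liouville volume form `ε_ω = ωⁿ / n!`, as
`ε_ω(v₁,…,v₂ₙ) = (2ⁿ n!)⁻¹ ∑_σ sgn(σ) ∏ᵢ ω(v_σ(2i-1), v_σ(2i))`. -/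
def liouville (W : KahlerStructure n M) (x : M) (v : Fin (2 * n) → Cn n) : ℝ :=
  ((2 : ℝ) ^ n * (n.factorial : ℝ))⁻¹ * ∑ σ : Equiv.Perm (Fin (2 * n)),
    ((Equiv.Perm.sign σ : ℤ) : ℝ) *
      ∏ i : Fin n, W.form x ![v (σ ⟨2 * i.1, by omega⟩), v (σ ⟨2 * i.1 + 1, by omega⟩)]

/-- The function `L_V ε_ω / ε_ω`. -/
def liouvilleRate (W : KahlerStructure n M) (V : M → Cn n) (x : M) : ℝ :=
  lieDeriv V W.liouville x (realFrame n) / W.liouville x (realFrame n)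

end KahlerStructure

/-! ## Hamiltonian actions

`G` is a Lie group modelled on the vector space `𝔤`, so that its Lie algebra `T_1 G` is `𝔤`. -/

section Actions

variable {n : ℕ} {M : Type*} [TopologicalSpace M] [ChartedSpace (Cn n) M]
  {𝔤 : Type*} [NormedAddCommGroup 𝔤] [NormedSpace ℝ 𝔤]
  {G : Type*} [TopologicalSpace G] [ChartedSpace 𝔤 G] [Group G]

/-- The infinitesimal action `X^ξ(x) = d/dt|₀ (exp(tξ) · x)`: the image of `ξ ∈ T_1 G` under the
differential at `1` of the orbit map `g ↦ g · x`. -/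
def fundField (n : ℕ) {M : Type*} [TopologicalSpace M] [ChartedSpace (Cn n) M]
    {𝔤 : Type*} [NormedAddCommGroup 𝔤] [NormedSpace ℝ 𝔤]
    (G : Type*) [TopologicalSpace G] [ChartedSpace 𝔤 G] [Group G] [MulAction G M]
    (ξ : 𝔤) (x : M) : Cn n :=
  let D : 𝔤 →L[ℝ] Cn n := mfderiv 𝓘(ℝ, 𝔤) 𝓘(ℝ, Cn n) (fun g : G => g • x) (1 : G)
  D ξ

/-- The adjoint action of `G` on its Lie algebra. -/
def AdG (g : G) : 𝔤 →L[ℝ] 𝔤 :=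
  mfderiv 𝓘(ℝ, 𝔤) 𝓘(ℝ, 𝔤) (fun h : G => g * h * g⁻¹) (1 : G)

/-- The differential of `x ↦ g · x`. -/
def actDeriv (n : ℕ) {M : Type*} [TopologicalSpace M] [ChartedSpace (Cn n) M]
    {G : Type*} [Group G] [MulAction G M] (g : G) (x : M) : Cn n →L[ℝ] Cn n :=
  mfderiv 𝓘(ℝ, Cn n) 𝓘(ℝ, Cn n) (fun y : M => g • y) x

end Actions

/-- A smooth action of `G` on the Kähler manifold `M`, preserving the complex and the symplectic
structure, with equivariant moment map `Φ : M → 𝔤*`, `φ_ξ(x) = Φ(x)(ξ)`, such that `0` is a regular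
value of `Φ` and `G` acts freely on `Φ⁻¹(0)`. -/
structure HamiltonianAction {n : ℕ} {M : Type*} [TopologicalSpace M] [ChartedSpace (Cn n) M]
    (W : KahlerStructure n M) (𝔤 : Type*) [NormedAddCommGroup 𝔤] [NormedSpace ℝ 𝔤]
    (G : Type*) [TopologicalSpace G] [ChartedSpace 𝔤 G] [Group G] [MulAction G M] where
  smooth_smul : ContMDiff (𝓘(ℝ, 𝔤).prod 𝓘(ℝ, Cn n)) 𝓘(ℝ, Cn n) ∞ (fun p : G × M => p.1 • p.2)
  holomorphic_smul : ∀ g : G, MDifferentiable 𝓘(ℂ, Cn n) 𝓘(ℂ, Cn n) (fun x : M => g • x)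
  symplectic_smul : ∀ (g : G) (x : M) (v w : Cn n),
    W.form (g • x) ![actDeriv n g x v, actDeriv n g x w] = W.form x ![v, w]
  moment : M → (𝔤 →L[ℝ] ℝ)
  smooth_moment : ContMDiff 𝓘(ℝ, Cn n) 𝓘(ℝ, 𝔤 →L[ℝ] ℝ) ∞ moment
  /-- `i(X^ξ) ω = dφ_ξ` -/
  hamiltonian : ∀ (ξ : 𝔤) (x : M) (v : Cn n),
    W.form x ![fundField n G ξ x, v] =
      dFun (fun y => moment y ξ) x v
  equivariant : ∀ (g : G) (x : M) (ξ : 𝔤), moment (g • x) ξ = moment x (AdG g⁻¹ ξ)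
  regular : ∀ x, moment x = 0 → Function.Surjective (dFun (n := n) moment x)
  free : ∀ x, moment x = 0 → ∀ g : G, g • x = x → g = 1

namespace HamiltonianAction

variable {n : ℕ} {M : Type*} [TopologicalSpace M] [ChartedSpace (Cn n) M]
  {W : KahlerStructure n M} {𝔤 : Type*} [NormedAddCommGroup 𝔤] [NormedSpace ℝ 𝔤]
  {G : Type*} [TopologicalSpace G] [ChartedSpace 𝔤 G] [Group G] [MulAction G M]

/-- The vector field `X^ξ`. -/
def X (_A : HamiltonianAction W 𝔤 G) (ξ : 𝔤) : M → Cn n := fundField n G ξ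

/-- The vector field `X^{iξ} = J X^ξ`. -/
def JX (A : HamiltonianAction W 𝔤 G) (ξ : 𝔤) : M → Cn n := fun x => cJ (A.X ξ x)

/-- `JX^ξ` as a section of Mathlib's tangent bundle. -/
def JXfield (A : HamiltonianAction W 𝔤 G) (ξ : 𝔤) (x : M) : TangentSpace 𝓘(ℝ, Cn n) x :=
  A.JX ξ x

open Classical in
/-- The point `e^{iξ} · x`: the value at time `1` of the integral curve of `X^{iξ} = J X^ξ` through
`x`, i.e. the action of `e^{iξ} ∈ G_ℂ` for the action of `G_ℂ` on `M` whose infinitesimal action is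
`X^{iξ} = J X^ξ`. -/
def expI (A : HamiltonianAction W 𝔤 G) (ξ : 𝔤) (x : M) : M :=
  if h : ∃ γ : ℝ → M, γ 0 = x ∧ IsMIntegralCurve γ (A.JXfield ξ) then h.choose 1 else x

/-- `ρ(ξ, x₀) = 2 ∫₀¹ φ_ξ(e^{itξ} · x₀) dt`. -/
def rho (A : HamiltonianAction W 𝔤 G) (ξ : 𝔤) (x : M) : ℝ :=
  2 * ∫ t in (0 : ℝ)..1, A.moment (A.expI (t • ξ) x) ξ

end HamiltonianAction

/-! ## The prequantum line bundle and its powers -/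

/-- A Hermitian line bundle `ℓ` with compatible connection of curvature `-√-1 ω`, given by unitary
frames `eᵢ` over the members `Uᵢ` of an open cover, with `eⱼ = gᵢⱼ eᵢ` on `Uᵢ ∩ Uⱼ` and
`∇ eᵢ = -√-1 θᵢ eᵢ` for real one-forms `θᵢ`.
A section of `ℓ` is a family of functions with `s = sᵢ eᵢ` on `Uᵢ`, so `sᵢ = gᵢⱼ sⱼ`. -/
structure PrequantumBundle {n : ℕ} {M : Type*} [TopologicalSpace M] [ChartedSpace (Cn n) M]
    (W : KahlerStructure n M) (ι : Type*) where
  U : ι → Set M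
  isOpen_U : ∀ i, IsOpen (U i)
  indexAt : M → ι
  mem_indexAt : ∀ x, x ∈ U (indexAt x)
  g : ι → ι → M → ℂ
  smooth_g : ∀ i j, ContMDiffOn 𝓘(ℝ, Cn n) 𝓘(ℝ, ℂ) ∞ (g i j) (U i ∩ U j)
  unitary : ∀ i j, ∀ x ∈ U i ∩ U j, ‖g i j x‖ = 1
  cocycle : ∀ i j l, ∀ x ∈ U i ∩ U j ∩ U l, g i j x * g j l x = g i l x
  θ : ι → DiffForm n 1 M ℝ
  smooth_θ : ∀ i, DiffForm.SmoothOn (θ i) (U i)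
  /-- the change of the connection form: `-√-1 θⱼ = -√-1 θᵢ + gᵢⱼ⁻¹ dgᵢⱼ` -/
  change_θ : ∀ i j, ∀ x ∈ U i ∩ U j, ∀ v : Cn n,
    dFun (g i j) x v =
      -Complex.I * ((θ j x ![v] - θ i x ![v] : ℝ) : ℂ) * g i j x
  /-- the curvature is `d(-√-1 θᵢ) = -√-1 ω` -/
  curvature : ∀ i, ∀ x ∈ U i, DiffForm.d (θ i) x = W.form x

namespace PrequantumBundle

variable {n : ℕ} {M : Type*} [TopologicalSpace M] [ChartedSpace (Cn n) M]
  {W : KahlerStructure n M} {ι : Type*}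

/-- The covariant derivative of `f eᵢ^k` (`f` a function) at `x` along `v`, with respect to the
connection on `ℓ^{⊗k}` induced from that of `ℓ`:
`∇_v (f eᵢ^k) = (df(v) - √-1 k θᵢ(v) f) eᵢ^k`. -/
def nabla (L : PrequantumBundle W ι) (k : ℕ) (i : ι) (f : M → ℂ) (x : M) (v : Cn n) : ℂ :=
  dFun f x v
    - Complex.I * (k : ℂ) * ((L.θ i x ![v] : ℝ) : ℂ) * f x

/-- Smooth sections of `ℓ^{⊗k}`: `s = sᵢ eᵢ^k` on `Uᵢ`. -/
structure Sections (L : PrequantumBundle W ι) (k : ℕ) where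
  coeff : ι → M → ℂ
  smooth : ∀ i, ContMDiffOn 𝓘(ℝ, Cn n) 𝓘(ℝ, ℂ) ∞ (coeff i) (L.U i)
  compat : ∀ i j, ∀ x ∈ L.U i ∩ L.U j, coeff i x = L.g i j x ^ k * coeff j x

namespace Sections

variable {L : PrequantumBundle W ι} {k : ℕ}

/-- The pointwise magnitude squared `|s|²(x)` (independent of the frame). -/
def normSq (s : L.Sections k) (x : M) : ℝ := ‖s.coeff (L.indexAt x) x‖ ^ 2

/-- `s` is holomorphic: it is covariantly constant in the `(0,1)`-directions `v + √-1 Jv`. -/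
def IsHolomorphic (s : L.Sections k) : Prop :=
  ∀ i, ∀ x ∈ L.U i, ∀ v : Cn n,
    L.nabla k i (s.coeff i) x v + Complex.I * L.nabla k i (s.coeff i) x (cJ v) = 0

/-- `s` is `G`-invariant: it is annihilated by the action
`Q_ξ = ∇_{X^ξ} - √-1 k φ_ξ` of the Lie algebra of the (connected) group `G`. -/
def IsInvariant {𝔤 : Type*} [NormedAddCommGroup 𝔤] [NormedSpace ℝ 𝔤]
    {G : Type*} [TopologicalSpace G] [ChartedSpace 𝔤 G] [Group G] [MulAction G M]
    (A : HamiltonianAction W 𝔤 G) (s : L.Sections k) : Prop :=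
  ∀ (ξ : 𝔤) (i : ι), ∀ x ∈ L.U i,
    L.nabla k i (s.coeff i) x (A.X ξ x)
      - Complex.I * (k : ℂ) * ((A.moment x ξ : ℝ) : ℂ) * s.coeff i x = 0

end Sections

end PrequantumBundle

/-! ## Half-form bundles -/

/-- A square root `√K` of the canonical bundle `K` of `M`, given by frames `e_a` over the members
`V_a` of an open cover, whose squares `e_a² = sq a` are nowhere vanishing holomorphic `(n,0)`-forms
on `V_a` (so the `e_a` are holomorphic frames of `√K`), with `e_b = h_{ab} e_a` on `V_a ∩ V_b`. -/
structure HalfFormBundle (n : ℕ) (M : Type*) [TopologicalSpace M] [ChartedSpace (Cn n) M]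
    (ι' : Type*) where
  V : ι' → Set M
  isOpen_V : ∀ a, IsOpen (V a)
  indexAt : M → ι'
  mem_indexAt : ∀ x, x ∈ V (indexAt x)
  sq : ι' → DiffForm n n M ℂ
  holomorphic_sq : ∀ a, DiffForm.IsHolomorphicOn (sq a) (V a)
  sq_ne_zero : ∀ a, ∀ x ∈ V a, sq a x ≠ 0
  h : ι' → ι' → M → ℂ
  holomorphic_h : ∀ a b, MDifferentiableOn 𝓘(ℂ, Cn n) 𝓘(ℂ, ℂ) (h a b) (V a ∩ V b)
  cocycle : ∀ a b c, ∀ x ∈ V a ∩ V b ∩ V c, h a b x * h b c x = h a c x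
  square : ∀ a b, ∀ x ∈ V a ∩ V b, sq b x = (h a b x) ^ 2 • sq a x

namespace HalfFormBundle

variable {n : ℕ} {M : Type*} [TopologicalSpace M] [ChartedSpace (Cn n) M] {ι' : Type*}

/-- The magnitude squared `|e_a|² = (e_a, e_a)` of the frame `e_a`, where
`e_a² ∧ conj(e_a)² = (e_a, e_a)² ε_ω` up to the constant of modulus one (depending only on `n`) that
makes `(e_a, e_a)` positive. -/
def frameNormSq (H : HalfFormBundle n M ι') (W : KahlerStructure n M) (a : ι') (x : M) : ℝ :=
  Real.sqrt (‖wedgeConj (H.sq a) x (realFrame n) / ((W.liouville x (realFrame n) : ℝ) : ℂ)‖)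

/-- The function `c` such that `L_V e_a = c e_a`, where the Lie derivative of half-forms is given by
`2 (L_V ν) ν = L_V (ν²)`. -/
def lieCoeff (H : HalfFormBundle n M ι') (V : M → Cn n) (a : ι') (x : M) : ℂ :=
  lieDeriv V (fun y v => H.sq a y v) x (complexFrame n) / (2 * H.sq a x (complexFrame n))

variable {W : KahlerStructure n M} {ι : Type*}

/-- Smooth sections of `ℓ^{⊗k} ⊗ √K`: `r = r_{ia} eᵢ^k ⊗ e_a` on `Uᵢ ∩ V_a`. -/
structure Sections (H : HalfFormBundle n M ι') (L : PrequantumBundle W ι) (k : ℕ) where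
  coeff : ι → ι' → M → ℂ
  smooth : ∀ i a, ContMDiffOn 𝓘(ℝ, Cn n) 𝓘(ℝ, ℂ) ∞ (coeff i a) (L.U i ∩ H.V a)
  compat : ∀ i j a b, ∀ x ∈ (L.U i ∩ L.U j) ∩ (H.V a ∩ H.V b),
    coeff i a x = L.g i j x ^ k * H.h a b x * coeff j b x

namespace Sections

variable {H : HalfFormBundle n M ι'} {L : PrequantumBundle W ι} {k : ℕ}

/-- The pointwise magnitude squared `|r|²(x)` (independent of the frames). -/
def normSq (r : H.Sections L k) (x : M) : ℝ :=
  ‖r.coeff (L.indexAt x) (H.indexAt x) x‖ ^ 2 * H.frameNormSq W (H.indexAt x) x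

/-- `r` is holomorphic: it is covariantly constant in the `(0,1)`-directions `v + √-1 Jv`
(the frames `e_a` being so, because their squares are holomorphic `(n,0)`-forms). -/
def IsHolomorphic (r : H.Sections L k) : Prop :=
  ∀ i a, ∀ x ∈ L.U i ∩ H.V a, ∀ v : Cn n,
    L.nabla k i (r.coeff i a) x v + Complex.I * L.nabla k i (r.coeff i a) x (cJ v) = 0

/-- `r` is `G`-invariant: it is annihilated by the action `Q_ξ ⊗ 1 + 1 ⊗ L_{X^ξ}` of the Lie algebra
of the (connected) group `G`. -/
def IsInvariant {𝔤 : Type*} [NormedAddCommGroup 𝔤] [NormedSpace ℝ 𝔤]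
    {G : Type*} [TopologicalSpace G] [ChartedSpace 𝔤 G] [Group G] [MulAction G M]
    (A : HamiltonianAction W 𝔤 G) (r : H.Sections L k) : Prop :=
  ∀ (ξ : 𝔤) (i : ι) (a : ι'), ∀ x ∈ L.U i ∩ H.V a,
    (L.nabla k i (r.coeff i a) x (A.X ξ x)
      - Complex.I * (k : ℂ) * ((A.moment x ξ : ℝ) : ℂ) * r.coeff i a x)
      + H.lieCoeff (A.X ξ) a x * r.coeff i a x = 0

end Sections

end HalfFormBundle

end

/-! Everything is a computation of logarithmic derivatives along the curve `t ↦ e^{itξ} · x₀`, whose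
velocity is JX, where X = X^ξ.

If s is holomorphic then ∇_{JX} s = i ∇_X s, and invariance says ∇_X s = ikφ_ξ s. Hence ∇_{JX} s =
-kφ_ξ s, and N = |s|² solves N' = -2kφ_ξ N, which integrates to (a) (`exists_dFun_cJ_eq`,
`eq_mul_exp_neg_integral`).

For (b), write L_X e_a = c e_a. The invariance equation now contains c, and the squared modulus of
the coefficient acquires the extra rate 2 Im c. In a chart |e_a|² is a constant times √(|S|²/|E|),
with S the coefficient of e_a² and E the Liouville density. The field X is holomorphic
(`fderiv_fundInChart_I_smul`), so its coordinate derivative is complex linear, with a complex trace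
z. Along JX the logarithmic derivatives are i(2c - z) for S and div(JX) + 2 Im z for E
(`exists_trace`), so that |e_a|² has the rate -2 Im c - div(JX)/2. Here z has cancelled, and c
cancels against the coefficient.

For ρ: the derivative of φ_ξ along the curve is B(X, X) ≥ 0. On the zero level φ_ξ starts at 0, with
positive slope when ξ ≠ 0, because 0 is a regular value; so φ_ξ > 0 for t > 0 (`moment_expI_pos`).
With ψ(ξ) = Φ(e^{iξ} · x₀) one has ρ(ξ) = 2 ∫₀¹ ψ(tξ)(ξ) dt. If ψ is C¹ at 0 and ψ(0) = 0, the
Hessian of such an integral is the symmetrization of Dψ(0) (`hessian_integral_radial`), and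
Dψ(0)(ξ)(η) = B(X^η, X^ξ).

The analytic input is the C¹ dependence of e^{iξ} · x₀ on ξ, obtained from the implicit function
theorem for the integral equation on C([-2,2], ℂⁿ) (`exists_contDiffAt_solution`). -/

open scoped Manifold ContDiff

noncomputable section

/-! ### Real and complex charts; complex linearity and cocycle rule of `chartDeriv`. -/

section Charts

variable {n : ℕ} {M : Type*} [TopologicalSpace M] [ChartedSpace (Cn n) M]

/-- A complex manifold is a real smooth manifold. -/
theorem isManifold_real_of_complex [IsManifold 𝓘(ℂ, Cn n) ω M] :
    IsManifold 𝓘(ℝ, Cn n) ∞ M := by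
  refine isManifold_of_contDiffOn _ _ _ fun e e' he he' => ?_
  have h : ContDiffOn ℂ ω (𝓘(ℂ, Cn n) ∘ e.symm ≫ₕ e' ∘ 𝓘(ℂ, Cn n).symm)
      (𝓘(ℂ, Cn n).symm ⁻¹' (e.symm ≫ₕ e').source ∩ Set.range 𝓘(ℂ, Cn n)) :=
    (contDiffGroupoid ω 𝓘(ℂ, Cn n)).compatible he he' |>.1
  exact (h.restrict_scalars ℝ).of_le le_top

theorem extChartAt_symm_eventuallyEq (x y : M) {e : Cn n}
    (he : e ∈ (extChartAt 𝓘(ℝ, Cn n) y).target)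
    (hx : (extChartAt 𝓘(ℝ, Cn n) y).symm e ∈ (extChartAt 𝓘(ℝ, Cn n) x).source) :
    ∀ᶠ e' in nhds e, e' ∈ (extChartAt 𝓘(ℝ, Cn n) y).target ∧
      (extChartAt 𝓘(ℝ, Cn n) y).symm e' ∈ (extChartAt 𝓘(ℝ, Cn n) x).source := by
  have h1 := (isOpen_extChartAt_target (I := 𝓘(ℝ, Cn n)) y).mem_nhds he
  refine (Filter.eventually_of_mem h1 fun _ h => h).and ?_
  exact (continuousAt_extChartAt_symm'' he).eventually
    ((isOpen_extChartAt_source (I := 𝓘(ℝ, Cn n)) x).mem_nhds hx)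

variable [IsManifold 𝓘(ℂ, Cn n) ω M]

/-- The extended charts for the real and the complex model are definitionally equal, so real
hypotheses can be passed to the complex coordinate change. -/
theorem differentiableAt_complex_transition (x y : M) {e : Cn n}
    (he : e ∈ (extChartAt 𝓘(ℝ, Cn n) x).target)
    (hy : (extChartAt 𝓘(ℝ, Cn n) x).symm e ∈ (extChartAt 𝓘(ℝ, Cn n) y).source) :
    DifferentiableAt ℂ (extChartAt 𝓘(ℝ, Cn n) y ∘ (extChartAt 𝓘(ℝ, Cn n) x).symm) e := by
  have h := contDiffWithinAt_ext_coord_change (I := 𝓘(ℂ, Cn n)) (n := ω) y x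
    (y := e) (by exact ⟨he, hy⟩)
  have h2 : ContDiffAt ℂ ω (extChartAt 𝓘(ℂ, Cn n) y ∘ (extChartAt 𝓘(ℂ, Cn n) x).symm) e := by
    simpa [contDiffWithinAt_univ] using h
  exact h2.differentiableAt (by simp)

theorem contDiffAt_transition (x y : M) {e : Cn n}
    (he : e ∈ (extChartAt 𝓘(ℝ, Cn n) x).target)
    (hy : (extChartAt 𝓘(ℝ, Cn n) x).symm e ∈ (extChartAt 𝓘(ℝ, Cn n) y).source) :
    ContDiffAt ℝ ∞ (extChartAt 𝓘(ℝ, Cn n) y ∘ (extChartAt 𝓘(ℝ, Cn n) x).symm) e := by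
  have := isManifold_real_of_complex (n := n) (M := M)
  have h := contDiffWithinAt_ext_coord_change (I := 𝓘(ℝ, Cn n)) (n := ∞) y x
    (y := e) (by exact ⟨he, hy⟩)
  simpa [contDiffWithinAt_univ] using h

theorem mdifferentiableAt_extChartAt_symm (x : M) {e : Cn n}
    (he : e ∈ (extChartAt 𝓘(ℝ, Cn n) x).target) :
    MDifferentiableAt 𝓘(ℝ, Cn n) 𝓘(ℝ, Cn n) (extChartAt 𝓘(ℝ, Cn n) x).symm e := by
  have := isManifold_real_of_complex (n := n) (M := M)
  have : IsManifold 𝓘(ℝ, Cn n) 1 M := .of_le (n := ∞) (by norm_cast)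
  have h := mdifferentiableWithinAt_extChartAt_symm (I := 𝓘(ℝ, Cn n)) he
  simpa [mdifferentiableWithinAt_univ] using h

theorem hasMFDerivAt_extChartAt_symm (x : M) {e : Cn n}
    (he : e ∈ (extChartAt 𝓘(ℝ, Cn n) x).target) :
    HasMFDerivAt 𝓘(ℝ, Cn n) 𝓘(ℝ, Cn n) (extChartAt 𝓘(ℝ, Cn n) x).symm e (chartDeriv x e) :=
  (mdifferentiableAt_extChartAt_symm x he).hasMFDerivAt

/-- The tangent space at a point is read in the preferred chart of that point, so `chartDeriv` is
the derivative of a coordinate change; this is how it inherits complex linearity. -/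
theorem chartDeriv_eq_fderiv (x : M) {e : Cn n} (he : e ∈ (extChartAt 𝓘(ℝ, Cn n) x).target) :
    chartDeriv x e = fderiv ℝ (extChartAt 𝓘(ℝ, Cn n) ((extChartAt 𝓘(ℝ, Cn n) x).symm e) ∘
      (extChartAt 𝓘(ℝ, Cn n) x).symm) e := by
  have h := (hasMFDerivAt_extChartAt_symm x he).2
  have h2 : HasFDerivAt (extChartAt 𝓘(ℝ, Cn n) ((extChartAt 𝓘(ℝ, Cn n) x).symm e) ∘
      (extChartAt 𝓘(ℝ, Cn n) x).symm) (chartDeriv x e) e := by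
    rw [modelWithCornersSelf_coe, Set.range_id] at h
    exact h.hasFDerivAt Filter.univ_mem
  exact h2.fderiv.symm

theorem chartDeriv_I_smul (x : M) {e : Cn n} (he : e ∈ (extChartAt 𝓘(ℝ, Cn n) x).target)
    (v : Cn n) : chartDeriv x e (Complex.I • v) = Complex.I • chartDeriv x e v := by
  have h := (differentiableAt_complex_transition x _ he (mem_extChartAt_source _)).hasFDerivAt
  rw [chartDeriv_eq_fderiv x he, (h.restrictScalars ℝ).fderiv]
  exact map_smul (fderiv ℂ _ e) _ _

theorem chartDeriv_isInvertible (x : M) {e : Cn n}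
    (he : e ∈ (extChartAt 𝓘(ℝ, Cn n) x).target) : (chartDeriv x e).IsInvertible := by
  have := isManifold_real_of_complex (n := n) (M := M)
  have : IsManifold 𝓘(ℝ, Cn n) 1 M := .of_le (n := ∞) (by norm_cast)
  have h := isInvertible_mfderivWithin_extChartAt_symm (I := 𝓘(ℝ, Cn n)) he
  rw [modelWithCornersSelf_coe, Set.range_id, mfderivWithin_univ] at h
  exact h

theorem chartDeriv_self (x : M) :
    chartDeriv x (extChartAt 𝓘(ℝ, Cn n) x x) = ContinuousLinearMap.id ℝ (Cn n) := by
  have := isManifold_real_of_complex (n := n) (M := M)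
  have : IsManifold 𝓘(ℝ, Cn n) 1 M := .of_le (n := ∞) (by norm_cast)
  have h := mfderivWithin_range_extChartAt_symm (I := 𝓘(ℝ, Cn n)) (x := x)
  rw [modelWithCornersSelf_coe, Set.range_id, mfderivWithin_univ] at h
  exact h

/-- The cocycle rule for `chartDeriv` under a change of charts. -/
theorem chartDeriv_transition (x y : M) {e : Cn n}
    (he : e ∈ (extChartAt 𝓘(ℝ, Cn n) y).target)
    (hx : (extChartAt 𝓘(ℝ, Cn n) y).symm e ∈ (extChartAt 𝓘(ℝ, Cn n) x).source) :
    chartDeriv y e =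
      (chartDeriv x (extChartAt 𝓘(ℝ, Cn n) x ((extChartAt 𝓘(ℝ, Cn n) y).symm e))).comp
        (fderiv ℝ (extChartAt 𝓘(ℝ, Cn n) x ∘ (extChartAt 𝓘(ℝ, Cn n) y).symm) e) := by
  have h1 : HasMFDerivAt 𝓘(ℝ, Cn n) 𝓘(ℝ, Cn n)
      (extChartAt 𝓘(ℝ, Cn n) x ∘ (extChartAt 𝓘(ℝ, Cn n) y).symm) e _ :=
    ((contDiffAt_transition y x he hx).differentiableAt (by simp)).hasFDerivAt.hasMFDerivAt
  have h2 := hasMFDerivAt_extChartAt_symm x ((extChartAt 𝓘(ℝ, Cn n) x).map_source hx)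
  have h3 := HasMFDerivAt.comp e h2 h1
  refine (h3.congr_of_eventuallyEq ?_).mfderiv
  filter_upwards [extChartAt_symm_eventuallyEq x y he hx] with e' h'
  exact ((extChartAt 𝓘(ℝ, Cn n) x).left_inv h'.2).symm

end Charts

/-! ### Superposition operators on spaces of continuous maps. -/

section Superposition

variable {K : Type*} [TopologicalSpace K] [CompactSpace K]
  {E F : Type*} [NormedAddCommGroup E] [NormedSpace ℝ E] [NormedAddCommGroup F] [NormedSpace ℝ F]

/-- The pointwise evaluation of a continuous family of operators on a continuous family of
vectors. -/
def ContinuousMap.evalPairing (g : C(K, E →L[ℝ] F)) (h : C(K, E)) : C(K, F) :=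
  ⟨fun t => g t (h t), g.continuous.clm_apply h.continuous⟩

theorem ContinuousMap.isBoundedBilinearMap_evalPairing :
    IsBoundedBilinearMap ℝ
      (fun p : C(K, E →L[ℝ] F) × C(K, E) => ContinuousMap.evalPairing p.1 p.2) where
  add_left _ _ _ := by ext; simp [evalPairing]
  smul_left _ _ _ := by ext; simp [evalPairing]
  add_right _ _ _ := by ext; simp [evalPairing]
  smul_right _ _ _ := by ext; simp [evalPairing]
  bound := ⟨1, one_pos, fun g h => by
    rw [one_mul, ContinuousMap.norm_le _ (by positivity)]
    exact fun t => ((g t).le_opNorm _).trans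
      (mul_le_mul (g.norm_coe_le_norm t) (h.norm_coe_le_norm t) (norm_nonneg _) (norm_nonneg g))⟩

theorem ContinuousMap.contDiff_evalPairing :
    ContDiff ℝ 1 (fun p : C(K, E →L[ℝ] F) × C(K, E) => ContinuousMap.evalPairing p.1 p.2) :=
  IsBoundedBilinearMap.contDiff (𝕜 := ℝ) (E := C(K, E →L[ℝ] F)) (F := C(K, E)) (G := C(K, F))
    isBoundedBilinearMap_evalPairing

/-- Mean value inequality on the segment. The constant does not depend on `x`, so the estimate
passes to the sup norm. -/
theorem norm_sub_sub_fderiv_le_of_lipschitzWith {g : E → F} (hg : Differentiable ℝ g)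
    {C : NNReal} (hC : LipschitzWith C (fderiv ℝ g)) (x h : E) :
    ‖g (x + h) - g x - fderiv ℝ g x h‖ ≤ C * ‖h‖ ^ 2 := by
  have := (convex_segment x (x + h)).norm_image_sub_le_of_norm_fderiv_le'
    (𝕜 := ℝ) (f := g) (φ := fderiv ℝ g x) (C := C * ‖h‖) (x := x) (y := x + h)
    (fun y _ => hg y) (fun y hy => ?_) (left_mem_segment _ _ _) (right_mem_segment _ _ _)
  · rw [add_sub_cancel_left] at this
    calc _ ≤ _ := this
      _ = _ := by ring
  · refine (hC.norm_sub_le y x).trans ?_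
    gcongr
    obtain ⟨θ, hθ, rfl⟩ := (segment_eq_image' ℝ x (x + h)) ▸ hy
    rw [add_sub_cancel_left, add_sub_cancel_left, norm_smul, Real.norm_of_nonneg hθ.1]
    exact mul_le_of_le_one_left (norm_nonneg _) hθ.2

/-- The superposition operator of a function with Lipschitz derivative is of class `C¹` on the
space of continuous maps. -/
theorem contDiff_one_superposition (g : C(E, F)) (hg : Differentiable ℝ g)
    {C : NNReal} (hC : LipschitzWith C (fderiv ℝ g)) :
    ContDiff ℝ 1 (fun γ : C(K, E) => g.comp γ) := by
  let dg : C(E, E →L[ℝ] F) := ⟨fderiv ℝ g, hC.continuous⟩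
  have hB := ContinuousMap.isBoundedBilinearMap_evalPairing (K := K) (E := E) (F := F)
  let B : C(K, E →L[ℝ] F) →L[ℝ] C(K, E) →L[ℝ] C(K, F) :=
    IsBoundedBilinearMap.toContinuousLinearMap (𝕜 := ℝ) (E := C(K, E →L[ℝ] F)) (F := C(K, E))
      (G := C(K, F)) hB
  have hd : ∀ γ : C(K, E), HasFDerivAt (fun γ : C(K, E) => g.comp γ) (B (dg.comp γ)) γ := by
    intro γ
    rw [hasFDerivAt_iff_isLittleO_nhds_zero]
    -- The pointwise quadratic remainder is uniform in `t`, hence quadratic in the sup norm.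
    refine Asymptotics.IsBigO.trans_isLittleO (g := fun h : C(K, E) => ‖h‖ ^ 2) ?_ ?_
    · refine Asymptotics.IsBigO.of_bound C (Filter.Eventually.of_forall fun h => ?_)
      rw [ContinuousMap.norm_le _ (by positivity)]
      intro t
      refine (norm_sub_sub_fderiv_le_of_lipschitzWith hg hC (γ t) (h t)).trans ?_
      rw [Real.norm_of_nonneg (by positivity)]
      gcongr
      exact h.norm_coe_le_norm t
    · exact Asymptotics.isLittleO_norm_pow_id one_lt_two
  rw [contDiff_one_iff_hasFDerivAt]
  refine ⟨fun γ => B (dg.comp γ), ?_, hd⟩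
  exact B.continuous.comp (ContinuousMap.continuous_postcomp dg)

end Superposition

/-! ### Integration as an operator on C([-2,2], E); the interval is chosen to have the time 1 in its
interior. -/

section Integration

theorem projIcc_intervalIntegrable {E : Type*} [NormedAddCommGroup E]
    (g : C(Set.Icc (-2 : ℝ) 2, E)) (a b : ℝ) :
    IntervalIntegrable (fun s => g (Set.projIcc (-2) 2 (by norm_num) s)) MeasureTheory.volume a b :=
  (g.continuous.comp continuous_projIcc).intervalIntegrable _ _

variable {E : Type*} [NormedAddCommGroup E] [NormedSpace ℝ E]

/-- Integration from `0`, as an operator on `C([-2,2], E)`. -/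
def integrationOperator : C(Set.Icc (-2 : ℝ) 2, E) →L[ℝ] C(Set.Icc (-2 : ℝ) 2, E) :=
  LinearMap.mkContinuous
    { toFun := fun g => ⟨fun t => ∫ s in (0 : ℝ)..t, g (Set.projIcc (-2) 2 (by norm_num) s),
        (intervalIntegral.continuous_primitive (projIcc_intervalIntegrable g) 0).comp
          continuous_subtype_val⟩
      map_add' := fun g h => by
        ext t
        exact intervalIntegral.integral_add (projIcc_intervalIntegrable g 0 t)
          (projIcc_intervalIntegrable h 0 t)
      map_smul' := fun c g => by
        ext t
        exact intervalIntegral.integral_smul c _ } 2 (fun g => by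
    rw [ContinuousMap.norm_le _ (by positivity)]
    intro t
    refine (intervalIntegral.norm_integral_le_of_norm_le_const
      (C := ‖g‖) (fun s _ => g.norm_coe_le_norm _)).trans ?_
    rw [mul_comm, sub_zero]
    gcongr
    exact abs_le.2 t.2)

theorem integrationOperator_apply (g : C(Set.Icc (-2 : ℝ) 2, E)) (t : Set.Icc (-2 : ℝ) 2) :
    integrationOperator g t = ∫ s in (0 : ℝ)..t, g (Set.projIcc (-2) 2 (by norm_num) s) := rfl

end Integration

/-! ### C¹ dependence of solutions of differential equations on parameters. -/

section Parameters

theorem exists_lipschitzWith_fderiv {E F : Type*} [NormedAddCommGroup E]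
    [NormedSpace ℝ E] [NormedAddCommGroup F] [NormedSpace ℝ F]
    {g : E → F} (hg : ContDiff ℝ 2 g) (hgc : HasCompactSupport g) :
    ∃ C, LipschitzWith C (fderiv ℝ g) := by
  have h : ContDiff ℝ 1 (fderiv ℝ g) := hg.fderiv_right (m := 1) (by norm_num)
  exact h.lipschitzWith_of_hasCompactSupport (hgc.fderiv ℝ) one_ne_zero

variable {P E : Type*} [NormedAddCommGroup P] [NormedSpace ℝ P] [CompleteSpace P]
  [NormedAddCommGroup E] [NormedSpace ℝ E] [FiniteDimensional ℝ E]

/-- A smooth function near a point can be modified away from the point to have compact support. -/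
theorem exists_contDiff_hasCompactSupport_eventuallyEq {F : Type*} [NormedAddCommGroup F]
    [NormedSpace ℝ F] {f : E → F} {x : E} {m : ℕ∞ω} (hm : m < ∞) (hf : ContDiffAt ℝ m f x) :
    ∃ g : E → F, ContDiff ℝ m g ∧ HasCompactSupport g ∧ g =ᶠ[nhds x] f := by
  obtain ⟨u, hu, hfu⟩ := hf.eventually hm.ne |>.exists_mem
  obtain ⟨r, hr, hru⟩ := Metric.mem_nhds_iff.1 hu
  let χ : ContDiffBump x := ⟨r / 3, r / 2, by positivity, by linarith⟩
  refine ⟨fun y => χ y • f y, ?_, ?_, ?_⟩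
  · refine contDiff_iff_contDiffAt.2 fun y => ?_
    by_cases hy : y ∈ Metric.ball x r
    · exact (χ.contDiff.of_le hm.le).contDiffAt.smul (hfu y (hru hy))
    · have : (fun y => χ y • f y) =ᶠ[nhds y] fun _ => 0 := by
        have h1 : y ∈ (Metric.closedBall x (r / 2))ᶜ := by
          simp only [Metric.mem_ball, not_lt, Set.mem_compl_iff, Metric.mem_closedBall,
            not_le] at hy ⊢
          linarith
        filter_upwards [Metric.isClosed_closedBall.isOpen_compl.mem_nhds h1] with z hz
        rw [χ.zero_of_le_dist (by simpa using (not_le.1 (fun h => hz (Metric.mem_closedBall.2 h))).le), zero_smul]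
      exact contDiffAt_const.congr_of_eventuallyEq this
  · exact χ.hasCompactSupport.smul_right
  · filter_upwards [χ.eventuallyEq_one] with y hy
    simp [hy]

/-- An implicit function theorem for perturbations of the identity. -/
theorem exists_contDiffAt_implicit {Q X : Type*} [NormedAddCommGroup Q] [NormedSpace ℝ Q]
    [CompleteSpace Q] [NormedAddCommGroup X] [NormedSpace ℝ X] [CompleteSpace X]
    {Φ : Q × X → X} (hΦ : ContDiff ℝ 1 Φ) {q : Q} {x : X} (hq : ∀ y, Φ (q, y) = y - x) :
    ∃ Γ : Q → X, ContDiffAt ℝ 1 Γ q ∧ Γ q = x ∧ ∀ᶠ p in nhds q, Φ (p, Γ p) = 0 := by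
  -- At the parameter `q` the map is a translation, so its partial derivative in the second variable
  -- is the identity.
  have hinv : fderiv ℝ Φ (q, x) ∘L .inr ℝ Q X = ContinuousLinearMap.id ℝ _ := by
    have h1 : HasFDerivAt (fun y => Φ (q, y)) (fderiv ℝ Φ (q, x) ∘L .inr ℝ Q X) x :=
      ((hΦ.differentiable (by simp)) (q, x)).hasFDerivAt.comp x (hasFDerivAt_prodMk_right q x)
    have h2 : HasFDerivAt (fun y => Φ (q, y)) (ContinuousLinearMap.id ℝ _) x := by
      simp only [hq]
      exact (hasFDerivAt_id _).sub_const _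
    exact h1.unique h2
  have hinv' : (fderiv ℝ Φ (q, x) ∘L .inr ℝ Q X).IsInvertible := by
    rw [hinv]; exact ⟨ContinuousLinearEquiv.refl ℝ _, rfl⟩
  have hΦu : ContDiffAt ℝ 1 Φ (q, x) := hΦ.contDiffAt
  refine ⟨hΦu.implicitFunction one_ne_zero hinv', hΦu.contDiffAt_implicitFunction _ _,
    hΦu.implicitFunction_apply_self _ _, ?_⟩
  filter_upwards [hΦu.eventually_apply_implicitFunction one_ne_zero hinv'] with p hp
  rw [hp, hq, sub_self]

/-- Solutions of the differential equation `γ' = f(γ) p` with `γ(0) = e` exist on `(-2,2)` and depend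
in a `C¹` manner on `(p, e)` near `(0, e₀)`. -/
theorem exists_contDiffAt_solution {f : E → P →L[ℝ] E} {e₀ : E} (hf : ContDiffAt ℝ 2 f e₀)
    {U : Set E} (hU : U ∈ nhds e₀) :
    ∃ γ : P × E → ℝ → E, ContDiffAt ℝ 1 (fun p => γ p 1) (0, e₀) ∧
      ∀ᶠ p in nhds ((0 : P), e₀), γ p 0 = p.2 ∧
        ∀ t ∈ Set.Ioo (-2 : ℝ) 2, γ p t ∈ U ∧ HasDerivAt (γ p) (f (γ p t) p.1) t := by
  obtain ⟨g, hg, hgc, hgf⟩ := exists_contDiff_hasCompactSupport_eventuallyEq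
    (WithTop.coe_lt_coe.2 (ENat.natCast_lt_top 2)) hf
  have hg1 : Differentiable ℝ g := hg.differentiable (by simp)
  obtain ⟨C, hC⟩ := exists_lipschitzWith_fderiv hg hgc
  let G : C(E, P →L[ℝ] E) := ⟨g, hg.continuous⟩
  let cE : E →L[ℝ] C(Set.Icc (-2 : ℝ) 2, E) := ContinuousLinearMap.const ℝ _
  let cP : P →L[ℝ] C(Set.Icc (-2 : ℝ) 2, P) := ContinuousLinearMap.const ℝ _
  -- The zeros are the solutions of the integral equation γ = e + ∫₀ g(γ) p. At p = 0 the integral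
  -- vanishes, which leaves a translation.
  let Φ : (P × E) × C(Set.Icc (-2 : ℝ) 2, E) → C(Set.Icc (-2 : ℝ) 2, E) := fun q =>
    q.2 - cE q.1.2 -
      integrationOperator (ContinuousMap.evalPairing (G.comp q.2) (cP q.1.1))
  have hΦ : ContDiff ℝ 1 Φ := by
    have h1 : ContDiff ℝ 1 fun q : (P × E) × C(Set.Icc (-2 : ℝ) 2, E) => G.comp q.2 :=
      (contDiff_one_superposition G hg1 hC).comp contDiff_snd
    have h2 : ContDiff ℝ 1 fun q : (P × E) × C(Set.Icc (-2 : ℝ) 2, E) => cP q.1.1 :=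
      cP.contDiff.comp (contDiff_fst.comp contDiff_fst)
    have h3 : ContDiff ℝ 1 fun q : (P × E) × C(Set.Icc (-2 : ℝ) 2, E) => cE q.1.2 :=
      cE.contDiff.comp (contDiff_snd.comp contDiff_fst)
    have h4 : ContDiff ℝ 1 fun q : (P × E) × C(Set.Icc (-2 : ℝ) 2, E) =>
        ContinuousMap.evalPairing (G.comp q.2) (cP q.1.1) :=
      (ContinuousMap.contDiff_evalPairing (K := Set.Icc (-2 : ℝ) 2) (E := P) (F := E)).comp
        (h1.prodMk h2)
    have h5 : ContDiff ℝ 1 (integrationOperator (E := E)) :=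
      ContinuousLinearMap.contDiff (𝕜 := ℝ) (E := C(Set.Icc (-2 : ℝ) 2, E))
        (F := C(Set.Icc (-2 : ℝ) 2, E)) integrationOperator
    exact (contDiff_snd.sub h3).sub (h5.comp h4)
  have hΦγ : ∀ γ, Φ ((0, e₀), γ) = γ - cE e₀ := by
    intro γ
    have : ContinuousMap.evalPairing (G.comp γ) (cP 0) = 0 := by
      ext t; simp [ContinuousMap.evalPairing]
    change γ - cE e₀ - integrationOperator (ContinuousMap.evalPairing (G.comp γ) (cP 0)) = _
    rw [this, map_zero, sub_zero]
  obtain ⟨Γ, hΓ, hΓ0, hΓeq⟩ := exists_contDiffAt_implicit hΦ hΦγ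
  obtain ⟨r, hr, hrU⟩ := Metric.mem_nhds_iff.1 (Filter.inter_mem hU hgf)
  -- Closeness to the constant curve keeps the solution in `U` and in the region where the cut-off
  -- `g` equals `f`.
  have hΓr : ∀ᶠ p in nhds ((0 : P), e₀), dist (Γ p) (cE e₀) < r := by
    have := hΓ.continuousAt.tendsto
    rw [hΓ0] at this
    exact this.eventually (Metric.ball_mem_nhds _ hr)
  let proj := Set.projIcc (-2 : ℝ) 2 (by norm_num)
  -- One side of the integral equation, extended to all real times: it is visibly differentiable,
  -- and it equals `Γ p` on [-2,2].
  let γ : P × E → ℝ → E := fun p t => p.2 + ∫ s in (0 : ℝ)..t, g (Γ p (proj s)) p.1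
  have key : ∀ p, Φ (p, Γ p) = 0 → ∀ t : Set.Icc (-2 : ℝ) 2, γ p t = Γ p t := by
    intro p hp t
    have := congrArg (fun h : C(Set.Icc (-2 : ℝ) 2, E) => h t) hp
    simp only [Φ, ContinuousMap.sub_apply, integrationOperator_apply, ContinuousMap.zero_apply]
      at this
    rw [sub_sub, sub_eq_zero] at this
    exact this.symm
  refine ⟨γ, ?_, ?_⟩
  · have h0 : ContDiff ℝ 1 (fun h : C(Set.Icc (-2 : ℝ) 2, E) => h ⟨1, by norm_num⟩) :=
      ContinuousLinearMap.contDiff (𝕜 := ℝ) (E := C(Set.Icc (-2 : ℝ) 2, E)) (F := E)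
        (ContinuousMap.evalCLM ℝ (⟨1, by norm_num⟩ : Set.Icc (-2 : ℝ) 2))
    have h1 : ContDiffAt ℝ 1 (fun p => Γ p ⟨1, by norm_num⟩) (0, e₀) := h0.contDiffAt.comp _ hΓ
    refine h1.congr_of_eventuallyEq ?_
    filter_upwards [hΓeq] with p hp using key p hp ⟨1, by norm_num⟩
  · filter_upwards [hΓeq, hΓr] with p hp hpr
    refine ⟨by simp [γ], fun t ht => ?_⟩
    have ht' : t ∈ Set.Icc (-2 : ℝ) 2 := Set.Ioo_subset_Icc_self ht
    have hkey := key p hp ⟨t, ht'⟩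
    have hmem : γ p t ∈ U ∩ {y | g y = f y} := by
      refine hrU ?_
      rw [hkey]
      exact lt_of_le_of_lt (ContinuousMap.dist_apply_le_dist (f := Γ p) (g := cE e₀) ⟨t, ht'⟩) hpr
    refine ⟨hmem.1, ?_⟩
    have hc : Continuous fun s => g (Γ p (proj s)) p.1 :=
      (hg.continuous.comp ((Γ p).continuous.comp continuous_projIcc)).clm_apply continuous_const
    have hd := (intervalIntegral.integral_hasDerivAt_right (hc.intervalIntegrable 0 t)
      (hc.stronglyMeasurableAtFilter _ _) hc.continuousAt).const_add p.2
    have hpt : Γ p (proj t) = γ p t := by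
      rw [hkey]; simp only [proj, Set.projIcc_of_mem _ ht']
    rw [hpt, hmem.2] at hd
    exact hd

end Parameters

/-! ### Fundamental vector fields in charts: smoothness and holomorphy. -/

section ActionCharts

variable {n : ℕ} {M : Type*} [TopologicalSpace M] [ChartedSpace (Cn n) M]
  {𝔤 : Type*} [NormedAddCommGroup 𝔤] [NormedSpace ℝ 𝔤]
  {G : Type*} [TopologicalSpace G] [ChartedSpace 𝔤 G] [Group G] [MulAction G M]

/-- The action map `(g, y) ↦ g · y` in the preferred charts at `1 : G` and at `x : M`. -/
def actInChart (𝔤 : Type*) [NormedAddCommGroup 𝔤] [NormedSpace ℝ 𝔤] (G : Type*)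
    [TopologicalSpace G] [ChartedSpace 𝔤 G] [Group G] [MulAction G M] (x : M) (p : 𝔤 × Cn n) :
    Cn n :=
  extChartAt 𝓘(ℝ, Cn n) x
    ((extChartAt 𝓘(ℝ, 𝔤) (1 : G)).symm p.1 • (extChartAt 𝓘(ℝ, Cn n) x).symm p.2)

/-- The coordinate of `1 : G` in its preferred chart. -/
def unitCoord (𝔤 : Type*) [NormedAddCommGroup 𝔤] [NormedSpace ℝ 𝔤] (G : Type*)
    [TopologicalSpace G] [ChartedSpace 𝔤 G] [Group G] : 𝔤 := extChartAt 𝓘(ℝ, 𝔤) (1 : G) 1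

theorem extChartAt_symm_unitCoord :
    (extChartAt 𝓘(ℝ, 𝔤) (1 : G)).symm (unitCoord 𝔤 G) = 1 :=
  extChartAt_to_inv (I := 𝓘(ℝ, 𝔤)) (1 : G)

theorem actInChart_unitCoord (x : M) {e : Cn n} (he : e ∈ (extChartAt 𝓘(ℝ, Cn n) x).target) :
    actInChart 𝔤 G x (unitCoord 𝔤 G, e) = e := by
  rw [actInChart, extChartAt_symm_unitCoord, one_smul]
  exact (extChartAt 𝓘(ℝ, Cn n) x).right_inv he

theorem eventually_smul_mem_source (x : M) {e : Cn n}
    (hsm : ContMDiff (𝓘(ℝ, 𝔤).prod 𝓘(ℝ, Cn n)) 𝓘(ℝ, Cn n) ∞ (fun p : G × M => p.1 • p.2))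
    (he : e ∈ (extChartAt 𝓘(ℝ, Cn n) x).target) :
    ∀ᶠ h in nhds (unitCoord 𝔤 G), (extChartAt 𝓘(ℝ, 𝔤) (1 : G)).symm h •
      (extChartAt 𝓘(ℝ, Cn n) x).symm e ∈ (extChartAt 𝓘(ℝ, Cn n) x).source := by
  have h1 : ContinuousAt (fun h : 𝔤 => ((extChartAt 𝓘(ℝ, 𝔤) (1 : G)).symm h,
      (extChartAt 𝓘(ℝ, Cn n) x).symm e)) (unitCoord 𝔤 G) :=
    (continuousAt_extChartAt_symm (1 : G)).prodMk continuousAt_const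
  have h2 := (hsm.continuous.continuousAt).comp h1
  refine h2.eventually ((isOpen_extChartAt_source (I := 𝓘(ℝ, Cn n)) x).mem_nhds ?_)
  simp only [Function.comp, extChartAt_symm_unitCoord, one_smul]
  exact (extChartAt 𝓘(ℝ, Cn n) x).map_target he

variable [IsManifold 𝓘(ℂ, Cn n) ω M]

/-- For `g` near `1`, the action of `g` is holomorphic in the chart at `x`. -/
theorem eventually_differentiableAt_actInChart (x : M) {e : Cn n}
    (hsm : ContMDiff (𝓘(ℝ, 𝔤).prod 𝓘(ℝ, Cn n)) 𝓘(ℝ, Cn n) ∞ (fun p : G × M => p.1 • p.2))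
    (hhol : ∀ g : G, MDifferentiable 𝓘(ℂ, Cn n) 𝓘(ℂ, Cn n) (fun x : M => g • x))
    (he : e ∈ (extChartAt 𝓘(ℝ, Cn n) x).target) :
    ∀ᶠ h in nhds (unitCoord 𝔤 G),
      DifferentiableAt ℂ (fun e' : Cn n => actInChart 𝔤 G x (h, e')) e := by
  have : IsManifold 𝓘(ℂ, Cn n) 1 M := .of_le (n := ω) le_top
  filter_upwards [eventually_smul_mem_source x hsm he] with h hh
  have h1 : MDifferentiableAt 𝓘(ℂ, Cn n) 𝓘(ℂ, Cn n) (extChartAt 𝓘(ℂ, Cn n) x).symm e := by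
    have h := mdifferentiableWithinAt_extChartAt_symm (I := 𝓘(ℂ, Cn n)) (x := x) (z := e) he
    rwa [modelWithCornersSelf_coe, Set.range_id, mdifferentiableWithinAt_univ] at h
  have h2 := MDifferentiableAt.comp e
    ((hhol ((extChartAt 𝓘(ℝ, 𝔤) (1 : G)).symm h)) ((extChartAt 𝓘(ℂ, Cn n) x).symm e)) h1
  rw [extChartAt_source] at hh
  have h3 := mdifferentiableAt_extChartAt (I := 𝓘(ℂ, Cn n)) hh
  exact (MDifferentiableAt.comp e h3 h2).differentiableAt

variable [LieGroup 𝓘(ℝ, 𝔤) ∞ G]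

theorem contDiffAt_actInChart (x : M) {e : Cn n}
    (hsm : ContMDiff (𝓘(ℝ, 𝔤).prod 𝓘(ℝ, Cn n)) 𝓘(ℝ, Cn n) ∞ (fun p : G × M => p.1 • p.2))
    (he : e ∈ (extChartAt 𝓘(ℝ, Cn n) x).target) :
    ContDiffAt ℝ ∞ (actInChart 𝔤 G x) (unitCoord 𝔤 G, e) := by
  have := isManifold_real_of_complex (n := n) (M := M)
  have h1 : ContMDiffAt 𝓘(ℝ, 𝔤 × Cn n) 𝓘(ℝ, 𝔤) ∞
      (fun p : 𝔤 × Cn n => (extChartAt 𝓘(ℝ, 𝔤) (1 : G)).symm p.1) (unitCoord 𝔤 G, e) := by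
    have h : ContMDiffAt 𝓘(ℝ, 𝔤) 𝓘(ℝ, 𝔤) ∞ (extChartAt 𝓘(ℝ, 𝔤) (1 : G)).symm
        (unitCoord 𝔤 G) :=
      (contMDiffOn_extChartAt_symm (1 : G)).contMDiffAt
        ((isOpen_extChartAt_target (1 : G)).mem_nhds (mem_extChartAt_target (1 : G)))
    exact ContMDiffAt.comp (unitCoord 𝔤 G, e) h (contDiff_fst.contMDiff.contMDiffAt)
  have h2 : ContMDiffAt 𝓘(ℝ, 𝔤 × Cn n) 𝓘(ℝ, Cn n) ∞
      (fun p : 𝔤 × Cn n => (extChartAt 𝓘(ℝ, Cn n) x).symm p.2) (unitCoord 𝔤 G, e) := by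
    have h : ContMDiffAt 𝓘(ℝ, Cn n) 𝓘(ℝ, Cn n) ∞ (extChartAt 𝓘(ℝ, Cn n) x).symm e :=
      (contMDiffOn_extChartAt_symm x).contMDiffAt ((isOpen_extChartAt_target x).mem_nhds he)
    exact ContMDiffAt.comp (unitCoord 𝔤 G, e) h (contDiff_snd.contMDiff.contMDiffAt)
  have h3 := ContMDiffAt.comp (unitCoord 𝔤 G, e) (hsm _) (h1.prodMk h2)
  have h4 : ContMDiffAt 𝓘(ℝ, Cn n) 𝓘(ℝ, Cn n) ∞ (extChartAt 𝓘(ℝ, Cn n) x)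
      ((extChartAt 𝓘(ℝ, 𝔤) (1 : G)).symm (unitCoord 𝔤 G) •
        (extChartAt 𝓘(ℝ, Cn n) x).symm e) := by
    refine contMDiffAt_extChartAt' ?_
    rw [extChartAt_symm_unitCoord, one_smul, ← extChartAt_source 𝓘(ℝ, Cn n)]
    exact (extChartAt 𝓘(ℝ, Cn n) x).map_target he
  exact (ContMDiffAt.comp (unitCoord 𝔤 G, e) h4 h3).contDiffAt

/-- The fundamental fields in the chart at `x`, as a function with values in the linear maps on the
Lie algebra. -/
def fundInChart (𝔤 : Type*) [NormedAddCommGroup 𝔤] [NormedSpace ℝ 𝔤] (G : Type*)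
    [TopologicalSpace G] [ChartedSpace 𝔤 G] [Group G] [MulAction G M] (x : M) (e : Cn n) :
    𝔤 →L[ℝ] Cn n :=
  (fderiv ℝ (actInChart 𝔤 G x) (unitCoord 𝔤 G, e)).comp (ContinuousLinearMap.inl ℝ 𝔤 (Cn n))

theorem contDiffAt_fderiv_actInChart (x : M) {e : Cn n}
    (hsm : ContMDiff (𝓘(ℝ, 𝔤).prod 𝓘(ℝ, Cn n)) 𝓘(ℝ, Cn n) ∞ (fun p : G × M => p.1 • p.2))
    (he : e ∈ (extChartAt 𝓘(ℝ, Cn n) x).target) :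
    ContDiffAt ℝ ∞ (fderiv ℝ (actInChart 𝔤 G x)) (unitCoord 𝔤 G, e) :=
  (contDiffAt_actInChart x hsm he).fderiv_right (m := ∞) (by norm_cast)

theorem contDiffAt_fundInChart (x : M) {e : Cn n}
    (hsm : ContMDiff (𝓘(ℝ, 𝔤).prod 𝓘(ℝ, Cn n)) 𝓘(ℝ, Cn n) ∞ (fun p : G × M => p.1 • p.2))
    (he : e ∈ (extChartAt 𝓘(ℝ, Cn n) x).target) :
    ContDiffAt ℝ ∞ (fundInChart 𝔤 G x) e := by
  have h1 : ContDiffAt ℝ ∞ (fun e' : Cn n => (unitCoord 𝔤 G, e')) e := by fun_prop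
  exact ((contDiffAt_fderiv_actInChart x hsm he).comp e h1).clm_comp contDiffAt_const

/-- Near 1, applying the inverse chart after the action in coordinates is the same as acting after
the inverse chart of the group. Differentiate both sides in the group variable at the coordinate of
1, where the inverse chart of the group has derivative the identity. -/
theorem fieldInChart_fundField (x : M) {e : Cn n}
    (hsm : ContMDiff (𝓘(ℝ, 𝔤).prod 𝓘(ℝ, Cn n)) 𝓘(ℝ, Cn n) ∞ (fun p : G × M => p.1 • p.2))
    (he : e ∈ (extChartAt 𝓘(ℝ, Cn n) x).target) (ξ : 𝔤) :
    fieldInChart (fundField n G ξ) x e = fundInChart 𝔤 G x e ξ := by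
  have := isManifold_real_of_complex (n := n) (M := M)
  have : IsManifold 𝓘(ℝ, 𝔤) 1 G := .of_le (n := ∞) (by norm_cast)
  obtain ⟨T, hT⟩ := chartDeriv_isInvertible x he
  rw [fieldInChart, ← hT, ContinuousLinearMap.inverse_equiv]
  rw [ContinuousLinearEquiv.coe_coe, ContinuousLinearEquiv.symm_apply_eq]
  set y := (extChartAt 𝓘(ℝ, Cn n) x).symm e
  have hinl : HasFDerivAt (fun h : 𝔤 => (h, e)) (ContinuousLinearMap.inl ℝ 𝔤 (Cn n))
      (unitCoord 𝔤 G) := hasFDerivAt_prodMk_left _ _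
  have h1 : HasFDerivAt (fun h : 𝔤 => actInChart 𝔤 G x (h, e)) (fundInChart 𝔤 G x e)
      (unitCoord 𝔤 G) :=
    HasFDerivAt.comp (g := actInChart 𝔤 G x) (f := fun h : 𝔤 => (h, e)) (unitCoord 𝔤 G)
      ((contDiffAt_actInChart x hsm he).differentiableAt (by simp)).hasFDerivAt hinl
  have h2 := hasMFDerivAt_extChartAt_symm x he
  have h2' : HasMFDerivAt 𝓘(ℝ, Cn n) 𝓘(ℝ, Cn n) (extChartAt 𝓘(ℝ, Cn n) x).symm
      (actInChart 𝔤 G x (unitCoord 𝔤 G, e)) (chartDeriv x e) := by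
    rw [actInChart_unitCoord x he]; exact h2
  have h3 := HasMFDerivAt.comp (unitCoord 𝔤 G) h2' h1.hasMFDerivAt
  have h4 : MDifferentiableAt 𝓘(ℝ, 𝔤) 𝓘(ℝ, Cn n) (fun g : G => g • y) (1 : G) := by
    have : ContMDiffAt 𝓘(ℝ, 𝔤) 𝓘(ℝ, Cn n) ∞ (fun g : G => g • y) 1 :=
      ContMDiffAt.comp (1 : G) (hsm _) (contMDiffAt_id.prodMk contMDiffAt_const)
    exact this.mdifferentiableAt (by simp)
  have h5 : HasMFDerivAt 𝓘(ℝ, 𝔤) 𝓘(ℝ, 𝔤) (extChartAt 𝓘(ℝ, 𝔤) (1 : G)).symm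
      (unitCoord 𝔤 G) (ContinuousLinearMap.id ℝ 𝔤) := by
    have h := mdifferentiableWithinAt_extChartAt_symm (I := 𝓘(ℝ, 𝔤))
      (mem_extChartAt_target (I := 𝓘(ℝ, 𝔤)) (1 : G))
    have h' := mfderivWithin_range_extChartAt_symm (I := 𝓘(ℝ, 𝔤)) (x := (1 : G))
    rw [modelWithCornersSelf_coe, Set.range_id, mdifferentiableWithinAt_univ] at h
    rw [modelWithCornersSelf_coe, Set.range_id, mfderivWithin_univ] at h'
    have h'' := h.hasMFDerivAt
    rw [h'] at h''
    exact h''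
  have h4' : HasMFDerivAt 𝓘(ℝ, 𝔤) 𝓘(ℝ, Cn n) (fun g : G => g • y)
      ((extChartAt 𝓘(ℝ, 𝔤) (1 : G)).symm (unitCoord 𝔤 G))
      (mfderiv 𝓘(ℝ, 𝔤) 𝓘(ℝ, Cn n) (fun g : G => g • y) (1 : G)) := by
    rw [extChartAt_symm_unitCoord]; exact h4.hasMFDerivAt
  have h6 := HasMFDerivAt.comp (unitCoord 𝔤 G) h4' h5
  have h7 : (extChartAt 𝓘(ℝ, Cn n) x).symm ∘ (fun h : 𝔤 => actInChart 𝔤 G x (h, e))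
      =ᶠ[nhds (unitCoord 𝔤 G)] (fun g : G => g • y) ∘ (extChartAt 𝓘(ℝ, 𝔤) (1 : G)).symm := by
    filter_upwards [eventually_smul_mem_source x hsm he] with h hh
    exact (extChartAt 𝓘(ℝ, Cn n) x).left_inv hh
  have h8 := hasMFDerivAt_unique h3 (h6.congr_of_eventuallyEq h7)
  have h9 := congrArg (fun D : 𝔤 →L[ℝ] Cn n => D ξ) h8
  have h10 : chartDeriv x e (fundInChart 𝔤 G x e ξ) = fundField n G ξ y := h9.symm ▸ rfl
  rw [← h10, ← hT]
  rfl

/-- The fundamental fields are holomorphic vector fields. -/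
theorem fderiv_fundInChart_I_smul (x : M) {e : Cn n}
    (hsm : ContMDiff (𝓘(ℝ, 𝔤).prod 𝓘(ℝ, Cn n)) 𝓘(ℝ, Cn n) ∞ (fun p : G × M => p.1 • p.2))
    (hhol : ∀ g : G, MDifferentiable 𝓘(ℂ, Cn n) 𝓘(ℂ, Cn n) (fun x : M => g • x))
    (he : e ∈ (extChartAt 𝓘(ℝ, Cn n) x).target) (ξ : 𝔤) (v : Cn n) :
    fderiv ℝ (fun e' => fundInChart 𝔤 G x e' ξ) e (Complex.I • v) =
      Complex.I • fderiv ℝ (fun e' => fundInChart 𝔤 G x e' ξ) e v := by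
  set ψ := actInChart (n := n) 𝔤 G x
  set h₀ := unitCoord 𝔤 G
  have hψ : ContDiffAt ℝ ∞ ψ (h₀, e) := contDiffAt_actInChart x hsm he
  have hdψ : HasFDerivAt (fderiv ℝ ψ) (fderiv ℝ (fderiv ℝ ψ) (h₀, e)) (h₀, e) :=
    ((contDiffAt_fderiv_actInChart x hsm he).differentiableAt (by simp)).hasFDerivAt
  have hsymm : IsSymmSndFDerivAt ℝ ψ (h₀, e) :=
    hψ.isSymmSndFDerivAt (by
      rw [minSmoothness_of_isRCLikeNormedField]; exact WithTop.coe_le_coe.2 le_top)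
  -- The derivative of the field is a mixed second derivative of the action; by symmetry it may be
  -- taken in the group direction last.
  have hD : ∀ w, fderiv ℝ (fun e' => fundInChart 𝔤 G x e' ξ) e w =
      fderiv ℝ (fderiv ℝ ψ) (h₀, e) (ξ, 0) (0, w) := by
    intro w
    have h1 : HasFDerivAt (fun e' : Cn n => (h₀, e')) (ContinuousLinearMap.inr ℝ 𝔤 (Cn n)) e :=
      hasFDerivAt_prodMk_right _ _
    have h2 := HasFDerivAt.comp (g := fderiv ℝ ψ) (f := fun e' : Cn n => (h₀, e')) e hdψ h1
    have h3 := h2.clm_apply (hasFDerivAt_const ((ξ, 0) : 𝔤 × Cn n) e)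
    have h4 : HasFDerivAt (fun e' => fundInChart 𝔤 G x e' ξ) _ e := h3
    rw [h4.fderiv, hsymm]
    simp
  have hE : ∀ w, HasFDerivAt (fun h => fderiv ℝ ψ (h, e) (0, w))
      (((fderiv ℝ (fderiv ℝ ψ) (h₀, e)).flip (0, w)).comp (ContinuousLinearMap.inl ℝ 𝔤 (Cn n)))
      h₀ := by
    intro w
    have h1 : HasFDerivAt (fun h : 𝔤 => (h, e)) (ContinuousLinearMap.inl ℝ 𝔤 (Cn n)) h₀ :=
      hasFDerivAt_prodMk_left _ _
    have h2 := HasFDerivAt.comp (g := fderiv ℝ ψ) (f := fun h : 𝔤 => (h, e)) h₀ hdψ h1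
    have h3 := h2.clm_apply (hasFDerivAt_const ((0, w) : 𝔤 × Cn n) h₀)
    refine h3.congr_fderiv ?_
    ext; simp
  -- Each group element near 1 acts holomorphically, so its space derivative commutes with `√-1`.
  -- Differentiating this identity in the group variable gives the claim.
  have hI : (fun h => fderiv ℝ ψ (h, e) (0, Complex.I • v)) =ᶠ[nhds h₀]
      fun h => Complex.I • fderiv ℝ ψ (h, e) (0, v) := by
    have hdiff : ∀ᶠ h in nhds h₀, DifferentiableAt ℝ ψ (h, e) := by
      have h1 := (hψ.of_le (m := 1) (by norm_cast)).eventually (by simp)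
      have h2 : ContinuousAt (fun h : 𝔤 => (h, e)) h₀ := by fun_prop
      filter_upwards [h2.eventually h1] with h hh using hh.differentiableAt (by simp)
    filter_upwards [hdiff, eventually_differentiableAt_actInChart x hsm hhol he] with h hh hc
    have h1 : HasFDerivAt (fun e' : Cn n => (h, e')) (ContinuousLinearMap.inr ℝ 𝔤 (Cn n)) e :=
      hasFDerivAt_prodMk_right _ _
    have h2 := HasFDerivAt.comp (g := ψ) (f := fun e' : Cn n => (h, e')) e hh.hasFDerivAt h1
    have h3 := h2.unique (hc.hasFDerivAt.restrictScalars ℝ)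
    have h4 : ∀ w, fderiv ℝ ψ (h, e) (0, w) = fderiv ℂ (fun e' => ψ (h, e')) e w := fun w => by
      simpa using congrArg (fun D : Cn n →L[ℝ] Cn n => D w) h3
    rw [h4, h4, map_smul]
  have h5 := ((hE v).const_smul Complex.I).congr_of_eventuallyEq hI
  have h6 := congrArg (fun D : 𝔤 →L[ℝ] Cn n => D ξ) ((hE (Complex.I • v)).unique h5)
  rw [hD, hD]
  simpa using h6

/-- Multiplication by `√-1` commutes with taking coordinates of a field. -/
theorem fieldInChart_cJ (V : M → Cn n) (x : M) {e : Cn n}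
    (he : e ∈ (extChartAt 𝓘(ℝ, Cn n) x).target) :
    fieldInChart (fun y => cJ (V y)) x e = Complex.I • fieldInChart V x e := by
  have hI := chartDeriv_I_smul x he
  obtain ⟨T, hT⟩ := chartDeriv_isInvertible x he
  simp only [fieldInChart, ← hT, ContinuousLinearMap.inverse_equiv] at hI ⊢
  simp only [ContinuousLinearEquiv.coe_coe] at hI ⊢
  rw [ContinuousLinearEquiv.symm_apply_eq, hI, ContinuousLinearEquiv.apply_symm_apply, cJ]

end ActionCharts

/-! ### Vector fields on the manifold and their coordinate expressions. -/

section Fields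

variable {n : ℕ} {M : Type*} [TopologicalSpace M] [ChartedSpace (Cn n) M]
  [IsManifold 𝓘(ℂ, Cn n) ω M]

theorem mfderiv_extChartAt_eq_inverse (x : M) {y : M}
    (hy : y ∈ (extChartAt 𝓘(ℝ, Cn n) x).source) (v : Cn n) :
    (mfderiv 𝓘(ℝ, Cn n) 𝓘(ℝ, Cn n) (extChartAt 𝓘(ℝ, Cn n) x) y : Cn n →L[ℝ] Cn n) v =
      (chartDeriv x (extChartAt 𝓘(ℝ, Cn n) x y)).inverse v := by
  have := isManifold_real_of_complex (n := n) (M := M)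
  have : IsManifold 𝓘(ℝ, Cn n) 1 M := .of_le (n := ∞) (by norm_cast)
  have h := mfderivWithin_extChartAt_symm_comp_mfderiv_extChartAt' (I := 𝓘(ℝ, Cn n)) hy
  rw [modelWithCornersSelf_coe, Set.range_id, mfderivWithin_univ] at h
  have h' : (chartDeriv x (extChartAt 𝓘(ℝ, Cn n) x y)).comp
    (mfderiv 𝓘(ℝ, Cn n) 𝓘(ℝ, Cn n) (extChartAt 𝓘(ℝ, Cn n) x) y : Cn n →L[ℝ] Cn n) =
      ContinuousLinearMap.id ℝ (Cn n) := h
  obtain ⟨T, hT⟩ := chartDeriv_isInvertible x ((extChartAt 𝓘(ℝ, Cn n) x).map_source hy)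
  rw [← hT] at h' ⊢
  rw [ContinuousLinearMap.inverse_equiv, ContinuousLinearEquiv.coe_coe]
  exact T.eq_symm_apply.2 (congrArg (fun D : Cn n →L[ℝ] Cn n => D v) h')

theorem fieldInChart_extChartAt (V : M → Cn n) (x : M) {y : M}
    (hy : y ∈ (extChartAt 𝓘(ℝ, Cn n) x).source) :
    fieldInChart V x (extChartAt 𝓘(ℝ, Cn n) x y) =
      (mfderiv 𝓘(ℝ, Cn n) 𝓘(ℝ, Cn n) (extChartAt 𝓘(ℝ, Cn n) x) y : Cn n →L[ℝ] Cn n) (V y) := by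
  rw [mfderiv_extChartAt_eq_inverse x hy, fieldInChart, (extChartAt 𝓘(ℝ, Cn n) x).left_inv hy]

/-- The trivialization of the tangent bundle at `x` acts on fibres by the derivative of the chart at
`x`, so in it the section has the components given by `fieldInChart`. -/
theorem contMDiff_of_fieldInChart [IsManifold 𝓘(ℝ, Cn n) 1 M]
    {V : (x : M) → TangentSpace 𝓘(ℝ, Cn n) x}
    (hV : ∀ x : M, ContDiffAt ℝ 1 (fieldInChart V x) (extChartAt 𝓘(ℝ, Cn n) x x)) :
    ContMDiff 𝓘(ℝ, Cn n) (𝓘(ℝ, Cn n).tangent) 1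
      (fun x => (⟨x, V x⟩ : TangentBundle 𝓘(ℝ, Cn n) M)) := by
  intro x
  rw [Bundle.contMDiffAt_section]
  have h1 : ContMDiffAt 𝓘(ℝ, Cn n) 𝓘(ℝ, Cn n) 1
      (fieldInChart V x ∘ extChartAt 𝓘(ℝ, Cn n) x) x :=
    ContMDiffAt.comp x (hV x).contMDiffAt (contMDiffAt_extChartAt)
  refine h1.congr_of_eventuallyEq ?_
  filter_upwards [(isOpen_extChartAt_source (I := 𝓘(ℝ, Cn n)) x).mem_nhds
    (mem_extChartAt_source x)] with y hy
  rw [Function.comp_apply, fieldInChart_extChartAt V x hy]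
  rw [extChartAt_source] at hy
  have := TangentBundle.continuousLinearMapAt_trivializationAt (I := 𝓘(ℝ, Cn n)) hy
  have h2 := Bundle.Trivialization.coe_linearMapAt_of_mem (R := ℝ)
    (trivializationAt (Cn n) (TangentSpace 𝓘(ℝ, Cn n)) x) (b := y) (by simpa using hy)
  exact (congrFun h2 (V y)).symm.trans
    (congrArg (fun D : Cn n →L[ℝ] Cn n => D (V y)) this)

theorem hasMFDerivAt_extChartAt_symm_comp (V : (x : M) → TangentSpace 𝓘(ℝ, Cn n) x) (x : M)
    {γ : ℝ → Cn n} {t : ℝ}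
    (ht : γ t ∈ (extChartAt 𝓘(ℝ, Cn n) x).target)
    (hγ : HasDerivAt γ (fieldInChart V x (γ t)) t) :
    HasMFDerivAt 𝓘(ℝ, ℝ) 𝓘(ℝ, Cn n) ((extChartAt 𝓘(ℝ, Cn n) x).symm ∘ γ) t
      ((1 : ℝ →L[ℝ] ℝ).smulRight (V ((extChartAt 𝓘(ℝ, Cn n) x).symm (γ t)))) := by
  have h := HasMFDerivAt.comp t (hasMFDerivAt_extChartAt_symm x ht) hγ.hasFDerivAt.hasMFDerivAt
  set w : Cn n := V ((extChartAt 𝓘(ℝ, Cn n) x).symm (γ t))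
  have h2 : (chartDeriv x (γ t)).comp (ContinuousLinearMap.toSpanSingleton ℝ
      (fieldInChart V x (γ t))) = (1 : ℝ →L[ℝ] ℝ).smulRight w := by
    obtain ⟨T, hT⟩ := chartDeriv_isInvertible x ht
    have h3 : chartDeriv x (γ t) (fieldInChart V x (γ t)) = w := by
      have h4 : fieldInChart V x (γ t) = T.symm w := by
        change (chartDeriv x (γ t)).inverse w = _
        rw [← hT, ContinuousLinearMap.inverse_equiv]
        rfl
      rw [h4, ← hT]
      exact T.apply_symm_apply _
    refine ContinuousLinearMap.ext_ring ?_
    rw [ContinuousLinearMap.comp_apply, ContinuousLinearMap.toSpanSingleton_apply,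
      ContinuousLinearMap.smulRight_apply, map_smul, h3]
    rfl
  exact h2 ▸ h

end Fields

/-! ### The flow of J X^ξ: uniqueness, completeness, C¹ dependence on ξ. -/

namespace HamiltonianAction

variable {n : ℕ} {M : Type*} [TopologicalSpace M] [ChartedSpace (Cn n) M]
  [IsManifold 𝓘(ℂ, Cn n) ω M]
  {W : KahlerStructure n M} {𝔤 : Type*} [NormedAddCommGroup 𝔤] [NormedSpace ℝ 𝔤]
  {G : Type*} [TopologicalSpace G] [ChartedSpace 𝔤 G] [Group G] [LieGroup 𝓘(ℝ, 𝔤) ∞ G]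
  [MulAction G M] (A : HamiltonianAction W 𝔤 G)

/-- The fields `J X^ξ` in the chart at `x`. -/
def JXInChart (_A : HamiltonianAction W 𝔤 G) (x : M) (e : Cn n) : 𝔤 →L[ℝ] Cn n :=
  Complex.I • fundInChart 𝔤 G x e

theorem contDiffAt_JXInChart (x : M) {e : Cn n} (he : e ∈ (extChartAt 𝓘(ℝ, Cn n) x).target) :
    ContDiffAt ℝ ∞ (A.JXInChart x) e :=
  (contDiffAt_fundInChart x A.smooth_smul he).const_smul Complex.I

theorem fieldInChart_X (ξ : 𝔤) (x : M) {e : Cn n}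
    (he : e ∈ (extChartAt 𝓘(ℝ, Cn n) x).target) :
    fieldInChart (A.X ξ) x e = fundInChart 𝔤 G x e ξ :=
  fieldInChart_fundField x A.smooth_smul he ξ

theorem fieldInChart_JX (ξ : 𝔤) (x : M) {e : Cn n}
    (he : e ∈ (extChartAt 𝓘(ℝ, Cn n) x).target) :
    fieldInChart (A.JX ξ) x e = A.JXInChart x e ξ := by
  unfold JX
  rw [fieldInChart_cJ _ x he, fieldInChart_X A ξ x he]
  rfl

theorem X_eq_fundInChart (ξ : 𝔤) (x : M) :
    A.X ξ x = fundInChart 𝔤 G x (extChartAt 𝓘(ℝ, Cn n) x x) ξ := by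
  rw [← fieldInChart_X A ξ x (mem_extChartAt_target x), fieldInChart, chartDeriv_self,
    extChartAt_to_inv, ContinuousLinearMap.inverse_id, ContinuousLinearMap.id_apply]

theorem JX_eq_JXInChart (ξ : 𝔤) (x : M) :
    A.JX ξ x = A.JXInChart x (extChartAt 𝓘(ℝ, Cn n) x x) ξ := by
  rw [JX, X_eq_fundInChart]
  rfl

/-- Scaling ξ is the same as rescaling time; this relates `expI (t • ξ)` to the curve at time `t`,
and small ξ to arbitrary ξ. -/
theorem JXfield_smul (a : ℝ) (ξ : 𝔤) : A.JXfield (a • ξ) = a • A.JXfield ξ := by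
  funext x
  exact (JX_eq_JXInChart A (a • ξ) x).trans ((map_smul _ a ξ).trans
    (congrArg (fun v : Cn n => a • v) (JX_eq_JXInChart A ξ x).symm))

theorem fieldInChart_JX_eventuallyEq (ξ : 𝔤) (x : M) {e : Cn n}
    (he : e ∈ (extChartAt 𝓘(ℝ, Cn n) x).target) :
    fieldInChart (A.JX ξ) x =ᶠ[nhds e] fun e' => A.JXInChart x e' ξ := by
  filter_upwards [(isOpen_extChartAt_target (I := 𝓘(ℝ, Cn n)) x).mem_nhds he] with e' he'
    using fieldInChart_JX A ξ x he'

theorem contMDiff_JXfield [IsManifold 𝓘(ℝ, Cn n) 1 M] (ξ : 𝔤) :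
    ContMDiff 𝓘(ℝ, Cn n) (𝓘(ℝ, Cn n).tangent) 1
      (fun x => (⟨x, A.JXfield ξ x⟩ : TangentBundle 𝓘(ℝ, Cn n) M)) := by
  refine contMDiff_of_fieldInChart fun x => ?_
  have h := ((A.contDiffAt_JXInChart x (mem_extChartAt_target x)).clm_apply
    (contDiffAt_const (c := ξ))).of_le (m := 1) (by norm_cast)
  exact h.congr_of_eventuallyEq (A.fieldInChart_JX_eventuallyEq ξ x (mem_extChartAt_target x))

/-- Uniqueness of integral curves of a C¹ field makes the choice in `expI` immaterial. -/
theorem expI_eq_of_isMIntegralCurve [T2Space M] {ξ : 𝔤} {γ : ℝ → M}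
    (hγ : IsMIntegralCurve γ (A.JXfield ξ)) : A.expI ξ (γ 0) = γ 1 := by
  have := isManifold_real_of_complex (n := n) (M := M)
  have : IsManifold 𝓘(ℝ, Cn n) 1 M := .of_le (n := ∞) (by norm_cast)
  have h : ∃ γ' : ℝ → M, γ' 0 = γ 0 ∧ IsMIntegralCurve γ' (A.JXfield ξ) := ⟨γ, rfl, hγ⟩
  rw [expI, dif_pos h]
  exact congrFun (isMIntegralCurve_Ioo_eq_of_contMDiff_boundaryless (t₀ := 0)
    (A.contMDiff_JXfield ξ) h.choose_spec.2 hγ h.choose_spec.1) 1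

theorem expI_smul_eq_of_isMIntegralCurve [T2Space M] {ξ : 𝔤} {γ : ℝ → M}
    (hγ : IsMIntegralCurve γ (A.JXfield ξ)) (t : ℝ) : A.expI (t • ξ) (γ 0) = γ t := by
  have h := hγ.comp_mul t
  rw [← JXfield_smul] at h
  simpa using A.expI_eq_of_isMIntegralCurve h

variable [FiniteDimensional ℝ 𝔤]

/-- Integral curves of `J X^ξ`, for `ξ` near `0` and starting points near `x`, exist on a fixed
interval, and are of class `C¹` in `ξ` and the starting point. -/
theorem exists_local_integralCurves (x : M) :
    ∃ γ : 𝔤 × Cn n → ℝ → Cn n,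
      ContDiffAt ℝ 1 (fun p => γ p 1) (0, extChartAt 𝓘(ℝ, Cn n) x x) ∧
      ∀ᶠ p in nhds ((0 : 𝔤), extChartAt 𝓘(ℝ, Cn n) x x), γ p 0 = p.2 ∧
        (∀ t ∈ Set.Ioo (-2 : ℝ) 2, γ p t ∈ (extChartAt 𝓘(ℝ, Cn n) x).target) ∧
        IsMIntegralCurveOn ((extChartAt 𝓘(ℝ, Cn n) x).symm ∘ γ p) (A.JXfield p.1)
          (Set.Ioo (-2 : ℝ) 2) := by
  have : CompleteSpace 𝔤 := FiniteDimensional.complete ℝ 𝔤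
  obtain ⟨γ, hγ, hev⟩ := exists_contDiffAt_solution (P := 𝔤)
    ((A.contDiffAt_JXInChart x (mem_extChartAt_target x)).of_le (m := 2)
      (WithTop.coe_le_coe.2 le_top))
    (extChartAt_target_mem_nhds (I := 𝓘(ℝ, Cn n)) x)
  refine ⟨γ, hγ, ?_⟩
  filter_upwards [hev] with p hp
  refine ⟨hp.1, fun t ht => (hp.2 t ht).1, fun t ht => ?_⟩
  obtain ⟨hmem, hd⟩ := hp.2 t ht
  refine (hasMFDerivAt_extChartAt_symm_comp (A.JXfield p.1) x hmem ?_).hasMFDerivWithinAt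
  have h := A.fieldInChart_JX p.1 x hmem
  rw [← h] at hd
  exact hd

/-- The local solutions exist on (-2,2) for small parameters only. Take such a solution for `c • ξ`
with small `c > 0` and slow it down by the factor `c`: the existence time `2 * c` is the same for
all starting points near `x`. -/
theorem exists_nhds_isMIntegralCurveOn (ξ : 𝔤) (x : M) :
    ∃ U ∈ nhds x, ∃ ε > 0, ∀ y ∈ U, ∃ γ : ℝ → M, γ 0 = y ∧
      IsMIntegralCurveOn γ (A.JXfield ξ) (Set.Ioo (-ε) ε) := by
  obtain ⟨γ, -, hev⟩ := A.exists_local_integralCurves x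
  rw [nhds_prod_eq] at hev
  obtain ⟨p, hp, q, hq, hpq⟩ := Filter.eventually_prod_iff.1 hev
  have hc : ∀ᶠ c in nhdsWithin (0 : ℝ) (Set.Ioi 0), p (c • ξ) := by
    have : Filter.Tendsto (fun c : ℝ => c • ξ) (nhds 0) (nhds 0) := by
      have : Continuous fun c : ℝ => c • ξ := by fun_prop
      simpa using this.tendsto 0
    exact (this.eventually hp).filter_mono nhdsWithin_le_nhds
  obtain ⟨c, hpc, hc0⟩ := (hc.and self_mem_nhdsWithin).exists
  have hc0 : 0 < c := hc0
  have hsrc := (isOpen_extChartAt_source (I := 𝓘(ℝ, Cn n)) x).mem_nhds (mem_extChartAt_source x)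
  refine ⟨_, Filter.inter_mem hsrc ((continuousAt_extChartAt (I := 𝓘(ℝ, Cn n)) x).eventually hq),
    2 * c, by positivity, fun y hy => ?_⟩
  obtain ⟨h0, -, hcurve⟩ := hpq hpc hy.2
  have h1 := hcurve.comp_mul c⁻¹
  simp only [] at h1
  rw [JXfield_smul, smul_smul, inv_mul_cancel₀ hc0.ne', one_smul] at h1
  refine ⟨_, ?_, h1.mono fun t ht => ?_⟩
  · simp only [Function.comp, zero_mul, h0]
    exact (extChartAt 𝓘(ℝ, Cn n) x).left_inv hy.1
  · change t * c⁻¹ ∈ Set.Ioo (-2) 2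
    rw [← div_eq_mul_inv, Set.mem_Ioo, lt_div_iff₀ hc0, div_lt_iff₀ hc0]
    exact ⟨by linarith [ht.1], ht.2⟩

variable [T2Space M] [CompactSpace M]

/-- By compactness of `M` there is one existence time for all starting points, and local curves can
then be prolonged indefinitely. -/
theorem exists_isMIntegralCurve (ξ : 𝔤) (x : M) :
    ∃ γ : ℝ → M, γ 0 = x ∧ IsMIntegralCurve γ (A.JXfield ξ) := by
  have := isManifold_real_of_complex (n := n) (M := M)
  have : IsManifold 𝓘(ℝ, Cn n) 1 M := .of_le (n := ∞) (by norm_cast)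
  have h : ∃ ε > 0, ∀ y ∈ (Set.univ : Set M), ∃ γ : ℝ → M, γ 0 = y ∧
      IsMIntegralCurveOn γ (A.JXfield ξ) (Set.Ioo (-ε) ε) := by
    refine isCompact_univ.induction_on (p := fun s : Set M => ∃ ε > 0, ∀ y ∈ s, ∃ γ : ℝ → M,
      γ 0 = y ∧ IsMIntegralCurveOn γ (A.JXfield ξ) (Set.Ioo (-ε) ε)) ⟨1, one_pos, by simp⟩ ?_ ?_ ?_
    · rintro s t hst ⟨ε, hε, h⟩
      exact ⟨ε, hε, fun y hy => h y (hst hy)⟩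
    · rintro s t ⟨ε, hε, h⟩ ⟨δ, hδ, h'⟩
      refine ⟨min ε δ, lt_min hε hδ, fun y hy => ?_⟩
      rcases hy with hy | hy
      · obtain ⟨γ, h0, hγ⟩ := h y hy
        exact ⟨γ, h0, hγ.mono (Set.Ioo_subset_Ioo (neg_le_neg (min_le_left _ _)) (min_le_left _ _))⟩
      · obtain ⟨γ, h0, hγ⟩ := h' y hy
        exact ⟨γ, h0,
          hγ.mono (Set.Ioo_subset_Ioo (neg_le_neg (min_le_right _ _)) (min_le_right _ _))⟩
    · intro y _
      obtain ⟨U, hU, ε, hε, h⟩ := A.exists_nhds_isMIntegralCurveOn ξ y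
      exact ⟨U, mem_nhdsWithin_of_mem_nhds hU, ε, hε, h⟩
  obtain ⟨ε, hε, h⟩ := h
  exact exists_isMIntegralCurve_of_isMIntegralCurveOn (A.contMDiff_JXfield ξ) hε
    (fun y => h y (Set.mem_univ y)) x

theorem expI_zero (x : M) : A.expI (0 : 𝔤) x = x := by
  obtain ⟨γ, h0, hγ⟩ := A.exists_isMIntegralCurve (0 : 𝔤) x
  rw [← smul_zero (0 : ℝ), ← h0]
  exact A.expI_smul_eq_of_isMIntegralCurve hγ 0

theorem isMIntegralCurve_expI (ξ : 𝔤) (x : M) :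
    IsMIntegralCurve (fun t : ℝ => A.expI (t • ξ) x) (A.JXfield ξ) := by
  obtain ⟨γ, h0, hγ⟩ := A.exists_isMIntegralCurve ξ x
  rw [← h0]
  simpa only [A.expI_smul_eq_of_isMIntegralCurve hγ] using hγ

theorem expI_eq_of_isMIntegralCurveOn {ξ : 𝔤} {γ : ℝ → M}
    (hγ : IsMIntegralCurveOn γ (A.JXfield ξ) (Set.Ioo (-2) 2)) : A.expI ξ (γ 0) = γ 1 := by
  have := isManifold_real_of_complex (n := n) (M := M)
  have : IsManifold 𝓘(ℝ, Cn n) 1 M := .of_le (n := ∞) (by norm_cast)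
  have h := isMIntegralCurveOn_Ioo_eqOn_of_contMDiff_boundaryless (t₀ := 0) (by norm_num)
    (A.contMDiff_JXfield ξ) ((A.isMIntegralCurve_expI ξ (γ 0)).isMIntegralCurveOn _) hγ
    (by simp [expI_zero])
  simpa using h (show (1 : ℝ) ∈ Set.Ioo (-2) 2 by norm_num)

/-- In the chart at `x`, the map `ξ ↦ e^{iξ} · x` is of class `C¹` near `0`. -/
theorem exists_contDiffAt_expI (x : M) :
    ∃ F : 𝔤 → Cn n, ContDiffAt ℝ 1 F 0 ∧ ∀ᶠ ξ in nhds (0 : 𝔤),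
      F ξ ∈ (extChartAt 𝓘(ℝ, Cn n) x).target ∧
      A.expI ξ x = (extChartAt 𝓘(ℝ, Cn n) x).symm (F ξ) := by
  obtain ⟨γ, hγ, hev⟩ := A.exists_local_integralCurves x
  set e₀ := extChartAt 𝓘(ℝ, Cn n) x x
  have hc : ContDiffAt ℝ 1 (fun ξ : 𝔤 => (ξ, e₀)) 0 := by fun_prop
  refine ⟨fun ξ => γ (ξ, e₀) 1, ContDiffAt.comp (g := fun p => γ p 1) (0 : 𝔤) hγ hc, ?_⟩
  filter_upwards [hc.continuousAt.eventually hev] with ξ hξ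
  refine ⟨hξ.2.1 1 (by norm_num), ?_⟩
  have h := A.expI_eq_of_isMIntegralCurveOn hξ.2.2
  simp only [Function.comp, hξ.1] at h
  rw [← h, extChartAt_to_inv]

end HamiltonianAction

/-! ### Second derivative at 0 of a radial integral. -/

section RadialIntegral

variable {E F : Type*} [NormedAddCommGroup E] [NormedSpace ℝ E]
  [NormedAddCommGroup F] [NormedSpace ℝ F]

/-- Mere continuity of `a` suffices, as (a ξ - a 0) ξ is o(ξ). This is how a second derivative at
the single point 0 comes out of a `ψ` that is only C¹. -/
theorem hasFDerivAt_clm_apply_self {a : E → E →L[ℝ] F} (ha : ContinuousAt a 0) :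
    HasFDerivAt (fun ξ => a ξ ξ) (a 0) 0 := by
  have h : HasFDerivAt (fun ξ => (a ξ - a 0) ξ) (0 : E →L[ℝ] F) 0 := by
    rw [hasFDerivAt_iff_isLittleO_nhds_zero]
    simp only [zero_add, sub_self, zero_apply, map_zero, sub_zero]
    rw [Asymptotics.isLittleO_iff]
    intro c hc
    have h1 : ∀ᶠ ξ in nhds (0 : E), ‖a ξ - a 0‖ < c := by
      have := (ha.sub (continuousAt_const (y := a 0))).norm
      have h2 : Filter.Tendsto (fun ξ => ‖a ξ - a 0‖) (nhds 0) (nhds 0) := by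
        simpa [ContinuousAt] using this
      exact h2.eventually (gt_mem_nhds hc)
    filter_upwards [h1] with ξ hξ
    exact ((a ξ - a 0).le_opNorm ξ).trans (by gcongr)
  refine ((h.add (a 0).hasFDerivAt).congr_of_eventuallyEq
    (Filter.Eventually.of_forall fun ξ => ?_)).congr_fderiv (zero_add _)
  simp

/-- Differentiation under the integral; compact support provides a constant dominating function. -/
theorem hasFDerivAt_integral_radial {ψ : E → F} (hψ : ContDiff ℝ 1 ψ)
    (hc : HasCompactSupport ψ) (ξ : E) :
    HasFDerivAt (fun ξ => ∫ t in (0 : ℝ)..1, ψ (t • ξ))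
      (∫ t in (0 : ℝ)..1, t • fderiv ℝ ψ (t • ξ)) ξ := by
  have hψ' : Continuous (fderiv ℝ ψ) := hψ.continuous_fderiv one_ne_zero
  obtain ⟨C, hC⟩ := (hc.fderiv ℝ).exists_bound_of_continuous hψ'
  have hcont : ∀ ξ : E, Continuous fun t : ℝ => ψ (t • ξ) := fun ξ => by
    have := hψ.continuous; fun_prop
  have hcont' : Continuous fun t : ℝ => t • fderiv ℝ ψ (t • ξ) := by fun_prop
  refine intervalIntegral.hasFDerivAt_integral_of_dominated_of_fderiv_le (s := Set.univ)
    (F' := fun ξ t => t • fderiv ℝ ψ (t • ξ)) (bound := fun _ => C)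
    Filter.univ_mem (Filter.Eventually.of_forall fun ξ => (hcont ξ).aestronglyMeasurable)
    ((hcont ξ).intervalIntegrable 0 1) hcont'.aestronglyMeasurable ?_
    intervalIntegrable_const ?_
  · refine Filter.Eventually.of_forall fun t ht η _ => ?_
    rw [Set.uIoc_of_le zero_le_one] at ht
    rw [norm_smul, Real.norm_of_nonneg ht.1.le]
    exact (mul_le_of_le_one_left (norm_nonneg _) ht.2).trans (hC _)
  · refine Filter.Eventually.of_forall fun t _ η _ => ?_
    have h1 : HasFDerivAt (fun η : E => t • η) (t • ContinuousLinearMap.id ℝ E) η :=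
      (hasFDerivAt_id η).const_smul t
    have h2 := (hψ.differentiable one_ne_zero (t • η)).hasFDerivAt.comp η h1
    refine h2.congr_fderiv ?_
    ext; simp

/-- The Hessian at `0` of `ξ ↦ 2 ∫₀¹ ψ(tξ)(ξ) dt`, for `ψ` of class `C¹` with `ψ(0) = 0`. -/
theorem hessian_integral_radial [FiniteDimensional ℝ E] {ψ : E → E →L[ℝ] ℝ}
    (hψ : ContDiffAt ℝ 1 ψ 0) (h0 : ψ 0 = 0) :
    let R : E → ℝ := fun ξ => 2 * ∫ t in (0 : ℝ)..1, ψ (t • ξ) ξ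
    (∀ᶠ ξ in nhds (0 : E), DifferentiableAt ℝ R ξ) ∧ DifferentiableAt ℝ (fderiv ℝ R) 0 ∧
      ∀ ξ η, fderiv ℝ (fderiv ℝ R) 0 ξ η = fderiv ℝ ψ 0 ξ η + fderiv ℝ ψ 0 η ξ := by
  intro R
  obtain ⟨χ, hχ, hχc, hχψ⟩ := exists_contDiff_hasCompactSupport_eventuallyEq
    (WithTop.coe_lt_coe.2 (ENat.natCast_lt_top 1)) hψ
  have hχ' : Continuous (fderiv ℝ χ) := hχ.continuous_fderiv one_ne_zero
  let Θ : E → E →L[ℝ] ℝ := fun ξ => ∫ t in (0 : ℝ)..1, χ (t • ξ)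
  let Θ' : E → E →L[ℝ] E →L[ℝ] ℝ := fun ξ => ∫ t in (0 : ℝ)..1, t • fderiv ℝ χ (t • ξ)
  have hΘ : ∀ ξ, HasFDerivAt Θ (Θ' ξ) ξ := hasFDerivAt_integral_radial hχ hχc
  have hΘ' : Continuous Θ' := by
    refine intervalIntegral.continuous_parametric_intervalIntegral_of_continuous' ?_ _ _
    fun_prop
  have hΘ0 : Θ 0 = 0 := by
    simp only [Θ, smul_zero, hχψ.eq_of_nhds, h0, intervalIntegral.integral_zero]
  -- The factor is ∫₀¹ t dt; it will cancel the 2 in front of the integral.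
  have hΘ'0 : Θ' 0 = (1 / 2 : ℝ) • fderiv ℝ ψ 0 := by
    simp only [Θ', smul_zero, hχψ.fderiv_eq]
    have h := intervalIntegral.integral_smul_const (a := 0) (b := 1)
      (μ := MeasureTheory.volume) (fun t : ℝ => t) (fderiv ℝ ψ 0)
    rw [integral_id] at h
    exact h.trans (by norm_num)
  -- For ξ in a ball around 0 the whole segment tξ stays in it, so the cut-off does not change the
  -- integral.
  have hR : ∀ᶠ ξ in nhds (0 : E), R ξ = 2 * Θ ξ ξ := by
    obtain ⟨r, hr, hball⟩ := Metric.eventually_nhds_iff_ball.1 hχψ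
    filter_upwards [Metric.ball_mem_nhds (0 : E) hr] with ξ hξ
    have hcont : Continuous fun t : ℝ => χ (t • ξ) := by
      have := hχ.continuous; fun_prop
    simp only [R, Θ]
    rw [ContinuousLinearMap.intervalIntegral_apply (hcont.intervalIntegrable 0 1)]
    congr 1
    refine intervalIntegral.integral_congr fun t ht => ?_
    rw [Set.uIcc_of_le zero_le_one] at ht
    have : t • ξ ∈ Metric.ball (0 : E) r := by
      rw [mem_ball_zero_iff] at hξ ⊢
      rw [norm_smul, Real.norm_of_nonneg ht.1]
      exact (mul_le_of_le_one_left (norm_nonneg _) ht.2).trans_lt hξ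
    simp only [hball _ this]
  have hR' : ∀ᶠ ξ in nhds (0 : E),
      HasFDerivAt R ((2 : ℝ) • (Θ ξ + (Θ' ξ).flip ξ)) ξ := by
    filter_upwards [hR.eventually_nhds] with ξ hξ
    have h1 := ((hΘ ξ).clm_apply (hasFDerivAt_id ξ)).const_mul (2 : ℝ)
    refine (h1.congr_of_eventuallyEq hξ).congr_fderiv ?_
    ext; simp
  have hfd : fderiv ℝ R =ᶠ[nhds 0] fun ξ => (2 : ℝ) • (Θ ξ + (Θ' ξ).flip ξ) :=
    hR'.mono fun ξ h => h.fderiv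
  have hflip : ContinuousAt (fun ξ => (Θ' ξ).flip) 0 :=
    ((ContinuousLinearMap.flipₗᵢ ℝ E E ℝ).continuous.comp hΘ').continuousAt
  -- The first summand of the derivative is differentiable everywhere; the second has a merely
  -- continuous coefficient and is handled at 0 alone.
  have h2 : HasFDerivAt (fderiv ℝ R) ((2 : ℝ) • (Θ' 0 + (Θ' 0).flip)) 0 :=
    (((hΘ 0).add (hasFDerivAt_clm_apply_self hflip)).const_smul (2 : ℝ)).congr_of_eventuallyEq hfd
  refine ⟨hR'.mono fun ξ h => h.differentiableAt, h2.differentiableAt, fun ξ η => ?_⟩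
  rw [h2.fderiv, hΘ'0]
  simp

end RadialIntegral

/-! ### Symmetry and invariance of the Kähler metric. -/

namespace KahlerStructure

variable {n : ℕ} {M : Type*} [TopologicalSpace M] [ChartedSpace (Cn n) M] (W : KahlerStructure n M)

theorem form_swap (x : M) (v w : Cn n) : W.form x ![v, w] = -W.form x ![w, v] := by
  have h := (W.form x).toAlternatingMap.map_swap ![w, v] (i := 0) (j := 1) (by decide)
  have h2 : ![w, v] ∘ ⇑(Equiv.swap (0 : Fin 2) 1) = ![v, w] := by
    ext i; fin_cases i <;> simp
  rw [h2] at h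
  exact h

theorem metric_comm (x : M) (v w : Cn n) : W.metric x v w = W.metric x w v := by
  have h := W.compat x v (cJ w)
  have h2 : cJ (cJ w) = -w := by simp [cJ, smul_smul]
  rw [h2] at h
  have h3 : W.form x ![cJ v, -w] = -W.form x ![cJ v, w] := by
    have h4 := (W.form x).toMultilinearMap.map_update_neg ![cJ v, w] 1 w
    have h5 : ∀ u, Function.update ![cJ v, w] 1 u = ![cJ v, u] := fun u => by
      ext i; fin_cases i <;> simp
    rw [h5, h5] at h4
    exact h4
  rw [metric, metric, ← h, h3, form_swap, neg_neg]

theorem metric_cJ (x : M) (v w : Cn n) : W.metric x (cJ v) (cJ w) = W.metric x v w := W.compat ..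

theorem metric_self_nonneg (x : M) (v : Cn n) : 0 ≤ W.metric x v v := by
  rcases eq_or_ne v 0 with rfl | hv
  · refine le_of_eq ((W.form x).toMultilinearMap.map_coord_zero (i := 0) rfl).symm
  · exact (W.pos x v hv).le

end KahlerStructure

/-! ### The moment map along the flow; minimum and Hessian of ρ. -/

namespace HamiltonianAction

variable {n : ℕ} {M : Type*} [TopologicalSpace M] [ChartedSpace (Cn n) M]
  {W : KahlerStructure n M} {𝔤 : Type*} [NormedAddCommGroup 𝔤] [NormedSpace ℝ 𝔤]
  {G : Type*} [TopologicalSpace G] [ChartedSpace 𝔤 G] [Group G]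
  [MulAction G M] (A : HamiltonianAction W 𝔤 G)

theorem mdifferentiableAt_moment (x : M) :
    MDifferentiableAt 𝓘(ℝ, Cn n) 𝓘(ℝ, 𝔤 →L[ℝ] ℝ) A.moment x :=
  A.smooth_moment.mdifferentiableAt (by simp)

theorem dFun_moment_apply (ξ : 𝔤) (x : M) (v : Cn n) :
    dFun (fun y => A.moment y ξ) x v = dFun A.moment x v ξ := by
  have h : HasMFDerivAt 𝓘(ℝ, 𝔤 →L[ℝ] ℝ) 𝓘(ℝ, ℝ) (fun f : 𝔤 →L[ℝ] ℝ => f ξ) (A.moment x)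
      (ContinuousLinearMap.apply ℝ ℝ ξ) :=
    (ContinuousLinearMap.apply ℝ ℝ ξ).hasFDerivAt.hasMFDerivAt
  have h2 := HasMFDerivAt.comp x h (A.mdifferentiableAt_moment x).hasMFDerivAt
  exact congrArg (fun D : Cn n →L[ℝ] ℝ => D v) h2.mfderiv

/-- This is the moment map equation for η evaluated on J X^ξ. For η = ξ it shows that φ_ξ is
nondecreasing along the flow of J X^ξ. -/
theorem dFun_moment_JX (ξ η : 𝔤) (x : M) :
    dFun A.moment x (A.JX ξ x) η = W.metric x (A.X η x) (A.X ξ x) := by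
  rw [← dFun_moment_apply, ← A.hamiltonian]
  rfl

/-- If X^ξ vanished at `x`, so would dφ_ξ, and every functional in the image of dΦ would kill ξ. By
regularity that image is the whole dual, which separates ξ from 0. -/
theorem X_ne_zero {x : M} (hx : A.moment x = 0) {ξ : 𝔤} (hξ : ξ ≠ 0) : A.X ξ x ≠ 0 := by
  intro h
  obtain ⟨f, hf⟩ := SeparatingDual.exists_ne_zero (R := ℝ) hξ
  obtain ⟨v, hv⟩ := A.regular x hx f
  apply hf
  rw [← hv, ← dFun_moment_apply, ← A.hamiltonian]
  exact (W.form x).toMultilinearMap.map_coord_zero (i := 0) h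

theorem rho_zero (x : M) : A.rho 0 x = 0 := by simp [rho]

variable [IsManifold 𝓘(ℂ, Cn n) ω M] [LieGroup 𝓘(ℝ, 𝔤) ∞ G] [FiniteDimensional ℝ 𝔤]
  [T2Space M] [CompactSpace M]

theorem hasDerivAt_comp_expI {F : Type*} [NormedAddCommGroup F] [NormedSpace ℝ F] {f : M → F}
    (ξ : 𝔤) (x : M) (t : ℝ)
    (hf : MDifferentiableAt 𝓘(ℝ, Cn n) 𝓘(ℝ, F) f (A.expI (t • ξ) x)) :
    HasDerivAt (fun t : ℝ => f (A.expI (t • ξ) x))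
      (dFun f (A.expI (t • ξ) x) (A.JX ξ (A.expI (t • ξ) x))) t := by
  have h := HasMFDerivAt.comp t hf.hasMFDerivAt (A.isMIntegralCurve_expI ξ x t)
  have h2 : HasFDerivAt (fun t : ℝ => f (A.expI (t • ξ) x))
      ((dFun f (A.expI (t • ξ) x)).comp
        ((1 : ℝ →L[ℝ] ℝ).smulRight (A.JX ξ (A.expI (t • ξ) x)))) t := h.hasFDerivAt
  refine h2.hasDerivAt.congr_deriv ?_
  change (dFun f (A.expI (t • ξ) x)) ((1 : ℝ) • A.JX ξ (A.expI (t • ξ) x)) = _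
  rw [one_smul]

theorem continuous_expI (ξ : 𝔤) (x : M) : Continuous fun t : ℝ => A.expI (t • ξ) x :=
  (A.isMIntegralCurve_expI ξ x).continuous

theorem hasDerivAt_moment_expI (ξ : 𝔤) (x : M) (t : ℝ) :
    HasDerivAt (fun t : ℝ => A.moment (A.expI (t • ξ) x) ξ)
      (W.metric (A.expI (t • ξ) x) (A.X ξ (A.expI (t • ξ) x)) (A.X ξ (A.expI (t • ξ) x))) t := by
  rw [← dFun_moment_JX]
  have h := (A.hasDerivAt_comp_expI ξ x t (A.mdifferentiableAt_moment _))
  exact ((ContinuousLinearMap.apply ℝ ℝ ξ).hasFDerivAt.comp_hasDerivAt t h)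

theorem continuous_moment_expI (ξ : 𝔤) (x : M) :
    Continuous fun t : ℝ => A.moment (A.expI (t • ξ) x) ξ :=
  continuous_iff_continuousAt.2 fun t => (A.hasDerivAt_moment_expI ξ x t).continuousAt

/-- The function is monotone and starts at 0. A zero at `t` would force it to vanish on [0,t],
contradicting its slope B(X^ξ, X^ξ) > 0 at time 0. -/
theorem moment_expI_pos {x : M} (hx : A.moment x = 0) {ξ : 𝔤} (hξ : ξ ≠ 0) {t : ℝ} (ht : 0 < t) :
    0 < A.moment (A.expI (t • ξ) x) ξ := by
  set φ : ℝ → ℝ := fun t => A.moment (A.expI (t • ξ) x) ξ with hφ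
  have hd := A.hasDerivAt_moment_expI ξ x
  have hmono : Monotone φ := monotone_of_hasDerivAt_nonneg hd fun t => W.metric_self_nonneg _ _
  have h0 : φ 0 = 0 := by simp [hφ, expI_zero, hx]
  refine lt_of_le_of_ne (h0 ▸ hmono ht.le) fun h => ?_
  have hzero : ∀ s ∈ Set.Icc 0 t, φ s = 0 := fun s hs =>
    le_antisymm ((hmono hs.2).trans h.symm.le) (h0 ▸ hmono hs.1)
  have h1 : HasDerivWithinAt φ 0 (Set.Icc 0 t) 0 :=
    (hasDerivWithinAt_const 0 (Set.Icc 0 t) (0 : ℝ)).congr hzero h0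
  have h2 := (hd 0).hasDerivWithinAt (s := Set.Icc 0 t)
  have h3 := (uniqueDiffOn_Icc ht 0 ⟨le_rfl, ht.le⟩).eq_deriv _ h1 h2
  rw [zero_smul, expI_zero] at h3
  exact (W.pos x _ (A.X_ne_zero hx hξ)).ne h3

theorem rho_pos {x : M} (hx : A.moment x = 0) {ξ : 𝔤} (hξ : ξ ≠ 0) : 0 < A.rho ξ x := by
  refine mul_pos two_pos (intervalIntegral.intervalIntegral_pos_of_pos_on
    ((A.continuous_moment_expI ξ x).intervalIntegrable 0 1) (fun t ht => ?_) one_pos)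
  exact A.moment_expI_pos hx hξ ht.1

theorem contDiffAt_moment_expI (x : M) : ContDiffAt ℝ 1 (fun ξ : 𝔤 => A.moment (A.expI ξ x)) 0 := by
  have := isManifold_real_of_complex (n := n) (M := M)
  obtain ⟨F, hF, hev⟩ := A.exists_contDiffAt_expI x
  have h1 : ContDiffAt ℝ 1 (A.moment ∘ (extChartAt 𝓘(ℝ, Cn n) x).symm) (F 0) := by
    have h : ContMDiffAt 𝓘(ℝ, Cn n) 𝓘(ℝ, Cn n) ∞ (extChartAt 𝓘(ℝ, Cn n) x).symm (F 0) :=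
      (contMDiffOn_extChartAt_symm x).contMDiffAt
        ((isOpen_extChartAt_target x).mem_nhds hev.self_of_nhds.1)
    exact (ContMDiffAt.comp (F 0) (A.smooth_moment _) h).contDiffAt.of_le (by norm_cast)
  refine (h1.comp (0 : 𝔤) hF).congr_of_eventuallyEq ?_
  filter_upwards [hev] with ξ hξ
  simp [hξ.2]

/-- Differentiability being known, the derivative is found along the ray tξ, which maps to an
integral curve of J X^ξ. -/
theorem fderiv_moment_expI (x : M) (ξ η : 𝔤) :
    fderiv ℝ (fun ξ : 𝔤 => A.moment (A.expI ξ x)) 0 ξ η = W.metric x (A.X η x) (A.X ξ x) := by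
  have h1 : HasDerivAt (fun t : ℝ => t • ξ) ξ 0 := by
    simpa using (hasDerivAt_id (0 : ℝ)).smul_const ξ
  have h2 : HasFDerivAt (fun ξ : 𝔤 => A.moment (A.expI ξ x))
      (fderiv ℝ (fun ξ : 𝔤 => A.moment (A.expI ξ x)) 0) ((0 : ℝ) • ξ) := by
    rw [zero_smul]
    exact ((A.contDiffAt_moment_expI x).differentiableAt one_ne_zero).hasFDerivAt
  have h3 := h2.comp_hasDerivAt (0 : ℝ) h1
  have h4 := A.hasDerivAt_comp_expI ξ x 0 (A.mdifferentiableAt_moment _)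
  rw [h3.unique h4, zero_smul, expI_zero, dFun_moment_JX]

theorem hessian_rho {x : M} (hx : A.moment x = 0) :
    (∀ᶠ ξ in nhds (0 : 𝔤), DifferentiableAt ℝ (fun η : 𝔤 => A.rho η x) ξ) ∧
      DifferentiableAt ℝ (fderiv ℝ (fun η : 𝔤 => A.rho η x)) 0 ∧
      ∀ ξ₁ ξ₂ : 𝔤, fderiv ℝ (fderiv ℝ (fun η : 𝔤 => A.rho η x)) 0 ξ₁ ξ₂ =
        2 * W.metric x (A.JX ξ₁ x) (A.JX ξ₂ x) := by
  obtain ⟨h1, h2, h3⟩ := hessian_integral_radial (A.contDiffAt_moment_expI x)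
    (by rw [expI_zero, hx])
  refine ⟨h1, h2, fun ξ η => (h3 ξ η).trans ?_⟩
  rw [fderiv_moment_expI, fderiv_moment_expI, JX, JX, W.metric_cJ, W.metric_comm x (A.X η x)]
  ring

end HamiltonianAction

/-! ### Top-degree alternating maps, traces and determinants. -/

section AlternatingTrace

variable {R V N ι : Type*} [CommRing R] [AddCommGroup V] [Module R V] [AddCommGroup N]
  [Module R N] [Fintype ι] [DecidableEq ι]

/-- Inserting an endomorphism in each slot in turn of an alternating map of top degree multiplies
it by the trace. -/
theorem AlternatingMap.sum_update_basis_eq_trace (f : V [⋀^ι]→ₗ[R] N) (b : Module.Basis ι R V)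
    (A : V →ₗ[R] V) :
    ∑ i, f (Function.update b i (A (b i))) = LinearMap.trace R V A • f b := by
  have h : ∀ i, f (Function.update b i (A (b i))) = b.repr (A (b i)) i • f b := by
    intro i
    conv_lhs => rw [← b.sum_repr (A (b i))]
    rw [f.map_update_sum]
    rw [Finset.sum_eq_single i]
    · rw [f.map_update_smul, Function.update_eq_self]
    · intro k _ hk
      rw [f.map_update_smul, f.map_update_self _ (Ne.symm hk), smul_zero]
    · simp
  simp only [h, ← Finset.sum_smul]
  rw [LinearMap.trace_eq_matrix_trace R b, Matrix.trace]
  simp [LinearMap.toMatrix_apply]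

theorem AlternatingMap.apply_comp_eq_det_smul (f : V [⋀^ι]→ₗ[R] R) (b : Module.Basis ι R V)
    (A : V →ₗ[R] V) (v : ι → V) : f (fun i => A (v i)) = LinearMap.det A * f v := by
  rw [f.eq_smul_basis_det b]
  simp only [AlternatingMap.smul_apply, smul_eq_mul]
  have := b.det_comp A v
  rw [Function.comp_def] at this
  rw [this]
  ring

end AlternatingTrace

/-! ### The standard complex and real frames as bases. -/

section Frames

variable (n : ℕ)

/-- The complex frame as a basis. -/
def complexBasis : Module.Basis (Fin n) ℂ (Cn n) := (EuclideanSpace.basisFun (Fin n) ℂ).toBasis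

theorem coe_complexBasis : ⇑(complexBasis n) = complexFrame n := by
  ext i : 1
  simp [complexBasis, complexFrame]

/-- The positions in the real frame as pairs of an index of `ℂⁿ` and one of `ℂ = ℝ²`. -/
def pairIndex : Fin n × Fin 2 ≃ Fin (2 * n) :=
  finProdFinEquiv.trans (finCongr (mul_comm n 2))

theorem pairIndex_val (p : Fin n × Fin 2) : (pairIndex n p : ℕ) = p.2 + 2 * p.1 := rfl

/-- The real frame as a basis. -/
def realBasis : Module.Basis (Fin (2 * n)) ℝ (Cn n) :=
  (Complex.basisOneI.smulTower (complexBasis n)).reindex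
    ((Equiv.prodComm _ _).trans (pairIndex n))

theorem coe_realBasis : ⇑(realBasis n) = realFrame n := by
  ext i : 1
  obtain ⟨⟨j, b⟩, rfl⟩ := (pairIndex n).surjective i
  have h1 : (pairIndex n (j, b) : ℕ) / 2 = j := by
    rw [pairIndex_val]; simp only; omega
  have h2 : (pairIndex n (j, b) : ℕ) % 2 = b := by
    rw [pairIndex_val]; simp only; omega
  have h3 : realBasis n (pairIndex n (j, b)) = Complex.basisOneI b • complexBasis n j := by
    simp [realBasis]
  rw [h3, realFrame]
  simp only [h1, h2, coe_complexBasis, complexFrame]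
  fin_cases b <;> ext k <;> simp

end Frames

/-! ### The Liouville form as an alternating map, and its nonvanishing. -/

section Liouville

/-- Slot `m` enters only the factor of index `m / 2`, on the side given by the parity of `m`.
Multilinearity of the product is thus reduced to linearity of one factor. -/
theorem prod_update_pair {n : ℕ} {V N : Type*} [CommMonoid N] (B : V → V → N) (v : Fin (2 * n) → V)
    (m : Fin (2 * n)) (x : V) :
    ∏ i : Fin n, B (Function.update v m x ⟨2 * i.1, by omega⟩)
        (Function.update v m x ⟨2 * i.1 + 1, by omega⟩) =
      (if m.1 % 2 = 0 then B x (v ⟨2 * (m.1 / 2) + 1, by omega⟩)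
        else B (v ⟨2 * (m.1 / 2), by omega⟩) x) *
      ∏ i ∈ Finset.univ.erase (⟨m.1 / 2, by omega⟩ : Fin n),
        B (v ⟨2 * i.1, by omega⟩) (v ⟨2 * i.1 + 1, by omega⟩) := by
  rw [← Finset.mul_prod_erase Finset.univ _ (Finset.mem_univ (⟨m.1 / 2, by omega⟩ : Fin n))]
  congr 1
  · split_ifs with h
    · rw [show (⟨2 * (m.1 / 2), by omega⟩ : Fin (2 * n)) = m from Fin.ext (by simp only; omega),
        Function.update_self, Function.update_of_ne]
      exact fun h' => by have := congrArg Fin.val h'; simp only at this; omega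
    · rw [show (⟨2 * (m.1 / 2) + 1, by omega⟩ : Fin (2 * n)) = m from
          Fin.ext (by simp only; omega), Function.update_self, Function.update_of_ne]
      exact fun h' => by have := congrArg Fin.val h'; simp only at this; omega
  · refine Finset.prod_congr rfl fun i hi => ?_
    have hi' : i.1 ≠ m.1 / 2 := fun h => (Finset.mem_erase.1 hi).1 (Fin.ext h)
    rw [Function.update_of_ne, Function.update_of_ne]
    · exact fun h' => by have := congrArg Fin.val h'; simp only at this; omega
    · exact fun h' => by have := congrArg Fin.val h'; simp only at this; omega

variable {n : ℕ} {V : Type*} [AddCommGroup V] [Module ℝ V]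

/-- The multilinear form `∏ᵢ B(v₂ᵢ, v₂ᵢ₊₁)`. -/
def pairProduct (n : ℕ) (B : V →ₗ[ℝ] V →ₗ[ℝ] ℝ) :
    MultilinearMap ℝ (fun _ : Fin (2 * n) => V) ℝ where
  toFun v := ∏ i : Fin n, B (v ⟨2 * i.1, by omega⟩) (v ⟨2 * i.1 + 1, by omega⟩)
  map_update_add' {inst} v m x y := by
    rw [Subsingleton.elim inst (instDecidableEqFin _)]
    simp only [prod_update_pair (fun a b => B a b) v m]
    split_ifs <;> simp [add_mul]
  map_update_smul' {inst} v m c x := by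
    rw [Subsingleton.elim inst (instDecidableEqFin _)]
    simp only [prod_update_pair (fun a b => B a b) v m]
    split_ifs <;> simp [mul_assoc]

/-- The alternating form `Bⁿ / n!` of top degree. -/
def liouvilleAlt (n : ℕ) (B : V →ₗ[ℝ] V →ₗ[ℝ] ℝ) : V [⋀^Fin (2 * n)]→ₗ[ℝ] ℝ :=
  ((2 : ℝ) ^ n * (n.factorial : ℝ))⁻¹ • MultilinearMap.alternatization (pairProduct n B)

theorem liouvilleAlt_apply (B : V →ₗ[ℝ] V →ₗ[ℝ] ℝ) (v : Fin (2 * n) → V) :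
    liouvilleAlt n B v = ((2 : ℝ) ^ n * (n.factorial : ℝ))⁻¹ * ∑ σ : Equiv.Perm (Fin (2 * n)),
      ((Equiv.Perm.sign σ : ℤ) : ℝ) *
        ∏ i : Fin n, B (v (σ ⟨2 * i.1, by omega⟩)) (v (σ ⟨2 * i.1 + 1, by omega⟩)) := by
  rw [liouvilleAlt, AlternatingMap.smul_apply, MultilinearMap.alternatization_apply, smul_eq_mul]
  congr 1
  refine Finset.sum_congr rfl fun σ _ => ?_
  rw [Units.smul_def, zsmul_eq_mul]
  rfl

/-- A permutation of pairs that permutes the blocks `{(i,0), (i,1)}` has the product of the signs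
inside the blocks as its sign. -/
theorem sign_eq_prod_of_blocks (σ : Equiv.Perm (Fin n × Fin 2)) (π : Fin n → Fin n)
    (s : Fin n → Equiv.Perm (Fin 2)) (h : ∀ i b, σ (i, b) = (π i, s i b)) :
    Equiv.Perm.sign σ = ∏ i, Equiv.Perm.sign (s i) := by
  have hπ : Function.Surjective π := by
    intro j
    obtain ⟨⟨i, b⟩, hi⟩ := σ.surjective (j, 0)
    exact ⟨i, by rw [h] at hi; exact congrArg Prod.fst hi⟩
  let τ : Equiv.Perm (Fin n) := Equiv.ofBijective π (Finite.injective_iff_bijective.1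
    (Finite.injective_iff_surjective.2 hπ))
  -- The permutation of the blocks acts on two copies of the index set, so its sign enters squared
  -- and disappears.
  have hσ : σ = Equiv.prodCongrLeft (fun _ : Fin 2 => τ) * Equiv.prodCongrRight s := by
    ext ⟨i, b⟩ : 1
    rw [h, Equiv.Perm.mul_apply]
    rfl
  rw [hσ, Equiv.Perm.sign_mul, Equiv.Perm.sign_prodCongrLeft, Equiv.Perm.sign_prodCongrRight]
  simp

/-- On a unitary frame each term of the sum defining `Bⁿ / n!` is nonnegative. -/
theorem sign_mul_prod_nonneg (u : Fin n × Fin 2 → V) (B : V →ₗ[ℝ] V →ₗ[ℝ] ℝ)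
    (hB : ∀ p q, B (u p) (u q) = if p.1 = q.1 then
      (if p.2 = 0 ∧ q.2 = 1 then 1 else if p.2 = 1 ∧ q.2 = 0 then -1 else 0) else 0)
    (σ : Equiv.Perm (Fin n × Fin 2)) :
    0 ≤ ((Equiv.Perm.sign σ : ℤ) : ℝ) * ∏ i : Fin n, B (u (σ (i, 0))) (u (σ (i, 1))) := by
  by_cases h0 : ∃ i, B (u (σ (i, 0))) (u (σ (i, 1))) = 0
  · obtain ⟨i, hi⟩ := h0
    rw [Finset.prod_eq_zero (Finset.mem_univ i) hi, mul_zero]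
  push Not at h0
  -- If no factor vanishes, `σ` maps blocks to blocks. Each factor is then the sign of the
  -- permutation inside its block, so the product equals the sign of `σ`.
  let s : Fin n → Equiv.Perm (Fin 2) := fun i =>
    if (σ (i, 0)).2 = 0 then 1 else Equiv.swap 0 1
  have key : ∀ i, (σ (i, 1)).1 = (σ (i, 0)).1 ∧ (σ (i, 0)).2 = s i 0 ∧ (σ (i, 1)).2 = s i 1 ∧
      B (u (σ (i, 0))) (u (σ (i, 1))) = ((Equiv.Perm.sign (s i) : ℤ) : ℝ) := by
    intro i
    have hi := h0 i
    rw [hB] at hi ⊢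
    simp only [s]
    generalize σ (i, 0) = p at *
    generalize σ (i, 1) = q at *
    obtain ⟨p1, p2⟩ := p
    obtain ⟨q1, q2⟩ := q
    by_cases hpq : p1 = q1
    · subst hpq
      fin_cases p2 <;> fin_cases q2 <;> simp_all
    · simp [hpq] at hi
  have hsign := sign_eq_prod_of_blocks σ (fun i => (σ (i, 0)).1) s (fun i b => by
    obtain ⟨h1, h2, h3, -⟩ := key i
    fin_cases b
    · exact Prod.ext rfl h2
    · exact Prod.ext h1 h3)
  rw [hsign, Finset.prod_congr rfl fun i _ => (key i).2.2.2]
  push_cast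
  exact mul_self_nonneg _

/-- No term of the sum is negative, and the identity permutation contributes 1. -/
theorem liouvilleAlt_pos_of_unitary (u : Fin n × Fin 2 → V) (B : V →ₗ[ℝ] V →ₗ[ℝ] ℝ)
    (hB : ∀ p q, B (u p) (u q) = if p.1 = q.1 then
      (if p.2 = 0 ∧ q.2 = 1 then 1 else if p.2 = 1 ∧ q.2 = 0 then -1 else 0) else 0) :
    0 < liouvilleAlt n B (u ∘ (pairIndex n).symm) := by
  rw [liouvilleAlt_apply]
  refine mul_pos (by positivity) ?_
  have hterm : ∀ σ : Equiv.Perm (Fin (2 * n)), ((Equiv.Perm.sign σ : ℤ) : ℝ) *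
      ∏ i : Fin n, B ((u ∘ (pairIndex n).symm) (σ ⟨2 * i.1, by omega⟩))
        ((u ∘ (pairIndex n).symm) (σ ⟨2 * i.1 + 1, by omega⟩)) =
      ((Equiv.Perm.sign ((pairIndex n).symm.permCongr σ) : ℤ) : ℝ) *
        ∏ i : Fin n, B (u ((pairIndex n).symm.permCongr σ (i, 0)))
          (u ((pairIndex n).symm.permCongr σ (i, 1))) := by
    intro σ
    rw [Equiv.Perm.sign_permCongr]
    congr 1
    refine Finset.prod_congr rfl fun i _ => ?_
    have h0 : pairIndex n (i, 0) = ⟨2 * i.1, by omega⟩ := Fin.ext (by rw [pairIndex_val]; simp)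
    have h1 : pairIndex n (i, 1) = ⟨2 * i.1 + 1, by omega⟩ :=
      Fin.ext (by rw [pairIndex_val]; simp [add_comm])
    simp only [Equiv.permCongr_apply, Equiv.symm_symm, h0, h1, Function.comp_apply]
  refine Finset.sum_pos' (fun σ _ => ?_) ⟨1, Finset.mem_univ _, ?_⟩
  · rw [hterm]; exact sign_mul_prod_nonneg u B hB _
  · rw [hterm, Equiv.Perm.sign_permCongr]
    have h1 : (pairIndex n).symm.permCongr 1 = 1 := by ext x : 1; simp [Equiv.permCongr_apply]
    simp only [h1, Equiv.Perm.one_apply, hB]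
    simp

end Liouville

/-- A positive definite sesquilinear form has an orthonormal basis. -/
theorem exists_orthonormal_basis_of_core {V : Type*} [AddCommGroup V] [Module ℂ V]
    [FiniteDimensional ℂ V] (c : InnerProductSpace.Core ℂ V) :
    ∃ b : Module.Basis (Fin (Module.finrank ℂ V)) ℂ V,
      ∀ i j, c.inner (b i) (b j) = if i = j then 1 else 0 := by
  let : NormedAddCommGroup V := c.toNormedAddCommGroup
  let : InnerProductSpace ℂ V := InnerProductSpace.ofCore c.toCore
  let b := stdOrthonormalBasis ℂ V
  refine ⟨b.toBasis, fun i j => ?_⟩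
  rw [b.coe_toBasis]
  exact orthonormal_iff_ite.1 b.orthonormal i j

/-- A positive two-form of type `(1,1)` has nonvanishing top power. -/
theorem liouvilleAlt_realFrame_ne_zero {n : ℕ} (B : Cn n →ₗ[ℝ] Cn n →ₗ[ℝ] ℝ)
    (hswap : ∀ v w, B v w = -B w v) (hcompat : ∀ v w, B (cJ v) (cJ w) = B v w)
    (hpos : ∀ v, v ≠ 0 → 0 < B v (cJ v)) : liouvilleAlt n B (realFrame n) ≠ 0 := by
  have hJJ : ∀ v : Cn n, cJ (cJ v) = -v := fun v => by simp [cJ, smul_smul]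
  have hJ1 : ∀ v w, B (cJ v) w = -B v (cJ w) := fun v w => by
    rw [← hcompat v (cJ w), hJJ, map_neg, neg_neg]
  have hself : ∀ v, B v v = 0 := fun v => by linarith [hswap v v]
  -- The Hermitian form B(v, Jw) + √-1 B(v, w). For an orthonormal basis b of it, the vectors b and
  -- Jb form a unitary frame for `B`.
  let c : InnerProductSpace.Core ℂ (Cn n) :=
    { inner := fun v w => ⟨B v (cJ w), B v w⟩
      conj_inner_symm := fun v w => by
        apply Complex.ext
        · simp only [Complex.conj_re]
          rw [hswap w, hJ1, neg_neg]
        · simp only [Complex.conj_im]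
          rw [hswap w, neg_neg]
      re_inner_nonneg := fun v => by
        rcases eq_or_ne v 0 with rfl | hv
        · simp
        · exact (hpos v hv).le
      add_left := fun u v w => by apply Complex.ext <;> simp
      smul_left := fun v w r => by
        have hr : r • v = r.re • v + r.im • cJ v := by
          conv_lhs => rw [← Complex.re_add_im r]
          rw [add_smul, mul_smul]
          rfl
        rw [hr]
        apply Complex.ext
        · simp only [map_add, map_smul, LinearMap.add_apply, LinearMap.smul_apply, smul_eq_mul,
            Complex.mul_re, Complex.conj_re, Complex.conj_im, hcompat]
          ring
        · simp only [map_add, map_smul, LinearMap.add_apply, LinearMap.smul_apply, smul_eq_mul,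
            Complex.mul_im, Complex.conj_re, Complex.conj_im, hJ1]
          ring
      definite := fun v hv => by
        by_contra h
        exact (hpos v h).ne' (congrArg Complex.re hv) }
  obtain ⟨b', hb'⟩ := exists_orthonormal_basis_of_core c
  let b := b'.reindex (finCongr (show Module.finrank ℂ (Cn n) = n by simp))
  have hb : ∀ i j, c.inner (b i) (b j) = if i = j then 1 else 0 := fun i j => by
    simp only [b, Module.Basis.reindex_apply, hb']
    simp
  have hre : ∀ i j, B (b i) (cJ (b j)) = if i = j then 1 else 0 := fun i j => by
    have := congrArg Complex.re (hb i j)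
    rw [apply_ite Complex.re] at this
    exact this
  have him : ∀ i j, B (b i) (b j) = 0 := fun i j => by
    have := congrArg Complex.im (hb i j)
    rw [apply_ite Complex.im] at this
    simp only [Complex.one_im, Complex.zero_im, ite_self] at this
    exact this
  let u : Fin n × Fin 2 → Cn n := fun p => if p.2 = 0 then b p.1 else cJ (b p.1)
  have hu := liouvilleAlt_pos_of_unitary u B (by
    rintro ⟨i, p⟩ ⟨j, q⟩
    fin_cases p <;> fin_cases q <;> simp [u, hre, him, hJ1, hJJ]
    split_ifs <;> simp)
  -- A top-degree alternating map vanishing on one basis is zero, so positivity on the unitary frame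
  -- gives nonvanishing on the standard one.
  rw [← coe_realBasis, AlternatingMap.map_basis_ne_zero_iff]
  rintro h
  rw [h] at hu
  exact lt_irrefl _ hu

/-- The trace of the real linear map underlying a complex linear map. -/
theorem trace_restrictScalars_complex {V : Type*} [AddCommGroup V] [Module ℂ V]
    [FiniteDimensional ℂ V] (A : V →ₗ[ℂ] V) :
    LinearMap.trace ℝ V (A.restrictScalars ℝ) = 2 * (LinearMap.trace ℂ V A).re := by
  classical
  let b := Module.finBasis ℂ V
  rw [LinearMap.trace_eq_matrix_trace ℂ b,
    LinearMap.trace_eq_matrix_trace ℝ (Complex.basisOneI.smulTower b)]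
  simp only [Matrix.trace, Matrix.diag, LinearMap.toMatrix_apply, Fintype.sum_prod_type,
    Fin.sum_univ_two, Complex.re_sum]
  simp only [Module.Basis.smulTower_repr_mk, Module.Basis.smulTower_apply,
    LinearMap.restrictScalars_apply, map_smul, Finsupp.smul_apply]
  rw [← Finset.sum_add_distrib, Finset.mul_sum]
  refine Finset.sum_congr rfl fun i _ => ?_
  simp
  ring

theorem det_restrictScalars_complex {V : Type*} [AddCommGroup V] [Module ℂ V]
    [FiniteDimensional ℂ V] (A : V →ₗ[ℂ] V) :
    LinearMap.det (A.restrictScalars ℝ) = ‖LinearMap.det A‖ ^ 2 := by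
  rw [LinearMap.det_restrictScalars, Algebra.norm_complex_apply, Complex.normSq_eq_norm_sq]

/-! ### Forms of type (n,0) are multiples of the complex determinant. -/

section TypeN0

variable {n : ℕ}

/-- A real alternating form that commutes with `√-1` in each slot, as a complex alternating
form. -/
def complexAlternating (α : (Cn n) [⋀^Fin n]→L[ℝ] ℂ)
    (h : ∀ (v : Fin n → Cn n) (j : Fin n),
      α (Function.update v j (cJ (v j))) = Complex.I * α v) : (Cn n) [⋀^Fin n]→ₗ[ℂ] ℂ where
  toFun := α
  map_update_add' {inst} v i x y := by
    obtain rfl : inst = instDecidableEqFin n := Subsingleton.elim _ _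
    exact α.toAlternatingMap.map_update_add v i x y
  map_update_smul' {inst} v i c x := by
    obtain rfl : inst = instDecidableEqFin n := Subsingleton.elim _ _
    have h1 : c • x = c.re • x + c.im • cJ x := by
      conv_lhs => rw [← Complex.re_add_im c]
      rw [add_smul, mul_smul]
      rfl
    have h2 := h (Function.update v i x) i
    rw [Function.update_self, Function.update_idem] at h2
    have h3 := α.toAlternatingMap.map_update_add v i (c.re • x) (c.im • cJ x)
    rw [α.toAlternatingMap.map_update_smul, α.toAlternatingMap.map_update_smul] at h3
    have h4 : α (Function.update v i (c.re • x + c.im • cJ x)) =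
        c.re • α (Function.update v i x) + c.im • α (Function.update v i (cJ x)) := h3
    rw [h1, h4, h2]
    simp only [Complex.real_smul, smul_eq_mul]
    conv_rhs => rw [← Complex.re_add_im c]
    ring
  map_eq_zero_of_eq' v i j hv hij := α.toAlternatingMap.map_eq_zero_of_eq v hv hij

theorem apply_eq_mul_det (α : (Cn n) [⋀^Fin n]→L[ℝ] ℂ)
    (h : ∀ (v : Fin n → Cn n) (j : Fin n),
      α (Function.update v j (cJ (v j))) = Complex.I * α v) (v : Fin n → Cn n) :
    α v = α (complexFrame n) * (complexBasis n).det v := by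
  have := congrArg (fun f => f v)
    ((complexAlternating α h).eq_smul_basis_det (complexBasis n))
  rw [coe_complexBasis] at this
  exact this

/-- The value of `α ∧ ᾱ` on the standard frame, for `α = dz₁ ∧ ⋯ ∧ dzₙ`. -/
def wedgeConst (n : ℕ) : ℂ :=
  ((n.factorial : ℂ) * (n.factorial : ℂ))⁻¹ * ∑ σ : Equiv.Perm (Fin (2 * n)),
    ((Equiv.Perm.sign σ : ℤ) : ℂ) *
      ((complexBasis n).det (fun i : Fin n => realFrame n (σ ⟨i.1, by omega⟩)) *
        (starRingEnd ℂ) ((complexBasis n).det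
          (fun i : Fin n => realFrame n (σ ⟨n + i.1, by omega⟩))))

/-- Both factors of each term are the coefficient of the form times a complex determinant. The sum
that remains depends on `n` only and enters |e_a|² as a constant factor. -/
theorem wedgeConj_realFrame {M : Type*} [TopologicalSpace M] [ChartedSpace (Cn n) M]
    {α : DiffForm n n M ℂ} (hα : DiffForm.IsTypeN0 α) (x : M) :
    wedgeConj α x (realFrame n) = ((‖α x (complexFrame n)‖ ^ 2 : ℝ) : ℂ) * wedgeConst n := by
  rw [wedgeConj, wedgeConst]
  conv_rhs => rw [mul_left_comm, Finset.mul_sum]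
  congr 1
  refine Finset.sum_congr rfl fun σ _ => ?_
  rw [apply_eq_mul_det (α x) (hα x) fun i : Fin n => realFrame n (σ ⟨i.1, by omega⟩),
    apply_eq_mul_det (α x) (hα x) fun i : Fin n => realFrame n (σ ⟨n + i.1, by omega⟩),
    map_mul, Complex.ofReal_pow, ← Complex.mul_conj']
  ring

end TypeN0

/-! ### Derivative of the determinant. -/

section Jacobi

/-- **Jacobi's formula** for the derivative of the determinant. -/
theorem hasFDerivAt_det {n : ℕ} {E : Type*} [NormedAddCommGroup E] [NormedSpace ℝ E]
    {D : E → Cn n →L[ℝ] Cn n} {D' : E →L[ℝ] Cn n →L[ℝ] Cn n} {e : E}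
    (hD : HasFDerivAt D D' e) (T : Cn n ≃L[ℝ] Cn n) (hT : (T : Cn n →L[ℝ] Cn n) = D e) :
    ∃ δ : E →L[ℝ] ℝ, HasFDerivAt (fun e => LinearMap.det (D e : Cn n →ₗ[ℝ] Cn n)) δ e ∧
      ∀ w, δ w = LinearMap.det (D e : Cn n →ₗ[ℝ] Cn n) *
        LinearMap.trace ℝ (Cn n)
          (((T.symm : Cn n →L[ℝ] Cn n).comp (D' w) : Cn n →L[ℝ] Cn n) : Cn n →ₗ[ℝ] Cn n) := by
  set b := realBasis n
  let f : ContinuousMultilinearMap ℝ (fun _ : Fin (2 * n) => Cn n) ℝ :=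
    ⟨b.det.toMultilinearMap, by
      change Continuous fun v => b.det v
      simp only [b.det_apply]
      refine Continuous.matrix_det (continuous_matrix fun i j => ?_)
      exact (LinearMap.continuous_of_finiteDimensional (b.coord i)).comp (continuous_apply j)⟩
  have hf : ∀ v, f v = b.det v := fun v => rfl
  have hdet : ∀ A : Cn n →L[ℝ] Cn n, LinearMap.det (A : Cn n →ₗ[ℝ] Cn n) = f fun i => A (b i) := by
    intro A
    rw [hf]
    have := b.det_comp (A : Cn n →ₗ[ℝ] Cn n) b
    rw [b.det_self, mul_one] at this
    exact this.symm
  have h1 : ∀ i, HasFDerivAt (fun e => D e (b i)) (D'.flip (b i)) e := fun i => by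
    refine (hD.clm_apply (hasFDerivAt_const (b i) e)).congr_fderiv ?_
    ext; simp
  have h2 := HasFDerivAt.multilinear_comp (f := f) h1
  refine ⟨_, h2.congr_of_eventuallyEq (Filter.Eventually.of_forall fun e => hdet (D e)), ?_⟩
  intro w
  simp only [_root_.sum_apply, ContinuousLinearMap.comp_apply, ContinuousLinearMap.flip_apply,
    ContinuousMultilinearMap.toContinuousLinearMap_apply, hf]
  -- Since `D e = T`, factoring `T` out of all slots leaves the basis with one entry changed by T⁻¹
  -- D'(w); the sum of these is a trace.
  have h3 : ∀ i, b.det (Function.update (fun j => D e (b j)) i (D' w (b i))) =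
      LinearMap.det (D e : Cn n →ₗ[ℝ] Cn n) * b.det (Function.update b i (T.symm (D' w (b i)))) := by
    intro i
    rw [← b.det_comp]
    congr 1
    ext j : 1
    rcases eq_or_ne j i with rfl | hj
    · simp [← hT]
    · simp [hj]
  simp only [h3, ← Finset.mul_sum]
  congr 1
  have h4 := b.det.sum_update_basis_eq_trace b
    (((T.symm : Cn n →L[ℝ] Cn n).comp (D' w) : Cn n →L[ℝ] Cn n) : Cn n →ₗ[ℝ] Cn n)
  rw [b.det_self, smul_eq_mul, mul_one] at h4
  exact h4

end Jacobi

/-! ### Change of coordinates for volume densities and divergences. -/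

section LiouvilleInChart

variable {n : ℕ}

/-- A two-form as a bilinear map. -/
def twoFormBilin (Ω : (Cn n) [⋀^Fin 2]→L[ℝ] ℝ) : Cn n →ₗ[ℝ] Cn n →ₗ[ℝ] ℝ :=
  have h0 : ∀ u v w : Cn n, Function.update ![v, w] 0 u = ![u, w] := fun u v w => by
    ext i : 1; fin_cases i <;> simp
  have h1 : ∀ u v w : Cn n, Function.update ![v, w] 1 u = ![v, u] := fun u v w => by
    ext i : 1; fin_cases i <;> simp
  LinearMap.mk₂ ℝ (fun v w => Ω ![v, w])
    (fun v v' w => by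
      have h := Ω.toMultilinearMap.map_update_add ![v, w] 0 v v'
      simp only [h0] at h
      exact h)
    (fun c v w => by
      have h := Ω.toMultilinearMap.map_update_smul ![v, w] 0 c v
      simp only [h0] at h
      exact h)
    (fun v w w' => by
      have h := Ω.toMultilinearMap.map_update_add ![v, w] 1 w w'
      simp only [h1] at h
      exact h)
    (fun c v w => by
      have h := Ω.toMultilinearMap.map_update_smul ![v, w] 1 c w
      simp only [h1] at h
      exact h)

theorem twoFormBilin_apply (Ω : (Cn n) [⋀^Fin 2]→L[ℝ] ℝ) (v w : Cn n) :
    twoFormBilin Ω v w = Ω ![v, w] := rfl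

theorem twoFormBilin_compContinuousLinearMap (Ω : (Cn n) [⋀^Fin 2]→L[ℝ] ℝ)
    (T : Cn n →L[ℝ] Cn n) (v w : Cn n) :
    twoFormBilin (Ω.compContinuousLinearMap T) v w = twoFormBilin Ω (T v) (T w) := by
  rw [twoFormBilin_apply, twoFormBilin_apply]
  refine congrArg Ω ?_
  ext i : 1
  fin_cases i <;> rfl

theorem liouvilleAlt_compContinuousLinearMap (Ω : (Cn n) [⋀^Fin 2]→L[ℝ] ℝ)
    (T : Cn n →L[ℝ] Cn n) (v : Fin (2 * n) → Cn n) :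
    liouvilleAlt n (twoFormBilin (Ω.compContinuousLinearMap T)) v =
      liouvilleAlt n (twoFormBilin Ω) (fun j => T (v j)) := by
  simp only [liouvilleAlt_apply, twoFormBilin_compContinuousLinearMap]

theorem liouvilleAlt_apply_comp (B : Cn n →ₗ[ℝ] Cn n →ₗ[ℝ] ℝ) (T : Cn n →L[ℝ] Cn n)
    (v : Fin (2 * n) → Cn n) :
    liouvilleAlt n B (fun j => T (v j)) =
      LinearMap.det (T : Cn n →ₗ[ℝ] Cn n) * liouvilleAlt n B v :=
  (liouvilleAlt n B).apply_comp_eq_det_smul (realBasis n) (T : Cn n →ₗ[ℝ] Cn n) v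

/-- The divergence, with respect to the density `E`, of a vector field is invariant under a change
of coordinates `τ`. -/
theorem divergence_comp {τ : Cn n → Cn n} {e : Cn n} (hτ : ContDiffAt ℝ ∞ τ e)
    (hT : (fderiv ℝ τ e).IsInvertible) {E E' : Cn n → ℝ} {V V' : Cn n → Cn n}
    (hE : DifferentiableAt ℝ E (τ e)) (hE0 : E (τ e) ≠ 0)
    (hV : DifferentiableAt ℝ V (τ e)) (hV' : DifferentiableAt ℝ V' e)
    (hEE' : E' =ᶠ[nhds e] fun e => LinearMap.det (fderiv ℝ τ e : Cn n →ₗ[ℝ] Cn n) * E (τ e))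
    (hVV' : (fun e => V (τ e)) =ᶠ[nhds e] fun e => fderiv ℝ τ e (V' e)) :
    fderiv ℝ E' e (V' e) / E' e +
        LinearMap.trace ℝ (Cn n) (fderiv ℝ V' e : Cn n →ₗ[ℝ] Cn n) =
      fderiv ℝ E (τ e) (V (τ e)) / E (τ e) +
        LinearMap.trace ℝ (Cn n) (fderiv ℝ V (τ e) : Cn n →ₗ[ℝ] Cn n) := by
  have hτ1 := (hτ.differentiableAt (by simp)).hasFDerivAt
  have hτ2 := ((hτ.fderiv_right (m := 1) (by norm_cast)).differentiableAt one_ne_zero).hasFDerivAt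
  have hsymm : ∀ v w, fderiv ℝ (fderiv ℝ τ) e v w = fderiv ℝ (fderiv ℝ τ) e w v :=
    fun v w => (hτ.isSymmSndFDerivAt
      (by rw [minSmoothness_of_isRCLikeNormedField]; exact WithTop.coe_le_coe.2 le_top)) v w
  obtain ⟨T, hT⟩ := hT
  obtain ⟨δ, hδ, hδ'⟩ := hasFDerivAt_det hτ2 T hT
  set d := LinearMap.det (fderiv ℝ τ e : Cn n →ₗ[ℝ] Cn n) with hd
  have hd0 : d ≠ 0 := by
    rw [hd, ← hT]
    exact (LinearEquiv.isUnit_det' T.toLinearEquiv).ne_zero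
  -- The trace of T⁻¹S occurs twice: in the derivative of the Jacobian by Jacobi's formula, and with
  -- the opposite sign in the trace of DV'.
  set S := fderiv ℝ (fderiv ℝ τ) e (V' e) with hS
  have h1 : HasFDerivAt E' (d • (fderiv ℝ E (τ e)).comp (fderiv ℝ τ e) + E (τ e) • δ) e :=
    (hδ.mul (hE.hasFDerivAt.comp e hτ1)).congr_of_eventuallyEq hEE'
  have h2 : fderiv ℝ τ e (V' e) = V (τ e) := hVV'.self_of_nhds.symm
  have h3 := hV.hasFDerivAt.comp e hτ1
  have h4 := (hτ2.clm_apply hV'.hasFDerivAt).congr_of_eventuallyEq hVV'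
  have h5 := h3.unique h4
  -- Obtained by differentiating Dτ(V') = V ∘ τ and using the symmetry of D²τ.
  have h6 : fderiv ℝ V' e = (T.symm : Cn n →L[ℝ] Cn n).comp
      ((fderiv ℝ V (τ e)).comp (T : Cn n →L[ℝ] Cn n)) - (T.symm : Cn n →L[ℝ] Cn n).comp S := by
    ext1 w
    have h7 := congrArg (fun D : Cn n →L[ℝ] Cn n => D w) h5
    simp only [ContinuousLinearMap.comp_apply, add_apply, ContinuousLinearMap.flip_apply] at h7
    rw [hsymm w, ← hS, ← hT] at h7
    simp only [sub_apply, ContinuousLinearMap.comp_apply]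
    rw [h7, map_add]
    simp
  have h8 : LinearMap.trace ℝ (Cn n) (fderiv ℝ V' e : Cn n →ₗ[ℝ] Cn n) =
      LinearMap.trace ℝ (Cn n) (fderiv ℝ V (τ e) : Cn n →ₗ[ℝ] Cn n) -
        LinearMap.trace ℝ (Cn n)
          (((T.symm : Cn n →L[ℝ] Cn n).comp S : Cn n →L[ℝ] Cn n) : Cn n →ₗ[ℝ] Cn n) := by
    rw [h6]
    have h9 := LinearMap.trace_conj' (fderiv ℝ V (τ e) : Cn n →ₗ[ℝ] Cn n) T.symm.toLinearEquiv
    rw [← h9, ← map_sub]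
    rfl
  have h10 : E' e = d * E (τ e) := hEE'.self_of_nhds
  have h11 : fderiv ℝ E' e (V' e) = d * fderiv ℝ E (τ e) (V (τ e)) + E (τ e) * δ (V' e) := by
    rw [h1.fderiv, ← h2]
    rfl
  rw [h11, h10, h8, hδ']
  field_simp
  ring

end LiouvilleInChart

/-! ### The divergence with respect to the Liouville form, in an arbitrary chart. -/

namespace KahlerStructure

variable {n : ℕ} {M : Type*} [TopologicalSpace M] [ChartedSpace (Cn n) M] (W : KahlerStructure n M)

theorem liouville_eq (x : M) (v : Fin (2 * n) → Cn n) :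
    W.liouville x v = liouvilleAlt n (twoFormBilin (W.form x)) v := by
  rw [liouvilleAlt_apply]
  rfl

theorem liouville_realFrame_ne_zero (x : M) : W.liouville x (realFrame n) ≠ 0 := by
  rw [liouville_eq]
  exact liouvilleAlt_realFrame_ne_zero _ (W.form_swap x) (W.compat x) (W.pos x)

/-- The density of the Liouville volume form in the preferred chart at `x`. -/
def liouvilleInChart (x : M) (e : Cn n) : ℝ :=
  W.liouville ((extChartAt 𝓘(ℝ, Cn n) x).symm e) (fun j => chartDeriv x e (realFrame n j))

theorem liouvilleInChart_eq (x : M) (e : Cn n) :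
    W.liouvilleInChart x e =
      liouvilleAlt n (twoFormBilin (DiffForm.inChart W.form x e)) (realFrame n) := by
  rw [liouvilleInChart, liouville_eq, DiffForm.inChart, liouvilleAlt_compContinuousLinearMap]

theorem liouvilleInChart_eq_det_mul (x : M) (e : Cn n) :
    W.liouvilleInChart x e = LinearMap.det (chartDeriv x e : Cn n →ₗ[ℝ] Cn n) *
      W.liouville ((extChartAt 𝓘(ℝ, Cn n) x).symm e) (realFrame n) := by
  rw [liouvilleInChart, liouville_eq, liouville_eq, liouvilleAlt_apply_comp]

theorem contDiffAt_liouvilleInChart (x : M) {e : Cn n}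
    (he : e ∈ (extChartAt 𝓘(ℝ, Cn n) x).target) : ContDiffAt ℝ ∞ (W.liouvilleInChart x) e := by
  have h1 : ContDiffAt ℝ ∞ (DiffForm.inChart W.form x) e := by
    refine (W.smooth x).contDiffAt ?_
    rw [Set.preimage_univ, Set.inter_univ]
    exact (isOpen_extChartAt_target (I := 𝓘(ℝ, Cn n)) x).mem_nhds he
  have h2 : ∀ v : Fin 2 → Cn n, ContDiffAt ℝ ∞ (fun e => DiffForm.inChart W.form x e v) e :=
    fun v => (ContinuousAlternatingMap.apply ℝ (Cn n) ℝ v).contDiff.contDiffAt.comp e h1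
  rw [show W.liouvilleInChart x = _ from funext (W.liouvilleInChart_eq x)]
  simp only [liouvilleAlt_apply, twoFormBilin_apply]
  refine contDiffAt_const.mul (ContDiffAt.sum fun σ _ => contDiffAt_const.mul ?_)
  exact contDiffAt_prod fun i _ => h2 _

/-- The divergence of a vector field in the preferred chart at `x`. -/
def divInChart (V : M → Cn n) (x : M) (e : Cn n) : ℝ :=
  fderiv ℝ (W.liouvilleInChart x) e (fieldInChart V x e) / W.liouvilleInChart x e +
    LinearMap.trace ℝ (Cn n) (fderiv ℝ (fieldInChart V x) e : Cn n →ₗ[ℝ] Cn n)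

variable [IsManifold 𝓘(ℂ, Cn n) ω M]

theorem liouvilleInChart_ne_zero (x : M) {e : Cn n}
    (he : e ∈ (extChartAt 𝓘(ℝ, Cn n) x).target) : W.liouvilleInChart x e ≠ 0 := by
  rw [liouvilleInChart_eq_det_mul]
  refine mul_ne_zero ?_ (W.liouville_realFrame_ne_zero _)
  obtain ⟨T, hT⟩ := chartDeriv_isInvertible x he
  rw [← hT]
  exact (LinearEquiv.isUnit_det' T.toLinearEquiv).ne_zero

theorem liouvilleInChart_self (x : M) :
    W.liouvilleInChart x (extChartAt 𝓘(ℝ, Cn n) x x) = W.liouville x (realFrame n) := by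
  rw [liouvilleInChart, chartDeriv_self, extChartAt_to_inv]
  rfl

theorem fieldInChart_self (V : M → Cn n) (x : M) :
    fieldInChart V x (extChartAt 𝓘(ℝ, Cn n) x x) = V x := by
  rw [fieldInChart, chartDeriv_self, extChartAt_to_inv, ContinuousLinearMap.inverse_id]
  rfl

/-- The sum over slots in the Lie derivative of a top-degree form is the trace of DV times the form.
-/
theorem liouvilleRate_eq_divInChart (V : M → Cn n) (x : M) :
    W.liouvilleRate V x = W.divInChart V x (extChartAt 𝓘(ℝ, Cn n) x x) := by
  rw [divInChart, liouvilleInChart_self, fieldInChart_self, liouvilleRate, lieDeriv, add_div]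
  congr 1
  rw [div_eq_iff (W.liouville_realFrame_ne_zero x)]
  simp only [liouville_eq, ← coe_realBasis]
  exact (liouvilleAlt n (twoFormBilin (W.form x))).sum_update_basis_eq_trace (realBasis n)
    (fderiv ℝ (fieldInChart V x) (extChartAt 𝓘(ℝ, Cn n) x x) : Cn n →ₗ[ℝ] Cn n)

/-- The divergence does not depend on the chart. -/
theorem liouvilleRate_eq_divInChart_of_mem_source (V : M → Cn n)
    (hV : ∀ (x : M), ∀ e ∈ (extChartAt 𝓘(ℝ, Cn n) x).target,
      DifferentiableAt ℝ (fieldInChart V x) e) (x : M) {y : M}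
    (hy : y ∈ (extChartAt 𝓘(ℝ, Cn n) x).source) :
    W.liouvilleRate V y = W.divInChart V x (extChartAt 𝓘(ℝ, Cn n) x y) := by
  rw [liouvilleRate_eq_divInChart]
  set φ := extChartAt 𝓘(ℝ, Cn n) x
  set ψ := extChartAt 𝓘(ℝ, Cn n) y with hψ
  have he : ψ y ∈ ψ.target := mem_extChartAt_target (I := 𝓘(ℝ, Cn n)) y
  have hy' : ψ.symm (ψ y) = y := extChartAt_to_inv (I := 𝓘(ℝ, Cn n)) y
  have hx : ψ.symm (ψ y) ∈ φ.source := by rwa [hy']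
  have hev := extChartAt_symm_eventuallyEq x y he hx
  set τ := φ ∘ ψ.symm with hτ
  have hτe : τ (ψ y) = φ y := by rw [hτ, Function.comp_apply, hy']
  have hφy : φ y ∈ φ.target := φ.map_source hy
  have hsymm : ∀ e, ψ.symm e ∈ φ.source → φ.symm (τ e) = ψ.symm e := fun e h => φ.left_inv h
  have htrans : ∀ e ∈ ψ.target, ψ.symm e ∈ φ.source →
      chartDeriv y e = (chartDeriv x (τ e)).comp (fderiv ℝ τ e) :=
    fun e h1 h2 => chartDeriv_transition x y h1 h2
  have hinv : ∀ e ∈ ψ.target, ψ.symm e ∈ φ.source → (fderiv ℝ τ e).IsInvertible := by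
    intro e h1 h2
    obtain ⟨T, hT⟩ := chartDeriv_isInvertible x (φ.map_source h2)
    obtain ⟨R, hR⟩ := chartDeriv_isInvertible y h1
    refine ⟨R.trans T.symm, ?_⟩
    have h3 := htrans e h1 h2
    ext1 w
    have h4 := congrArg (fun D : Cn n →L[ℝ] Cn n => T.symm (D w)) h3
    rw [← hR] at h4
    refine h4.trans ?_
    change T.symm (chartDeriv x (φ (ψ.symm e)) _) = _
    rw [← hT]
    exact T.symm_apply_apply _
  have hτsm : ContDiffAt ℝ ∞ τ (ψ y) := contDiffAt_transition y x he hx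
  refine (divergence_comp (τ := τ) (e := ψ y) hτsm (hinv _ he hx)
    (E := W.liouvilleInChart x) (V := fieldInChart V x) ?_ ?_ ?_ (hV y _ he) ?_ ?_).trans ?_
  · rw [hτe]
    exact (W.contDiffAt_liouvilleInChart x hφy).differentiableAt (by simp)
  · rw [hτe]
    exact W.liouvilleInChart_ne_zero x hφy
  · rw [hτe]
    exact hV x _ hφy
  · filter_upwards [hev] with e h
    rw [liouvilleInChart_eq_det_mul, liouvilleInChart_eq_det_mul, htrans e h.1 h.2,
      hsymm e h.2]
    have h3 : LinearMap.det
        ((chartDeriv x (τ e)).comp (fderiv ℝ τ e) : Cn n →ₗ[ℝ] Cn n) =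
        LinearMap.det (chartDeriv x (τ e) : Cn n →ₗ[ℝ] Cn n) *
          LinearMap.det (fderiv ℝ τ e : Cn n →ₗ[ℝ] Cn n) := LinearMap.det_comp _ _
    rw [h3]
    ring
  · filter_upwards [hev] with e h
    obtain ⟨T, hT⟩ := chartDeriv_isInvertible x (φ.map_source h.2)
    obtain ⟨R, hR⟩ := hinv e h.1 h.2
    have h3 := htrans e h.1 h.2
    have hT' : chartDeriv x (τ e) = T := hT.symm
    rw [fieldInChart, fieldInChart, h3, hT', hsymm e h.2, ← hR]
    rw [show ((T : Cn n →L[ℝ] Cn n).comp (R : Cn n →L[ℝ] Cn n)) =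
      ((R.trans T : Cn n ≃L[ℝ] Cn n) : Cn n →L[ℝ] Cn n) from rfl,
      ContinuousLinearMap.inverse_equiv, ContinuousLinearMap.inverse_equiv]
    simp only [ContinuousLinearEquiv.coe_coe, ContinuousLinearEquiv.symm_trans_apply,
      ContinuousLinearEquiv.apply_symm_apply]
    rfl
  · rw [divInChart, hτe]

end KahlerStructure

/-! ### Logarithmic derivatives of squared norms. -/

section LogDerivative

theorem HasDerivAt.norm_sq_of_eq_mul {f : ℝ → ℂ} {σ : ℂ} {t : ℝ} (hf : HasDerivAt f (σ * f t) t) :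
    HasDerivAt (fun t => ‖f t‖ ^ 2) (2 * σ.re * ‖f t‖ ^ 2) t := by
  refine hf.norm_sq.congr_deriv ?_
  rw [← Complex.normSq_eq_norm_sq, Complex.normSq_apply, Complex.inner, Complex.mul_re]
  simp only [Complex.mul_re, Complex.mul_im, Complex.conj_re, Complex.conj_im]
  ring

/-- The rate is half of 2 Re σ - ε. Taking |E| makes the sign of `E` irrelevant. -/
theorem HasDerivAt.sqrt_norm_sq_div_abs {s : ℝ → ℂ} {E : ℝ → ℝ} {σ : ℂ} {ε : ℝ} {t : ℝ}
    (hs : HasDerivAt s (σ * s t) t) (hE : HasDerivAt E (ε * E t) t) (hs0 : s t ≠ 0)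
    (hE0 : E t ≠ 0) :
    HasDerivAt (fun t => √(‖s t‖ ^ 2 / |E t|)) ((σ.re - ε / 2) * √(‖s t‖ ^ 2 / |E t|)) t := by
  have h1 : HasDerivAt (fun t => |E t|) (ε * |E t|) t := by
    rcases lt_or_gt_of_ne hE0 with h | h
    · have h2 := (hasDerivAt_abs_neg h).comp t hE
      refine h2.congr_deriv ?_
      rw [abs_of_neg h]; ring
    · have h2 := (hasDerivAt_abs_pos h).comp t hE
      refine h2.congr_deriv ?_
      rw [abs_of_pos h]; ring
  have h2 : 0 < |E t| := abs_pos.2 hE0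
  have h3 : 0 < ‖s t‖ ^ 2 := by positivity
  have h4 := (hs.norm_sq_of_eq_mul.div h1 h2.ne').sqrt (div_pos h3 h2).ne'
  refine h4.congr_deriv ?_
  have h5 : 0 < √(‖s t‖ ^ 2 / |E t|) := Real.sqrt_pos.2 (div_pos h3 h2)
  have h6 : √(‖s t‖ ^ 2 / |E t|) * √(‖s t‖ ^ 2 / |E t|) = ‖s t‖ ^ 2 / |E t| :=
    Real.mul_self_sqrt (div_pos h3 h2).le
  simp only [Pi.div_apply]
  rw [div_eq_iff (by positivity), show ∀ a b : ℝ, a * b * (2 * b) = 2 * a * (b * b) by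
    intros; ring, h6]
  field_simp

/-- The solution of a linear homogeneous differential equation. -/
theorem eq_mul_exp_neg_integral {N g : ℝ → ℝ} (hg : Continuous g)
    (hN : ∀ t, HasDerivAt N (-g t * N t) t) :
    N 1 = N 0 * Real.exp (-∫ t in (0 : ℝ)..1, g t) := by
  set Γ : ℝ → ℝ := fun s => ∫ t in (0 : ℝ)..s, g t with hΓ
  have hΓ' : ∀ s, HasDerivAt Γ (g s) s := fun s => hg.integral_hasStrictDerivAt 0 s |>.hasDerivAt
  -- Integrating factor: the product is constant.
  have h1 : ∀ s, HasDerivAt (fun s => N s * Real.exp (Γ s)) 0 s := fun s =>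
    ((hN s).mul (hΓ' s).exp).congr_deriv (by ring)
  have h2 := is_const_of_deriv_eq_zero (fun s => (h1 s).differentiableAt)
    (fun s => (h1 s).deriv) 1 0
  simp only [hΓ, intervalIntegral.integral_same, Real.exp_zero, mul_one] at h2
  rw [← h2, mul_assoc, ← Real.exp_add, add_neg_cancel, Real.exp_zero, mul_one]

end LogDerivative

/-! ### Complex traces and determinants of real maps commuting with `√-1`. -/

section ComplexLinear

variable {n : ℕ}

/-- A real linear map that commutes with `√-1`, as a complex linear map. -/
def complexLinear (A : Cn n →L[ℝ] Cn n) (hA : ∀ v, A (Complex.I • v) = Complex.I • A v) :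
    Cn n →ₗ[ℂ] Cn n where
  toFun := A
  map_add' := map_add A
  map_smul' c v := by
    have h : ∀ w : Cn n, c • w = c.re • w + c.im • (Complex.I • w) := fun w => by
      conv_lhs => rw [← Complex.re_add_im c]
      rw [add_smul, mul_smul]
      rfl
    rw [h v, map_add, map_smul, map_smul, hA, ← h, RingHom.id_apply]

theorem restrictScalars_complexLinear (A : Cn n →L[ℝ] Cn n)
    (hA : ∀ v, A (Complex.I • v) = Complex.I • A v) :
    (complexLinear A hA).restrictScalars ℝ = (A : Cn n →ₗ[ℝ] Cn n) := rfl

theorem sum_update_complexFrame (α : (Cn n) [⋀^Fin n]→L[ℝ] ℂ)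
    (h : ∀ (v : Fin n → Cn n) (j : Fin n), α (Function.update v j (cJ (v j))) = Complex.I * α v)
    (A : Cn n →L[ℝ] Cn n) (hA : ∀ v, A (Complex.I • v) = Complex.I • A v) :
    ∑ j, α (Function.update (complexFrame n) j (A (complexFrame n j))) =
      LinearMap.trace ℂ (Cn n) (complexLinear A hA) * α (complexFrame n) := by
  have := (complexAlternating α h).sum_update_basis_eq_trace (complexBasis n) (complexLinear A hA)
  rw [coe_complexBasis] at this
  exact this

theorem apply_complexFrame_comp (α : (Cn n) [⋀^Fin n]→L[ℝ] ℂ)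
    (h : ∀ (v : Fin n → Cn n) (j : Fin n), α (Function.update v j (cJ (v j))) = Complex.I * α v)
    (A : Cn n →L[ℝ] Cn n) (hA : ∀ v, A (Complex.I • v) = Complex.I • A v) :
    α (fun j => A (complexFrame n j)) =
      LinearMap.det (complexLinear A hA) * α (complexFrame n) := by
  have := (complexAlternating α h).apply_comp_eq_det_smul (complexBasis n) (complexLinear A hA)
    (complexBasis n)
  rw [coe_complexBasis] at this
  exact this

end ComplexLinear

/-! ### The Hermitian norm of half-form frames. -/

namespace HalfFormBundle

variable {n : ℕ} {M : Type*} [TopologicalSpace M] [ChartedSpace (Cn n) M] {ι' : Type*}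
  (H : HalfFormBundle n M ι') (W : KahlerStructure n M)

theorem frameNormSq_eq (a : ι') (x : M) :
    H.frameNormSq W a x = √‖wedgeConst n‖ *
      √(‖H.sq a x (complexFrame n)‖ ^ 2 / |W.liouville x (realFrame n)|) := by
  rw [frameNormSq, wedgeConj_realFrame (H.holomorphic_sq a).1, ← Real.sqrt_mul (norm_nonneg _)]
  congr 1
  rw [norm_div, norm_mul, Complex.norm_real, Complex.norm_real, Real.norm_of_nonneg (by positivity),
    Real.norm_eq_abs]
  ring

theorem frameNormSq_change {a b : ι'} {x : M} (hx : x ∈ H.V a ∩ H.V b) :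
    H.frameNormSq W b x = ‖H.h a b x‖ ^ 2 * H.frameNormSq W a x := by
  rw [frameNormSq_eq, frameNormSq_eq, H.square a b x hx]
  have h : ‖(H.h a b x ^ 2 • H.sq a x) (complexFrame n)‖ ^ 2 / |W.liouville x (realFrame n)| =
      (‖H.h a b x‖ ^ 2) ^ 2 *
        (‖H.sq a x (complexFrame n)‖ ^ 2 / |W.liouville x (realFrame n)|) := by
    rw [ContinuousAlternatingMap.smul_apply, norm_smul, norm_pow]
    ring
  rw [h, Real.sqrt_mul (by positivity), Real.sqrt_sq (by positivity)]
  ring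

theorem sq_complexFrame_ne_zero {a : ι'} {x : M} (hx : x ∈ H.V a) :
    H.sq a x (complexFrame n) ≠ 0 := by
  intro h
  refine H.sq_ne_zero a x hx (ContinuousAlternatingMap.ext fun v => ?_)
  rw [apply_eq_mul_det _ ((H.holomorphic_sq a).1 x), h, zero_mul]
  rfl

/-- The coefficient of the square of the frame `e_a` in the preferred chart at `x`. -/
def sqInChart (a : ι') (x : M) (e : Cn n) : ℂ := DiffForm.inChart (H.sq a) x e (complexFrame n)

theorem differentiableAt_sqInChart {a : ι'} {x : M} (hx : x ∈ H.V a) :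
    DifferentiableAt ℂ (H.sqInChart a x) (extChartAt 𝓘(ℝ, Cn n) x x) := by
  refine ((H.holomorphic_sq a).2 x).differentiableAt ?_
  refine ((continuousOn_extChartAt_symm (I := 𝓘(ℝ, Cn n)) x).isOpen_inter_preimage
    (isOpen_extChartAt_target x) (H.isOpen_V a)).mem_nhds ⟨mem_extChartAt_target x, ?_⟩
  rwa [Set.mem_preimage, extChartAt_to_inv]

variable [IsManifold 𝓘(ℂ, Cn n) ω M]

theorem sqInChart_self (a : ι') (x : M) :
    H.sqInChart a x (extChartAt 𝓘(ℝ, Cn n) x x) = H.sq a x (complexFrame n) := by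
  rw [sqInChart, DiffForm.inChart, chartDeriv_self, extChartAt_to_inv]
  rfl

/-- The chart derivative multiplies the coefficient of e_a² by its complex determinant and the
Liouville density by its real one, which is |det_ℂ|²; the quotient under the root does not change.
-/
theorem frameNormSq_extChartAt_symm (a : ι') (x : M) {e : Cn n}
    (he : e ∈ (extChartAt 𝓘(ℝ, Cn n) x).target) :
    H.frameNormSq W a ((extChartAt 𝓘(ℝ, Cn n) x).symm e) =
      √‖wedgeConst n‖ * √(‖H.sqInChart a x e‖ ^ 2 / |W.liouvilleInChart x e|) := by
  have hI := chartDeriv_I_smul x he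
  have h1 : H.sqInChart a x e = LinearMap.det (complexLinear (chartDeriv x e) hI) *
      H.sq a ((extChartAt 𝓘(ℝ, Cn n) x).symm e) (complexFrame n) :=
    apply_complexFrame_comp _ ((H.holomorphic_sq a).1 _) _ hI
  have h2 := W.liouvilleInChart_eq_det_mul x e
  rw [← restrictScalars_complexLinear _ hI, det_restrictScalars_complex] at h2
  have h3 := W.liouvilleInChart_ne_zero x he
  rw [frameNormSq_eq, h1, h2, norm_mul, mul_pow, abs_mul, abs_of_nonneg (sq_nonneg ‖_‖),
    mul_div_mul_left]
  exact left_ne_zero_of_mul (h2 ▸ h3)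

end HalfFormBundle

/-! ### Norms of half-form frames along the flow. -/

namespace HamiltonianAction

variable {n : ℕ} {M : Type*} [TopologicalSpace M] [ChartedSpace (Cn n) M]
  {W : KahlerStructure n M} {𝔤 : Type*} [NormedAddCommGroup 𝔤] [NormedSpace ℝ 𝔤]
  {G : Type*} [TopologicalSpace G] [ChartedSpace 𝔤 G] [Group G]
  [MulAction G M] (A : HamiltonianAction W 𝔤 G) [IsManifold 𝓘(ℂ, Cn n) ω M]
  [LieGroup 𝓘(ℝ, 𝔤) ∞ G]

theorem contDiffAt_fieldInChart_JX (ξ : 𝔤) (x : M) {e : Cn n}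
    (he : e ∈ (extChartAt 𝓘(ℝ, Cn n) x).target) : ContDiffAt ℝ ∞ (fieldInChart (A.JX ξ) x) e :=
  ((A.contDiffAt_JXInChart x he).clm_apply (contDiffAt_const (c := ξ))).congr_of_eventuallyEq
    (A.fieldInChart_JX_eventuallyEq ξ x he)

/-- By definition the rate at `y` uses the preferred chart at `y`, which may jump with `y`; in the
fixed chart at `x` continuity is visible. It is needed to integrate the differential equation for
|r|². -/
theorem continuous_liouvilleRate_JX (ξ : 𝔤) : Continuous (W.liouvilleRate (A.JX ξ)) := by
  refine continuous_iff_continuousAt.2 fun x => ?_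
  have he := mem_extChartAt_target (I := 𝓘(ℝ, Cn n)) x
  have hV := A.contDiffAt_fieldInChart_JX ξ x he
  have hE := W.contDiffAt_liouvilleInChart x he
  have h1 : ContinuousAt (W.divInChart (A.JX ξ) x) (extChartAt 𝓘(ℝ, Cn n) x x) := by
    have h2 := ((hE.fderiv_right (m := ∞) (by norm_cast)).continuousAt.clm_apply
      hV.continuousAt).div hE.continuousAt (W.liouvilleInChart_ne_zero x he)
    have h3 : Continuous fun T : Cn n →L[ℝ] Cn n =>
        LinearMap.trace ℝ (Cn n) (T : Cn n →ₗ[ℝ] Cn n) :=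
      LinearMap.continuous_of_finiteDimensional
        ((LinearMap.trace ℝ (Cn n)).comp (ContinuousLinearMap.coeLM ℝ))
    exact h2.add (h3.continuousAt.comp (hV.fderiv_right (m := ∞) (by norm_cast)).continuousAt)
  refine (ContinuousAt.comp h1 (continuousAt_extChartAt x)).congr ?_
  filter_upwards [extChartAt_source_mem_nhds (I := 𝓘(ℝ, Cn n)) x] with y hy
  exact (W.liouvilleRate_eq_divInChart_of_mem_source (A.JX ξ) (fun x e he =>
    (A.contDiffAt_fieldInChart_JX ξ x he).differentiableAt (by simp)) x hy).symm

/-- The derivative at the base point of the coordinate expression of `X^ξ`. -/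
theorem fderiv_fieldInChart_X (ξ : 𝔤) (x : M) {e : Cn n}
    (he : e ∈ (extChartAt 𝓘(ℝ, Cn n) x).target) :
    (∀ v, fderiv ℝ (fieldInChart (A.X ξ) x) e (Complex.I • v) =
      Complex.I • fderiv ℝ (fieldInChart (A.X ξ) x) e v) ∧
    ∀ v, fderiv ℝ (fieldInChart (A.JX ξ) x) e v =
      Complex.I • fderiv ℝ (fieldInChart (A.X ξ) x) e v := by
  have h1 : fieldInChart (A.X ξ) x =ᶠ[nhds e] fun e' => fundInChart 𝔤 G x e' ξ := by
    filter_upwards [(isOpen_extChartAt_target (I := 𝓘(ℝ, Cn n)) x).mem_nhds he] with e' he'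
      using fieldInChart_fundField x A.smooth_smul he' ξ
  have h2 : DifferentiableAt ℝ (fun e' => fundInChart 𝔤 G x e' ξ) e :=
    ((contDiffAt_fundInChart x A.smooth_smul he).clm_apply
      (contDiffAt_const (c := ξ))).differentiableAt (by simp)
  refine ⟨fun v => ?_, fun v => ?_⟩
  · rw [h1.fderiv_eq]
    exact fderiv_fundInChart_I_smul x A.smooth_smul A.holomorphic_smul he ξ v
  · rw [(A.fieldInChart_JX_eventuallyEq ξ x he).fderiv_eq, h1.fderiv_eq]
    have h3 := h2.hasFDerivAt.const_smul Complex.I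
    exact congrArg (fun D : Cn n →L[ℝ] Cn n => D v) h3.fderiv

/-- The traces of the derivatives at the base point of the coordinate expressions of `X^ξ` and
`J X^ξ`, by which `L_{X^ξ}` on half-forms and the divergence of `J X^ξ` are expressed. -/
theorem exists_trace (ξ : 𝔤) {ι' : Type*} (H : HalfFormBundle n M ι') {a : ι'} {x : M}
    (hx : x ∈ H.V a) :
    ∃ z : ℂ, fderiv ℝ (H.sqInChart a x) (extChartAt 𝓘(ℝ, Cn n) x x) (A.JX ξ x) =
        Complex.I * (2 * H.lieCoeff (A.X ξ) a x - z) *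
          H.sqInChart a x (extChartAt 𝓘(ℝ, Cn n) x x) ∧
      fderiv ℝ (W.liouvilleInChart x) (extChartAt 𝓘(ℝ, Cn n) x x) (A.JX ξ x) =
        (W.liouvilleRate (A.JX ξ) x + 2 * z.im) *
          W.liouvilleInChart x (extChartAt 𝓘(ℝ, Cn n) x x) := by
  have he := mem_extChartAt_target (I := 𝓘(ℝ, Cn n)) x
  obtain ⟨hI, hJ⟩ := A.fderiv_fieldInChart_X ξ x he
  set D := fderiv ℝ (fieldInChart (A.X ξ) x) (extChartAt 𝓘(ℝ, Cn n) x x) with hD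
  refine ⟨LinearMap.trace ℂ (Cn n) (complexLinear D hI), ?_, ?_⟩
  · have h1 := (H.differentiableAt_sqInChart hx).hasFDerivAt
    -- The coefficient is a holomorphic function, so J passes through its derivative as `√-1`.
    have h2 : fderiv ℝ (H.sqInChart a x) (extChartAt 𝓘(ℝ, Cn n) x x) (A.JX ξ x) =
        Complex.I * fderiv ℝ (H.sqInChart a x) (extChartAt 𝓘(ℝ, Cn n) x x) (A.X ξ x) := by
      rw [(h1.restrictScalars ℝ).fderiv]
      exact map_smul (fderiv ℂ (H.sqInChart a x) (extChartAt 𝓘(ℝ, Cn n) x x)) Complex.I (A.X ξ x)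
    have h3 : H.lieCoeff (A.X ξ) a x =
        (fderiv ℝ (H.sqInChart a x) (extChartAt 𝓘(ℝ, Cn n) x x) (A.X ξ x) +
          LinearMap.trace ℂ (Cn n) (complexLinear D hI) * H.sq a x (complexFrame n)) /
          (2 * H.sq a x (complexFrame n)) := by
      rw [← sum_update_complexFrame _ ((H.holomorphic_sq a).1 x)]
      rfl
    have h4 := H.sq_complexFrame_ne_zero hx
    rw [h2, h3, H.sqInChart_self]
    field_simp
    ring
  -- The coordinate derivative of J X^ξ is `√-1` times that of X^ξ, so its real trace is 2 Re(√-1 z)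
  -- = -2 Im z.
  · have h1 : (fderiv ℝ (fieldInChart (A.JX ξ) x) (extChartAt 𝓘(ℝ, Cn n) x x) :
        Cn n →ₗ[ℝ] Cn n) = (Complex.I • complexLinear D hI).restrictScalars ℝ :=
      LinearMap.ext hJ
    rw [W.liouvilleRate_eq_divInChart, KahlerStructure.divInChart, KahlerStructure.fieldInChart_self,
      h1, trace_restrictScalars_complex, map_smul, smul_eq_mul, Complex.I_mul_re]
    have h2 := W.liouvilleInChart_ne_zero x he
    field_simp
    ring

variable [FiniteDimensional ℝ 𝔤] [T2Space M] [CompactSpace M]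

/-- With c = `lieCoeff` and z the trace from `exists_trace`, the form coefficient contributes Re(√-1
(2c - z)) = -2 Im c + Im z, and the density contributes minus half of (rate + 2 Im z); z drops out.
-/
theorem hasDerivAt_frameNormSq_expI (ξ : 𝔤) (x : M) (t : ℝ) {ι' : Type*}
    (H : HalfFormBundle n M ι') {a : ι'} (ha : A.expI (t • ξ) x ∈ H.V a) :
    HasDerivAt (fun t : ℝ => H.frameNormSq W a (A.expI (t • ξ) x))
      ((-2 * (H.lieCoeff (A.X ξ) a (A.expI (t • ξ) x)).im -
          W.liouvilleRate (A.JX ξ) (A.expI (t • ξ) x) / 2) *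
        H.frameNormSq W a (A.expI (t • ξ) x)) t := by
  have := isManifold_real_of_complex (n := n) (M := M)
  have : IsManifold 𝓘(ℝ, Cn n) 1 M := .of_le (n := ∞) (by norm_cast)
  obtain ⟨y, hy⟩ : ∃ y, y = A.expI (t • ξ) x := ⟨_, rfl⟩
  rw [← hy] at ha
  have he := mem_extChartAt_target (I := 𝓘(ℝ, Cn n)) y
  have hys := mem_extChartAt_source (I := 𝓘(ℝ, Cn n)) y
  obtain ⟨z, hz1, hz2⟩ := A.exists_trace ξ H ha
  set η : ℝ → Cn n := fun t => extChartAt 𝓘(ℝ, Cn n) y (A.expI (t • ξ) x) with hη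
  have hηt : η t = extChartAt 𝓘(ℝ, Cn n) y y := by simp only [hη, ← hy]
  have h1 : HasDerivAt η (A.JX ξ y) t := by
    have h2 : MDifferentiableAt 𝓘(ℝ, Cn n) 𝓘(ℝ, Cn n) (extChartAt 𝓘(ℝ, Cn n) y)
        (A.expI (t • ξ) x) := by
      rw [← hy]
      exact (contMDiffAt_extChartAt (n := 1)).mdifferentiableAt one_ne_zero
    refine (A.hasDerivAt_comp_expI ξ x t h2).congr_deriv ?_
    rw [← hy]
    refine (fieldInChart_extChartAt (A.JX ξ) y hys).symm.trans ?_
    exact KahlerStructure.fieldInChart_self _ _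
  have hS : HasDerivAt (fun t => H.sqInChart a y (η t))
      (Complex.I * (2 * H.lieCoeff (A.X ξ) a y - z) * H.sqInChart a y (η t)) t := by
    have h2 := ((H.differentiableAt_sqInChart ha).restrictScalars ℝ).hasFDerivAt
    rw [← hηt] at h2 hz1
    exact (h2.comp_hasDerivAt t h1).congr_deriv hz1
  have hE : HasDerivAt (fun t => W.liouvilleInChart y (η t))
      ((W.liouvilleRate (A.JX ξ) y + 2 * z.im) * W.liouvilleInChart y (η t)) t := by
    have h2 := ((W.contDiffAt_liouvilleInChart y he).differentiableAt (by simp)).hasFDerivAt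
    rw [← hηt] at h2 hz2
    exact (h2.comp_hasDerivAt t h1).congr_deriv hz2
  have h3 := (hS.sqrt_norm_sq_div_abs hE
    (by rw [hηt, H.sqInChart_self]; exact H.sq_complexFrame_ne_zero ha)
    (by rw [hηt]; exact W.liouvilleInChart_ne_zero y he)).const_mul (√‖wedgeConst n‖)
  have hev : ∀ᶠ t' in nhds t, A.expI (t' • ξ) x ∈ (extChartAt 𝓘(ℝ, Cn n) y).source := by
    refine (A.continuous_expI ξ x).continuousAt.eventually_mem ?_
    rw [← hy]
    exact extChartAt_source_mem_nhds y
  have h4 : ∀ t', A.expI (t' • ξ) x ∈ (extChartAt 𝓘(ℝ, Cn n) y).source →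
      H.frameNormSq W a (A.expI (t' • ξ) x) =
        √‖wedgeConst n‖ * √(‖H.sqInChart a y (η t')‖ ^ 2 / |W.liouvilleInChart y (η t')|) := by
    intro t' ht'
    have h5 := H.frameNormSq_extChartAt_symm W a y ((extChartAt 𝓘(ℝ, Cn n) y).map_source ht')
    rwa [(extChartAt 𝓘(ℝ, Cn n) y).left_inv ht'] at h5
  refine (h3.congr_of_eventuallyEq (hev.mono fun t' ht' => h4 t' ht')).congr_deriv ?_
  rw [h4 t hev.self_of_nhds, ← hy]
  simp only [Complex.mul_re, Complex.mul_im, Complex.sub_re, Complex.sub_im, Complex.I_re,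
    Complex.I_im, Complex.re_ofNat, Complex.im_ofNat]
  ring

end HamiltonianAction

/-! ### Sections of the prequantum line bundle along the flow. -/

namespace PrequantumBundle

variable {n : ℕ} {M : Type*} [TopologicalSpace M] [ChartedSpace (Cn n) M]
  {W : KahlerStructure n M} {ι : Type*} (L : PrequantumBundle W ι)

/-- For a function annihilated in the `(0,1)`-directions, `∇_X f = b f` determines
`df(JX)`. -/
theorem exists_dFun_cJ_eq {k : ℕ} {i : ι} {f : M → ℂ} {x : M} {v : Cn n} {b : ℂ}
    (hhol : L.nabla k i f x v + Complex.I * L.nabla k i f x (cJ v) = 0)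
    (hb : L.nabla k i f x v = b * f x) :
    ∃ σ : ℂ, dFun f x (cJ v) = σ * f x ∧ σ.re = -b.im := by
  -- The first term is ∇_{Jv} = √-1 ∇_v; the second is the connection form, purely imaginary because
  -- the connection is unitary, so it does not affect the real part.
  refine ⟨Complex.I * b + Complex.I * (k : ℂ) * ((L.θ i x ![cJ v] : ℝ) : ℂ), ?_, by simp⟩
  have h1 : L.nabla k i f x (cJ v) = Complex.I * (b * f x) := by
    rw [← hb]
    linear_combination -Complex.I * hhol + L.nabla k i f x (cJ v) * Complex.I_mul_I
  rw [nabla, sub_eq_iff_eq_add] at h1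
  rw [h1]
  ring

namespace Sections

variable {L} {k : ℕ} (s : L.Sections k)

theorem normSq_eq {i : ι} {x : M} (hx : x ∈ L.U i) : s.normSq x = ‖s.coeff i x‖ ^ 2 := by
  rw [normSq, s.compat i _ x ⟨hx, L.mem_indexAt x⟩, norm_mul, norm_pow,
    L.unitary _ _ x ⟨hx, L.mem_indexAt x⟩, one_pow, one_mul]

variable {𝔤 : Type*} [NormedAddCommGroup 𝔤] [NormedSpace ℝ 𝔤]
  {G : Type*} [TopologicalSpace G] [ChartedSpace 𝔤 G] [Group G] [MulAction G M]
  [IsManifold 𝓘(ℂ, Cn n) ω M] [LieGroup 𝓘(ℝ, 𝔤) ∞ G] [FiniteDimensional ℝ 𝔤]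
  [T2Space M] [CompactSpace M] (A : HamiltonianAction W 𝔤 G)

/-- In a fixed unitary frame around the point, invariance gives b = √-1 kφ_ξ in `exists_dFun_cJ_eq`,
hence Re σ = -kφ_ξ. -/
theorem hasDerivAt_normSq_expI (hs : s.IsHolomorphic) (hA : s.IsInvariant A) (ξ : 𝔤) (x : M)
    (t : ℝ) :
    HasDerivAt (fun t : ℝ => s.normSq (A.expI (t • ξ) x))
      (-(2 * (k : ℝ) * A.moment (A.expI (t • ξ) x) ξ) * s.normSq (A.expI (t • ξ) x)) t := by
  obtain ⟨y, hy⟩ : ∃ y, y = A.expI (t • ξ) x := ⟨_, rfl⟩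
  have hi := L.mem_indexAt y
  set i := L.indexAt y
  obtain ⟨σ, h1, h2⟩ := L.exists_dFun_cJ_eq (hs i y hi (A.X ξ y))
    (sub_eq_zero.1 (hA ξ i y hi))
  have h3 : MDifferentiableAt 𝓘(ℝ, Cn n) 𝓘(ℝ, ℂ) (s.coeff i) (A.expI (t • ξ) x) := by
    rw [← hy]
    exact ((s.smooth i).contMDiffAt ((L.isOpen_U i).mem_nhds hi)).mdifferentiableAt (by simp)
  have h4 := A.hasDerivAt_comp_expI ξ x t h3
  have h5 : HasDerivAt (fun t : ℝ => s.coeff i (A.expI (t • ξ) x))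
      (σ * s.coeff i (A.expI (t • ξ) x)) t := by
    refine h4.congr_deriv ?_
    rw [← hy]
    exact h1
  have hev : ∀ᶠ t' in nhds t, A.expI (t' • ξ) x ∈ L.U i :=
    (A.continuous_expI ξ x).continuousAt.eventually_mem
      (by rw [← hy]; exact (L.isOpen_U i).mem_nhds hi)
  refine (h5.norm_sq_of_eq_mul.congr_of_eventuallyEq
    (hev.mono fun t' ht' => s.normSq_eq ht')).congr_deriv ?_
  rw [s.normSq_eq hev.self_of_nhds, h2, ← hy]
  simp only [Complex.mul_im, Complex.mul_re, Complex.I_re, Complex.I_im,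
    Complex.natCast_re, Complex.natCast_im, Complex.ofReal_re, Complex.ofReal_im]
  ring

/-- The pointwise norm of an invariant holomorphic section along `t ↦ e^{itξ} · x`. -/
theorem normSq_expI (hs : s.IsHolomorphic) (hA : s.IsInvariant A) (ξ : 𝔤) (x : M) :
    s.normSq (A.expI ξ x) = s.normSq x *
      Real.exp (-∫ t in (0 : ℝ)..1, 2 * (k : ℝ) * A.moment (A.expI (t • ξ) x) ξ) := by
  have h := eq_mul_exp_neg_integral (continuous_const.mul (A.continuous_moment_expI ξ x))
    (s.hasDerivAt_normSq_expI A hs hA ξ x)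
  rwa [one_smul, zero_smul, A.expI_zero] at h

end Sections

end PrequantumBundle

/-! ### Half-form valued sections along the flow. -/

namespace HalfFormBundle.Sections

variable {n : ℕ} {M : Type*} [TopologicalSpace M] [ChartedSpace (Cn n) M]
  {W : KahlerStructure n M} {ι ι' : Type*} {L : PrequantumBundle W ι}
  {H : HalfFormBundle n M ι'} {k : ℕ} (r : H.Sections L k)

theorem normSq_eq {i : ι} {a : ι'} {x : M} (hi : x ∈ L.U i) (ha : x ∈ H.V a) :
    r.normSq x = ‖r.coeff i a x‖ ^ 2 * H.frameNormSq W a x := by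
  rw [normSq, r.compat i (L.indexAt x) a (H.indexAt x) x
    ⟨⟨hi, L.mem_indexAt x⟩, ⟨ha, H.mem_indexAt x⟩⟩,
    H.frameNormSq_change W ⟨ha, H.mem_indexAt x⟩, norm_mul, norm_mul, norm_pow,
    L.unitary _ _ x ⟨hi, L.mem_indexAt x⟩]
  ring

variable {𝔤 : Type*} [NormedAddCommGroup 𝔤] [NormedSpace ℝ 𝔤]
  {G : Type*} [TopologicalSpace G] [ChartedSpace 𝔤 G] [Group G] [MulAction G M]
  [IsManifold 𝓘(ℂ, Cn n) ω M] [LieGroup 𝓘(ℝ, 𝔤) ∞ G] [FiniteDimensional ℝ 𝔤]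
  [T2Space M] [CompactSpace M] (A : HamiltonianAction W 𝔤 G)

/-- Invariance now gives b = √-1 kφ_ξ - c with c = `lieCoeff`. The resulting 2 Im c in the rate of
the coefficient is cancelled by the -2 Im c in that of the frame. -/
theorem hasDerivAt_normSq_expI (hr : r.IsHolomorphic) (hA : r.IsInvariant A) (ξ : 𝔤) (x : M)
    (t : ℝ) :
    HasDerivAt (fun t : ℝ => r.normSq (A.expI (t • ξ) x))
      (-(2 * (k : ℝ) * A.moment (A.expI (t • ξ) x) ξ +
          W.liouvilleRate (A.JX ξ) (A.expI (t • ξ) x) / 2) *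
        r.normSq (A.expI (t • ξ) x)) t := by
  obtain ⟨y, hy⟩ : ∃ y, y = A.expI (t • ξ) x := ⟨_, rfl⟩
  have hi := L.mem_indexAt y
  have ha := H.mem_indexAt y
  set i := L.indexAt y
  set a := H.indexAt y
  obtain ⟨σ, h1, h2⟩ := L.exists_dFun_cJ_eq (hr i a y ⟨hi, ha⟩ (A.X ξ y))
    (b := Complex.I * (k : ℂ) * ((A.moment y ξ : ℝ) : ℂ) - H.lieCoeff (A.X ξ) a y)
    (by linear_combination hA ξ i a y ⟨hi, ha⟩)
  have hopen := (L.isOpen_U i).inter (H.isOpen_V a)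
  have h3 : MDifferentiableAt 𝓘(ℝ, Cn n) 𝓘(ℝ, ℂ) (r.coeff i a) (A.expI (t • ξ) x) := by
    rw [← hy]
    exact ((r.smooth i a).contMDiffAt (hopen.mem_nhds ⟨hi, ha⟩)).mdifferentiableAt (by simp)
  have h4 := A.hasDerivAt_comp_expI ξ x t h3
  have h5 : HasDerivAt (fun t : ℝ => r.coeff i a (A.expI (t • ξ) x))
      (σ * r.coeff i a (A.expI (t • ξ) x)) t := by
    refine h4.congr_deriv ?_
    rw [← hy]
    exact h1
  have h6 := A.hasDerivAt_frameNormSq_expI ξ x t H (a := a) (by rwa [← hy])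
  have hev : ∀ᶠ t' in nhds t, A.expI (t' • ξ) x ∈ L.U i ∩ H.V a :=
    (A.continuous_expI ξ x).continuousAt.eventually_mem
      (by rw [← hy]; exact hopen.mem_nhds ⟨hi, ha⟩)
  refine ((h5.norm_sq_of_eq_mul.mul h6).congr_of_eventuallyEq
    (hev.mono fun t' ht' => r.normSq_eq ht'.1 ht'.2)).congr_deriv ?_
  rw [r.normSq_eq hev.self_of_nhds.1 hev.self_of_nhds.2, h2, ← hy]
  simp only [Complex.sub_im, Complex.mul_im, Complex.mul_re, Complex.I_re, Complex.I_im,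
    Complex.natCast_re, Complex.natCast_im, Complex.ofReal_re, Complex.ofReal_im]
  ring

/-- The pointwise norm of an invariant holomorphic section, with values in half-forms, along
`t ↦ e^{itξ} · x`. -/
theorem normSq_expI (hr : r.IsHolomorphic) (hA : r.IsInvariant A) (ξ : 𝔤) (x : M) :
    r.normSq (A.expI ξ x) = r.normSq x *
      Real.exp (-∫ t in (0 : ℝ)..1, (2 * (k : ℝ) * A.moment (A.expI (t • ξ) x) ξ +
        W.liouvilleRate (A.JX ξ) (A.expI (t • ξ) x) / 2)) := by
  have h := eq_mul_exp_neg_integral ((continuous_const.mul (A.continuous_moment_expI ξ x)).add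
    (((A.continuous_liouvilleRate_JX ξ).comp (A.continuous_expI ξ x)).div_const 2))
    (r.hasDerivAt_normSq_expI A hr hA ξ x)
  rwa [one_smul, zero_smul, A.expI_zero] at h

end HalfFormBundle.Sections

end

theorem mainTheorem9 {n : ℕ} {M : Type*} [TopologicalSpace M] [ChartedSpace (Cn n) M]
    [IsManifold 𝓘(ℂ, Cn n) ω M] [T2Space M] [CompactSpace M] [ConnectedSpace M]
    {𝔤 : Type*} [NormedAddCommGroup 𝔤] [NormedSpace ℝ 𝔤] [FiniteDimensional ℝ 𝔤]
    {G : Type*} [TopologicalSpace G] [ChartedSpace 𝔤 G] [Group G] [LieGroup 𝓘(ℝ, 𝔤) ∞ G]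
    [T2Space G] [CompactSpace G] [ConnectedSpace G] [MulAction G M]
    (W : KahlerStructure n M) (A : HamiltonianAction W 𝔤 G) :
    -- `t ↦ e^{itξ} · x` is the integral curve of `J X^ξ` through `x`
    (∀ (ξ : 𝔤) (x : M), A.expI 0 x = x ∧
      IsMIntegralCurve (fun t : ℝ => A.expI (t • ξ) x) (A.JXfield ξ)) ∧
    -- (a)
    (∀ {ι : Type*} (L : PrequantumBundle W ι) (k : ℕ) (s : L.Sections k),
      s.IsHolomorphic → s.IsInvariant A →
      ∀ x₀ : M, A.moment x₀ = 0 → ∀ ξ : 𝔤,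
        s.normSq (A.expI ξ x₀) = s.normSq x₀ *
          Real.exp (-∫ t in (0 : ℝ)..1, 2 * (k : ℝ) * A.moment (A.expI (t • ξ) x₀) ξ)) ∧
    -- (b)
    (∀ {ι ι' : Type*} (L : PrequantumBundle W ι) (H : HalfFormBundle n M ι') (k : ℕ)
      (r : H.Sections L k), r.IsHolomorphic → r.IsInvariant A →
      ∀ x₀ : M, A.moment x₀ = 0 → ∀ ξ : 𝔤,
        r.normSq (A.expI ξ x₀) = r.normSq x₀ *
          Real.exp (-∫ t in (0 : ℝ)..1,
            (2 * (k : ℝ) * A.moment (A.expI (t • ξ) x₀) ξ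
              + W.liouvilleRate (A.JX ξ) (A.expI (t • ξ) x₀) / 2))) ∧
    -- the unique minimum of `ρ(·, x₀)`, and its Hessian there
    (∀ x₀ : M, A.moment x₀ = 0 →
      (∀ ξ : 𝔤, ξ ≠ 0 → A.rho 0 x₀ < A.rho ξ x₀) ∧
      (∀ᶠ ξ in nhds (0 : 𝔤), DifferentiableAt ℝ (fun η : 𝔤 => A.rho η x₀) ξ) ∧
      DifferentiableAt ℝ (fderiv ℝ (fun η : 𝔤 => A.rho η x₀)) 0 ∧
      ∀ ξ₁ ξ₂ : 𝔤, fderiv ℝ (fderiv ℝ (fun η : 𝔤 => A.rho η x₀)) 0 ξ₁ ξ₂ =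
        2 * W.metric x₀ (A.JX ξ₁ x₀) (A.JX ξ₂ x₀)) := by
  refine ⟨fun ξ x => ⟨A.expI_zero x, A.isMIntegralCurve_expI ξ x⟩, ?_, ?_, ?_⟩
  · exact fun L k s hs hA x₀ _ ξ => s.normSq_expI A hs hA ξ x₀
  · exact fun L H k r hr hA x₀ _ ξ => r.normSq_expI A hr hA ξ x₀
  · exact fun x₀ hx => ⟨fun ξ hξ => by rw [A.rho_zero]; exact A.rho_pos hx hξ, A.hessian_rho hx⟩
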